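/- Graphs are finite, simple and undirected, with nodes from a set $V$ of identifiers. A graph stream $S$ of length $T$ is a sequence of $T$ (possibly empty) finite sets of arriving nodes and edges, in which every node and edge arrives at most once and the endpoints of an edge arrive no later than the edge. $S_{[t]}$ denotes its first $t$ terms, and the flattened graph of $S_{[t]}$ consists of all nodes and edges arriving by time $t$. A graph is $(D,\ell)$-bounded if at most $\ell$ of its nodes have degree greater than $D$; $S$ is $(D,\ell)$-bounded through time $t$ if the flattened graph of $S_{[t]}$ is. Two streams of the same length are node-neighbors if one is obtained from the other by removing a node and all its edges, and edge-neighbors if one is obtained from the other by removing one edge, or an isolated node, or a node of degree $1$ together with its edge (degrees in the flattened graph). The distance $d_{\mathrm{node}}$ (resp. $d_{\mathrm{edge}}$) of two streams of the same length is the length of a shortest chain of streams joining them in which consecutive streams are node-neighbors (resp. edge-neighbors). Fix a linear order on the possible edges. The projections $\Pi^{\mathrm{BBDS}}_D$ and $\Pi^{\mathrm{DLL}}_D$ keep a counter $d(v)$ for each node, initially $0$, output every node when it arrives, and process the edges by arrival time and, within a time step, in the fixed order; an edge $\{u,v\}$ is output (at its arrival time) if and only if $d(u)<D$ and $d(v)<D$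 when it is processed. After an edge $\{u,v\}$ is processed, $d(u)$ and $d(v)$ are increased by $1$: always for $\Pi^{\mathrm{BBDS}}_D$, and only if the edge was output for $\Pi^{\mathrm{DLL}}_D$. **Theorem.** Let $D\ge 1$, $\ell\ge 0$, $T\ge 1$ be integers. (A) For every linear order on the edges, every stream $S$ of length $T$ and every $t\in\{1,\dots,T\}$, the flattened graphs of $\Pi^{\mathrm{BBDS}}_D(S)_{[t]}$ and $\Pi^{\mathrm{DLL}}_D(S)_{[t]}$ have maximum degree at most $D$. Moreover, for streams $S,S'$ of length $T$ and every $t\in\{1,\dots,T\}$: 1. If $S,S'$ are edge-neighbors, then (a) $d_{\mathrm{edge}}(\Pi^{\mathrm{BBDS}}_D(S)_{[t]},\Pi^{\mathrm{BBDS}}_D(S')_{[t]})\le 3$; (b) if $S,S'$ are $(D,\ell)$-bounded through time $t$, then $d_{\mathrm{edge}}(\Pi^{\mathrm{DLL}}_D(S)_{[t]},\Pi^{\mathrm{DLL}}_D(S')_{[t]})\le 2\ell+1$. 2. If $S,S'$ are node-neighbors and $(D,\ell)$-bounded through time $t$, then (a) $d_{\mathrm{edge}}(\Pi^{\mathrm{BBDS}}_D(S)_{[t]},\Pi^{\mathrm{BBDS}}_D(S')_{[t]})\le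 D+\ell$; (b) $d_{\mathrm{edge}}(\Pi^{\mathrm{DLL}}_D(S)_{[t]},\Pi^{\mathrm{DLL}}_D(S')_{[t]})\le D+2\ell\sqrt{\min\{D,\ell\}}$. 3. If $S,S'$ are node-neighbors and $(D,\ell)$-bounded through time $t$, then $d_{\mathrm{node}}(\Pi_D(S)_{[t]},\Pi_D(S')_{[t]})\le 2\ell+1$ for both (a) $\Pi_D=\Pi^{\mathrm{BBDS}}_D$ and (b) $\Pi_D=\Pi^{\mathrm{DLL}}_D$. (B) (Tightness.) Let $V$ be any infinite linearly ordered set, and order the edges $\{u,v\}$, $u<v$, lexicographically as pairs $(u,v)$. For each of the following items there are streams $S,S'$ of length $T$ (for $T=1$: graphs) with the stated distance between the projections through time $t$, for every $t\in\{1,\dots,T\}$; they are edge-neighbors in item 1 and node-neighbors in items 2 and 3, and, except in item 1(a), their flattened graphs are $(D,\ell)$-bounded: * 1(a), BBDS: $d_{\mathrm{edge}}=3$. * 1(b), DLL: $d_{\mathrm{edge}}=\ell+1$. * 2(a), BBDS: $d_{\mathrm{edge}}=D+\max\{\ell-1,0\}$. * 2(b), DLL: $d_{\mathrm{edge}}\ge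 D+c\,\ell\sqrt{\min\{D,\ell\}}$ whenever $D,\ell\ge N$, where $c>0$ and $N$ are absolute constants. * 3(a), BBDS: $d_{\mathrm{node}}=2\max\{\ell-1,0\}+1$. * 3(b), DLL: $d_{\mathrm{node}}=\ell+1$ if $\ell$ is even and $d_{\mathrm{node}}=\ell+2$ if $\ell$ is odd. In particular bound 1(a) is attained, bounds 2(a) and 3(a) are tight up to an additive constant of 2, and the other bounds are tight up to constant factors (2(b) for $D,\ell$ sufficiently large). -/

import Mathlib

/-- A finite simple graph whose vertices are drawn from the type `V` of node identifiers. -/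
structure FinGraph (V : Type*) where
  verts : Finset V
  edges : Finset (Sym2 V)
  not_isDiag : ∀ e ∈ edges, ¬ e.IsDiag
  endpoint_mem : ∀ e ∈ edges, ∀ v ∈ e, v ∈ verts

namespace FinGraph

variable {V : Type*} [DecidableEq V]

/-- The degree of `v`: the number of edges incident to `v`. -/
def degree (G : FinGraph V) (v : V) : ℕ :=
  (G.edges.filter fun e => v ∈ e).card

/-- `G` is `(D, ℓ)`-bounded: at most `ℓ` nodes have degree greater than `D`. -/
def IsBounded (G : FinGraph V) (D l : ℕ) : Prop :=
  (G.verts.filter fun v => D < G.degree v).card ≤ l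

/-- `G` is `D`-bounded: its maximum degree is at most `D`. -/
def MaxDegreeLE (G : FinGraph V) (D : ℕ) : Prop :=
  ∀ v ∈ G.verts, G.degree v ≤ D

end FinGraph

/-- A graph stream of length `T`: at each time step a finite set of nodes and a finite set of edges
arrive (both empty if nothing arrives, the symbol `⊥`). Every node and every edge arrives
at most once, there are no loops, and the endpoints of an edge arrive no later than the edge.
The time steps `1, …, T` are indexed by `Fin T`. -/
structure GraphStream (V : Type*) (T : ℕ) where
  nodes : Fin T → Finset V
  edges : Fin T → Finset (Sym2 V)
  nodes_disjoint : ∀ i j, i ≠ j → Disjoint (nodes i) (nodes j)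
  edges_disjoint : ∀ i j, i ≠ j → Disjoint (edges i) (edges j)
  not_isDiag : ∀ i, ∀ e ∈ edges i, ¬ e.IsDiag
  endpoint_arrived : ∀ i, ∀ e ∈ edges i, ∀ v ∈ e, ∃ j ≤ i, v ∈ nodes j

namespace GraphStream

variable {V : Type*} {T : ℕ}

/-- The prefix `S_[t]` of a stream: its first `t` time steps. -/
def upTo (S : GraphStream V T) (t : ℕ) (ht : t ≤ T) : GraphStream V t where
  nodes i := S.nodes (Fin.castLE ht i)
  edges i := S.edges (Fin.castLE ht i)
  nodes_disjoint i j hij :=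
    S.nodes_disjoint _ _ fun h => hij (Fin.castLE_injective ht h)
  edges_disjoint i j hij :=
    S.edges_disjoint _ _ fun h => hij (Fin.castLE_injective ht h)
  not_isDiag i := S.not_isDiag _
  endpoint_arrived i e he v hv := by
    obtain ⟨j, hj, hvj⟩ := S.endpoint_arrived _ e he v hv
    have hlt : (j : ℕ) < t := lt_of_le_of_lt (Fin.le_def.mp hj) i.isLt
    exact ⟨⟨j, hlt⟩, Fin.le_def.mpr (Fin.le_def.mp hj), hvj⟩

variable [DecidableEq V]

/-- The flattened graph: all nodes and edges that arrive during the stream. -/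
def flatten (S : GraphStream V T) : FinGraph V where
  verts := Finset.univ.biUnion S.nodes
  edges := Finset.univ.biUnion S.edges
  not_isDiag e he := by
    obtain ⟨i, -, hi⟩ := Finset.mem_biUnion.mp he
    exact S.not_isDiag i e hi
  endpoint_mem e he v hv := by
    obtain ⟨i, -, hi⟩ := Finset.mem_biUnion.mp he
    obtain ⟨j, -, hj⟩ := S.endpoint_arrived i e hi v hv
    exact Finset.mem_biUnion.mpr ⟨j, Finset.mem_univ j, hj⟩

/-- `S` is `(D, ℓ)`-bounded through time `t`. -/
def BoundedThrough (S : GraphStream V T) (D l t : ℕ) (ht : t ≤ T) : Prop :=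
  (S.upTo t ht).flatten.IsBounded D l

/-! ### Neighboring streams and distances -/

/-- `S'` is obtained from `S` by removing the node `v` of `S` and all edges incident to it
(the node and its edges may arrive at different time steps). -/
def RemovesNode (S S' : GraphStream V T) (v : V) : Prop :=
  v ∈ S.flatten.verts ∧
    (∀ i, S'.nodes i = (S.nodes i).erase v) ∧
    (∀ i, S'.edges i = (S.edges i).filter fun e => v ∉ e)

/-- `S'` is obtained from `S` by removing the edge `e` of `S` (all nodes are kept). -/
def RemovesEdge (S S' : GraphStream V T) (e : Sym2 V) : Prop :=
  e ∈ S.flatten.edges ∧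
    (∀ i, S'.nodes i = S.nodes i) ∧
    (∀ i, S'.edges i = (S.edges i).erase e)

/-- `S'` is obtained from `S` by removing a node and all of its edges. -/
def NodeStep (S S' : GraphStream V T) : Prop :=
  ∃ v, RemovesNode S S' v

/-- `S'` is obtained from `S` by removing one edge, an isolated node, or a node of degree `1`
together with its edge. -/
def EdgeStep (S S' : GraphStream V T) : Prop :=
  (∃ e, RemovesEdge S S' e) ∨ ∃ v, S.flatten.degree v ≤ 1 ∧ RemovesNode S S' v

/-- Node-neighboring streams. -/
def NodeNeighbor (S S' : GraphStream V T) : Prop :=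
  NodeStep S S' ∨ NodeStep S' S

/-- Edge-neighboring streams. -/
def EdgeNeighbor (S S' : GraphStream V T) : Prop :=
  EdgeStep S S' ∨ EdgeStep S' S

theorem RemovesNode.irrefl (S : GraphStream V T) (v : V) : ¬ RemovesNode S S v := by
  rintro ⟨hv, hn, -⟩
  obtain ⟨i, -, hi⟩ := Finset.mem_biUnion.mp hv
  rw [hn i] at hi
  exact Finset.notMem_erase v _ hi

theorem RemovesEdge.irrefl (S : GraphStream V T) (e : Sym2 V) : ¬ RemovesEdge S S e := by
  rintro ⟨he, -, hn⟩
  obtain ⟨i, -, hi⟩ := Finset.mem_biUnion.mp he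
  rw [hn i] at hi
  exact Finset.notMem_erase e _ hi

/-- The graph on all streams of length `T` in which node-neighboring streams are adjacent. -/
def nodeNeighborGraph (V : Type*) [DecidableEq V] (T : ℕ) : SimpleGraph (GraphStream V T) where
  Adj := NodeNeighbor
  symm := ⟨fun _ _ h => Or.symm h⟩
  loopless := ⟨by
    rintro S (⟨v, h⟩ | ⟨v, h⟩) <;> exact RemovesNode.irrefl S v h⟩

/-- The graph on all streams of length `T` in which edge-neighboring streams are adjacent. -/
def edgeNeighborGraph (V : Type*) [DecidableEq V] (T : ℕ) : SimpleGraph (GraphStream V T) where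
  Adj := EdgeNeighbor
  symm := ⟨fun _ _ h => Or.symm h⟩
  loopless := ⟨by
    rintro S ((⟨e, h⟩ | ⟨v, -, h⟩) | (⟨e, h⟩ | ⟨v, -, h⟩))
    · exact RemovesEdge.irrefl S e h
    · exact RemovesNode.irrefl S v h
    · exact RemovesEdge.irrefl S e h
    · exact RemovesNode.irrefl S v h⟩

/-- Node distance: the length of a shortest chain of streams, consecutive ones being
node-neighbors. -/
noncomputable def nodeDist (S S' : GraphStream V T) : ℕ∞ :=
  (nodeNeighborGraph V T).edist S S'

/-- Edge distance: the length of a shortest chain of streams, consecutive ones being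
edge-neighbors. -/
noncomputable def edgeDist (S S' : GraphStream V T) : ℕ∞ :=
  (edgeNeighborGraph V T).edist S S'

end GraphStream

/-! ### The time-aware projections -/

/-- The inclusion criterion: `original` gives the BBDS projection, `projected` the DLL one. -/
inductive Criterion
  | original
  | projected

namespace TimeAwareProjection

open GraphStream

variable {V : Type*} {T : ℕ}

/-- Both endpoints of `e` have counter value less than `D`. -/
def AddEdge (D : ℕ) (d : V → ℕ) (e : Sym2 V) : Prop :=
  ∀ v ∈ e, d v < D

/-- The edges of a time step listed in increasing order. -/
def arrivalList (ord : LinearOrder (Sym2 V)) (S : GraphStream V T) (i : Fin T) :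
    List (Sym2 V) :=
  (S.edges i).sort ord.le

variable [DecidableEq V]

instance (D : ℕ) (d : V → ℕ) (e : Sym2 V) : Decidable (AddEdge D d e) :=
  decidable_of_iff (∀ v ∈ e.toFinset, d v < D) (by simp [AddEdge])

/-- Increment the counters of both endpoints of `e`. -/
def increment (d : V → ℕ) (e : Sym2 V) : V → ℕ :=
  fun v => if v ∈ e then d v + 1 else d v

/-- Process one edge. The state consists of the counters `d` and of the set of the edges
of the current time step that have been included so far. -/
def processEdge (c : Criterion) (D : ℕ) (s : (V → ℕ) × Finset (Sym2 V)) (e : Sym2 V) :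
    (V → ℕ) × Finset (Sym2 V) :=
  if AddEdge D s.1 e then (increment s.1 e, insert e s.2)
  else
    match c with
    | .original => (increment s.1 e, s.2)
    | .projected => s

/-- Process the edges of one time step, in the order of the list, from counters `d`. -/
def processStep (c : Criterion) (D : ℕ) (d : V → ℕ) (es : List (Sym2 V)) :
    (V → ℕ) × Finset (Sym2 V) :=
  es.foldl (processEdge c D) (d, ∅)

/-- The counters after the first `n` time steps. All counters start at `0`; a counter is never
touched before its node arrives, so this is the same as setting it to `0` on arrival. -/
def counters (c : Criterion) (ord : LinearOrder (Sym2 V)) (D : ℕ) (S : GraphStream V T) :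
    ℕ → V → ℕ
  | 0 => fun _ => 0
  | n + 1 =>
    if h : n < T then
      (processStep c D (counters c ord D S n) (arrivalList ord S ⟨n, h⟩)).1
    else counters c ord D S n

/-- The edges that the projection outputs at time step `i`. -/
def projEdges (c : Criterion) (ord : LinearOrder (Sym2 V)) (D : ℕ) (S : GraphStream V T)
    (i : Fin T) : Finset (Sym2 V) :=
  (processStep c D (counters c ord D S i) (arrivalList ord S i)).2

theorem foldl_processEdge_subset (c : Criterion) (D : ℕ) (es : List (Sym2 V)) :
    ∀ s : (V → ℕ) × Finset (Sym2 V), ∀ e ∈ (es.foldl (processEdge c D) s).2, e ∈ s.2 ∨ e ∈ es := by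
  induction es with
  | nil => intro s e he; exact Or.inl he
  | cons a es ih =>
    intro s e he
    rcases ih _ e he with h | h
    · unfold processEdge at h
      split_ifs at h
      · rcases Finset.mem_insert.mp h with h | h
        · exact Or.inr (by simp [h])
        · exact Or.inl h
      · cases c <;> exact Or.inl h
    · exact Or.inr (List.mem_cons_of_mem _ h)

theorem projEdges_subset (c : Criterion) (ord : LinearOrder (Sym2 V)) (D : ℕ)
    (S : GraphStream V T) (i : Fin T) : projEdges c ord D S i ⊆ S.edges i := by
  intro e he
  rcases foldl_processEdge_subset c D _ _ e he with h | h
  · exact absurd h (Finset.notMem_empty e)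
  · exact (Finset.mem_sort _).mp h

end TimeAwareProjection

open TimeAwareProjection in
/-- The time-aware projection `Π_D` with inclusion criterion `c`; edges arriving in the same time
step are considered in the order `ord`. All nodes are output when they arrive. -/
def GraphStream.proj {V : Type*} [DecidableEq V] {T : ℕ} (c : Criterion)
    (ord : LinearOrder (Sym2 V)) (D : ℕ) (S : GraphStream V T) : GraphStream V T where
  nodes := S.nodes
  edges := projEdges c ord D S
  nodes_disjoint := S.nodes_disjoint
  edges_disjoint i j hij :=
    Finset.disjoint_of_subset_left (projEdges_subset c ord D S i)
      (Finset.disjoint_of_subset_right (projEdges_subset c ord D S j) (S.edges_disjoint i j hij))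
  not_isDiag i e he := S.not_isDiag i e (projEdges_subset c ord D S i he)
  endpoint_arrived i e he := S.endpoint_arrived i e (projEdges_subset c ord D S i he)

/-- The lexicographic order on edges: `{u, v}` with `u ≤ v` is compared as the pair `(u, v)`. -/
abbrev lexEdgeOrder (V : Type*) [LinearOrder V] : LinearOrder (Sym2 V) :=
  LinearOrder.lift' (fun e : Sym2 V => toLex (e.inf, e.sup)) (by
    intro e f h
    have h' := Prod.ext_iff.mp (toLex.injective h)
    exact Sym2.inf_eq_inf_and_sup_eq_sup.mp h')

/-- The projection based on degrees in the original stream. -/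
abbrev GraphStream.bbds {V : Type*} [DecidableEq V] {T : ℕ} (ord : LinearOrder (Sym2 V)) (D : ℕ)
    (S : GraphStream V T) : GraphStream V T :=
  S.proj Criterion.original ord D

/-- The projection based on degrees in the projected stream. -/
abbrev GraphStream.dll {V : Type*} [DecidableEq V] {T : ℕ} (ord : LinearOrder (Sym2 V)) (D : ℕ)
    (S : GraphStream V T) : GraphStream V T :=
  S.proj Criterion.projected ord D

/-! Injective keys sort the edges by arrival time and then by the fixed order. The output A on an
edge set E is then described statically by `IsProj`: an edge of E lies in A iff at each endpoint
fewer than D counted edges precede it. A neighboring stream restricts E to a subset under the same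
keys, so everything reduces to the set H of surviving edges on which the two outputs A and B
disagree.

BBDS: removal only lowers the counts, so every edge of H is rejected with the larger E and accepted
with the smaller. Such an edge has an endpoint x of degree above D that lost an edge and had exactly
D edges before this one. Only one edge at x has exactly D predecessors, so H injects into these
nodes (`IsProj.original_card_le`).

DLL: every edge of H is blocked by an endpoint that is saturated in the output rejecting it. A node
x blocks at most as many edges as H has other edges at x, plus the number s x of removed edges of A
at x. Ranking nodes by the earliest edge they block, an edge runs upward from its blocker to any
other ranked endpoint, unless both block it (`IsProj.exists_isBlocking`). This behaves like a flow
of total supply k = ∑ s: at most k edges leave an initial segment of the ranks (`card_crossing_le`).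
So each node blocks at most k edges and |H| ≤ k l, where k ≤ 2 for edge-neighbors. For
node-neighbors k ≤ min {D, l}, and a relation on n ranks with at most k pairs over every cut has at
most √(2n(n-1)k) pairs (`sq_card_le_of_cut`), because the pairs have total length at most (n-1)k
while r pairs with a common lower end have total length at least r²/2.

For the node distance it suffices that a few nodes cover H: each is removed and reinserted.
Conversely, an edge step changes at most one edge, and a node present in both streams is touched an
even number of times by a chain, so each edge of a differing matching costs two steps
(`matching_le_nodeDist`).

Tightness for BBDS comes from stars whose last leaf is displaced by one extra edge. For DLL it comes
from layered networks in which each hub is saturated exactly when it keeps its edges from the layer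
below. Acceptance then alternates between layers, and removing the root flips the parity, which
changes every edge that is not pendant at a hub. A path of hubs and a grid of complete layers give
the two bounds. -/

namespace GraphStream

/-! ### Extensionality and membership for streams -/

variable {V : Type*} {T : ℕ}

theorem ext_of_eq {S S' : GraphStream V T} (hn : ∀ i, S.nodes i = S'.nodes i)
    (he : ∀ i, S.edges i = S'.edges i) : S = S' := by
  cases S
  cases S'
  obtain rfl := funext hn
  obtain rfl := funext he
  rfl

theorem edges_time_unique {S : GraphStream V T} {e : Sym2 V} {i j : Fin T} (hi : e ∈ S.edges i)
    (hj : e ∈ S.edges j) : i = j := by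
  by_contra h
  exact Finset.disjoint_left.mp (S.edges_disjoint i j h) hi hj

variable [DecidableEq V]

theorem mem_flatten_verts {S : GraphStream V T} {v : V} :
    v ∈ S.flatten.verts ↔ ∃ i, v ∈ S.nodes i := by
  simp [flatten]

theorem mem_flatten_edges {S : GraphStream V T} {e : Sym2 V} :
    e ∈ S.flatten.edges ↔ ∃ i, e ∈ S.edges i := by
  simp [flatten]

/-! ### Prefixes -/

open TimeAwareProjection in
theorem counters_upTo (c : Criterion) (ord : LinearOrder (Sym2 V)) (D : ℕ) (S : GraphStream V T)
    (t : ℕ) (ht : t ≤ T) (n : ℕ) (hn : n ≤ t) :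
    counters c ord D (S.upTo t ht) n = counters c ord D S n := by
  induction n with
  | zero => rfl
  | succ n ih =>
    have h1 : n < t := hn
    have h2 : n < T := h1.trans_le ht
    simp only [counters, dif_pos h1, dif_pos h2, ih h1.le]
    rfl

theorem proj_upTo (c : Criterion) (ord : LinearOrder (Sym2 V)) (D : ℕ) (S : GraphStream V T)
    (t : ℕ) (ht : t ≤ T) : (S.proj c ord D).upTo t ht = (S.upTo t ht).proj c ord D := by
  refine ext_of_eq (fun i => rfl) (fun i => ?_)
  change TimeAwareProjection.projEdges c ord D S (Fin.castLE ht i) =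
    TimeAwareProjection.projEdges c ord D (S.upTo t ht) i
  unfold TimeAwareProjection.projEdges
  rw [counters_upTo c ord D S t ht i i.isLt.le]
  rfl

/-- If `v` has not arrived by time `t`, none of its edges has, and the two prefixes coincide. -/
theorem RemovesNode.upTo {S S' : GraphStream V T} {v : V} (h : RemovesNode S S' v) (t : ℕ)
    (ht : t ≤ T) :
    S.upTo t ht = S'.upTo t ht ∨ RemovesNode (S.upTo t ht) (S'.upTo t ht) v := by
  by_cases hv : v ∈ (S.upTo t ht).flatten.verts
  · exact Or.inr ⟨hv, fun i => h.2.1 _, fun i => h.2.2 _⟩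
  · left
    refine ext_of_eq (fun i => ?_) (fun i => ?_)
    · refine ((h.2.1 _).trans (Finset.erase_eq_of_notMem fun hi => hv ?_)).symm
      exact mem_flatten_verts.mpr ⟨i, hi⟩
    · refine ((h.2.2 _).trans (Finset.filter_true_of_mem fun e he hve => hv ?_)).symm
      exact (S.upTo t ht).flatten.endpoint_mem e (mem_flatten_edges.mpr ⟨i, he⟩) v hve

theorem RemovesEdge.upTo {S S' : GraphStream V T} {e : Sym2 V} (h : RemovesEdge S S' e) (t : ℕ)
    (ht : t ≤ T) :
    S.upTo t ht = S'.upTo t ht ∨ RemovesEdge (S.upTo t ht) (S'.upTo t ht) e := by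
  by_cases hv : e ∈ (S.upTo t ht).flatten.edges
  · exact Or.inr ⟨hv, fun i => h.2.1 _, fun i => h.2.2 _⟩
  · left
    refine ext_of_eq (fun i => (h.2.1 _).symm) (fun i => ?_)
    refine ((h.2.2 _).trans (Finset.erase_eq_of_notMem fun hi => hv ?_)).symm
    exact mem_flatten_edges.mpr ⟨i, hi⟩

theorem degree_upTo_le (S : GraphStream V T) (t : ℕ) (ht : t ≤ T) (v : V) :
    (S.upTo t ht).flatten.degree v ≤ S.flatten.degree v := by
  refine Finset.card_le_card (Finset.filter_subset_filter _ fun e he => ?_)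
  obtain ⟨i, hi⟩ := mem_flatten_edges.mp he
  exact mem_flatten_edges.mpr ⟨_, hi⟩

theorem EdgeStep.upTo {S S' : GraphStream V T} (h : EdgeStep S S') (t : ℕ) (ht : t ≤ T) :
    S.upTo t ht = S'.upTo t ht ∨ EdgeStep (S.upTo t ht) (S'.upTo t ht) := by
  rcases h with ⟨e, h⟩ | ⟨v, hd, h⟩
  · exact (h.upTo t ht).imp_right fun h => Or.inl ⟨e, h⟩
  · exact (h.upTo t ht).imp_right fun h => Or.inr ⟨v, (S.degree_upTo_le t ht v).trans hd, h⟩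

/-! ### Substreams and upper bounds for the distances -/

/-- The part of a stream on the nodes `W` formed by the edges in `F`. -/
def sub (U : GraphStream V T) (W : Finset V) (F : Finset (Sym2 V)) : GraphStream V T where
  nodes i := (U.nodes i).filter (· ∈ W)
  edges i := (U.edges i).filter fun e => e ∈ F ∧ e.toFinset ⊆ W
  nodes_disjoint i j h := Finset.disjoint_filter_filter (U.nodes_disjoint i j h)
  edges_disjoint i j h := Finset.disjoint_filter_filter (U.edges_disjoint i j h)
  not_isDiag i e he := U.not_isDiag i e (Finset.mem_filter.mp he).1
  endpoint_arrived i e he v hv := by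
    obtain ⟨h1, -, h3⟩ := Finset.mem_filter.mp he
    obtain ⟨j, hj, hvj⟩ := U.endpoint_arrived i e h1 v hv
    exact ⟨j, hj, Finset.mem_filter.mpr ⟨hvj, h3 (Sym2.mem_toFinset.mpr hv)⟩⟩

theorem mem_sub_edges {U : GraphStream V T} {W : Finset V} {F : Finset (Sym2 V)} {i : Fin T}
    {e : Sym2 V} : e ∈ (U.sub W F).edges i ↔ e ∈ U.edges i ∧ e ∈ F ∧ ∀ v ∈ e, v ∈ W := by
  simp [sub, Finset.subset_iff]

theorem mem_sub_nodes {U : GraphStream V T} {W : Finset V} {F : Finset (Sym2 V)} {i : Fin T}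
    {v : V} : v ∈ (U.sub W F).nodes i ↔ v ∈ U.nodes i ∧ v ∈ W := by
  simp [sub]

theorem sub_flatten_edges_subset (U : GraphStream V T) (W : Finset V) (F : Finset (Sym2 V)) :
    (U.sub W F).flatten.edges ⊆ F := by
  intro e he
  obtain ⟨i, hi⟩ := mem_flatten_edges.mp he
  exact (mem_sub_edges.mp hi).2.1

theorem edgeDist_comm (S S' : GraphStream V T) : S.edgeDist S' = S'.edgeDist S :=
  SimpleGraph.edist_comm

theorem nodeDist_comm (S S' : GraphStream V T) : S.nodeDist S' = S'.nodeDist S :=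
  SimpleGraph.edist_comm

theorem edgeDist_triangle (S S' S'' : GraphStream V T) :
    S.edgeDist S'' ≤ S.edgeDist S' + S'.edgeDist S'' :=
  SimpleGraph.edist_triangle

theorem nodeDist_triangle (S S' S'' : GraphStream V T) :
    S.nodeDist S'' ≤ S.nodeDist S' + S'.nodeDist S'' :=
  SimpleGraph.edist_triangle

theorem edgeDist_self (S : GraphStream V T) : S.edgeDist S = 0 :=
  SimpleGraph.edist_self

theorem nodeDist_self (S : GraphStream V T) : S.nodeDist S = 0 :=
  SimpleGraph.edist_self

theorem edgeDist_sub_insert_le_one (U : GraphStream V T) (W : Finset V) (F : Finset (Sym2 V))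
    (e : Sym2 V) : (U.sub W F).edgeDist (U.sub W (insert e F)) ≤ 1 := by
  refine SimpleGraph.edist_le_one_iff_adj_or_eq.mpr ?_
  by_cases heF : e ∈ F
  · rw [Finset.insert_eq_self.mpr heF]
    exact Or.inr rfl
  by_cases he : e ∈ (U.sub W (insert e F)).flatten.edges
  · left
    refine Or.inr (Or.inl ⟨e, he, fun i => rfl, fun i => ?_⟩)
    ext f
    simp only [Finset.mem_erase, mem_sub_edges, Finset.mem_insert]
    constructor
    · rintro ⟨h1, h2, h3⟩
      exact ⟨fun h => heF (h ▸ h2), h1, Or.inr h2, h3⟩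
    · rintro ⟨h0, h1, h2, h3⟩
      exact ⟨h1, h2.resolve_left h0, h3⟩
  · right
    refine ext_of_eq (fun i => rfl) (fun i => ?_)
    ext f
    constructor
    · intro h
      obtain ⟨h1, h2, h3⟩ := mem_sub_edges.mp h
      exact mem_sub_edges.mpr ⟨h1, Finset.mem_insert_of_mem h2, h3⟩
    · intro h
      obtain ⟨h1, h2, h3⟩ := mem_sub_edges.mp h
      refine mem_sub_edges.mpr ⟨h1, (Finset.mem_insert.mp h2).resolve_left ?_, h3⟩
      rintro rfl
      exact he (mem_flatten_edges.mpr ⟨i, h⟩)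

theorem edgeDist_sub_union_le (U : GraphStream V T) (W : Finset V) (F R : Finset (Sym2 V)) :
    (U.sub W F).edgeDist (U.sub W (R ∪ F)) ≤ R.card := by
  induction R using Finset.induction_on with
  | empty => simp [edgeDist_self]
  | insert e R he ih =>
    rw [Finset.insert_union, Finset.card_insert_of_notMem he]
    refine (edgeDist_triangle _ _ _).trans (add_le_add ih
      (edgeDist_sub_insert_le_one U W _ e)) |>.trans ?_
    simp

/-- The chain passes through the common part `F ∩ F'`. -/
theorem edgeDist_sub_le (U : GraphStream V T) (W : Finset V) (F F' : Finset (Sym2 V)) :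
    (U.sub W F).edgeDist (U.sub W F') ≤ (symmDiff F F').card := by
  have h1 := edgeDist_sub_union_le U W (F ∩ F') (F \ F')
  have h2 := edgeDist_sub_union_le U W (F ∩ F') (F' \ F)
  have e1 : F \ F' ∪ F ∩ F' = F := Finset.sdiff_union_inter F F'
  have e2 : F' \ F ∪ F ∩ F' = F' := by rw [Finset.inter_comm]; exact Finset.sdiff_union_inter F' F
  rw [e1, edgeDist_comm] at h1
  rw [e2] at h2
  refine (edgeDist_triangle _ (U.sub W (F ∩ F')) _).trans ((add_le_add h1 h2).trans ?_)
  rw [symmDiff, Finset.sup_eq_union, Finset.card_union_of_disjoint disjoint_sdiff_sdiff]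
  simp

theorem sub_removesNode_or_eq (U : GraphStream V T) (W : Finset V) (F : Finset (Sym2 V)) (v : V) :
    RemovesNode (U.sub W F) (U.sub (W.erase v) F) v ∨ U.sub W F = U.sub (W.erase v) F := by
  have hn : ∀ i, (U.sub (W.erase v) F).nodes i = ((U.sub W F).nodes i).erase v := by
    intro i
    ext x
    simp only [mem_sub_nodes, Finset.mem_erase]
    tauto
  have he : ∀ i, (U.sub (W.erase v) F).edges i = ((U.sub W F).edges i).filter (v ∉ ·) := by
    intro i
    ext e
    simp only [mem_sub_edges, Finset.mem_filter, Finset.mem_erase]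
    constructor
    · rintro ⟨h1, h2, h3⟩
      exact ⟨⟨h1, h2, fun x hx => (h3 x hx).2⟩, fun hv => (h3 v hv).1 rfl⟩
    · rintro ⟨⟨h1, h2, h3⟩, h4⟩
      exact ⟨h1, h2, fun x hx => ⟨fun h => h4 (h ▸ hx), h3 x hx⟩⟩
  by_cases hv : v ∈ (U.sub W F).flatten.verts
  · exact Or.inl ⟨hv, hn, he⟩
  · right
    refine ext_of_eq (fun i => ?_) (fun i => ?_)
    · rw [hn i, Finset.erase_eq_of_notMem fun h => hv (mem_flatten_verts.mpr ⟨i, h⟩)]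
    · rw [he i]
      symm
      refine Finset.filter_true_of_mem fun e he hve => hv ?_
      exact (U.sub W F).flatten.endpoint_mem e (mem_flatten_edges.mpr ⟨i, he⟩) v hve

theorem nodeDist_sub_erase_le_one (U : GraphStream V T) (W : Finset V) (F : Finset (Sym2 V))
    (v : V) : (U.sub W F).nodeDist (U.sub (W.erase v) F) ≤ 1 := by
  refine SimpleGraph.edist_le_one_iff_adj_or_eq.mpr ?_
  exact (sub_removesNode_or_eq U W F v).imp_left fun h => Or.inl ⟨v, h⟩

theorem nodeDist_sub_sdiff_le (U : GraphStream V T) (W X : Finset V) (F : Finset (Sym2 V)) :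
    (U.sub W F).nodeDist (U.sub (W \ X) F) ≤ X.card := by
  induction X using Finset.induction_on with
  | empty => simp [nodeDist_self]
  | insert x X hx ih =>
    rw [Finset.card_insert_of_notMem hx, Finset.sdiff_insert]
    have := nodeDist_sub_erase_le_one U (W \ X) F x
    refine (nodeDist_triangle _ _ _).trans ((add_le_add ih this).trans ?_)
    simp

/-- Streams on the same nodes whose differing edges are covered by `X`. -/
theorem nodeDist_sub_le_of_cover (U : GraphStream V T) (W X : Finset V) (F F' : Finset (Sym2 V))
    (hX : ∀ e ∈ symmDiff F F', ∃ x ∈ X, x ∈ e) :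
    (U.sub W F).nodeDist (U.sub W F') ≤ (2 * X.card : ℕ) := by
  have h1 := nodeDist_sub_sdiff_le U W X F
  have h2 := nodeDist_sub_sdiff_le U W X F'
  -- Once the cover is gone the streams agree, so removing `X` and reinserting it joins them; hence
  -- the factor 2.
  have e1 : U.sub (W \ X) F = U.sub (W \ X) F' := by
    refine ext_of_eq (fun i => rfl) (fun i => ?_)
    ext e
    simp only [mem_sub_edges]
    have key : (∀ v ∈ e, v ∈ W \ X) → (e ∈ F ↔ e ∈ F') := by
      intro h
      by_contra hne
      obtain ⟨x, hx, hxe⟩ := hX e (by rw [Finset.mem_symmDiff]; tauto)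
      exact (Finset.mem_sdiff.mp (h x hxe)).2 hx
    tauto
  rw [← e1, nodeDist_comm] at h2
  refine (nodeDist_triangle _ _ _).trans ((add_le_add h1 h2).trans ?_)
  rw [two_mul]
  simp

/-- One step removes `v` with all its edges; only differing edges that avoid `v` still need a cover.
-/
theorem nodeDist_sub_erase_le_of_cover (U : GraphStream V T) (W X : Finset V)
    (F F' : Finset (Sym2 V)) (v : V)
    (hX : ∀ e ∈ symmDiff F F', v ∉ e → ∃ x ∈ X, x ∈ e) :
    (U.sub W F).nodeDist (U.sub (W.erase v) F') ≤ (2 * X.card + 1 : ℕ) := by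
  have h1 := nodeDist_sub_erase_le_one U W F v
  have e1 : ∀ F : Finset (Sym2 V), U.sub (W.erase v) F = U.sub (W.erase v) (F.filter (v ∉ ·)) := by
    intro F
    refine ext_of_eq (fun i => rfl) (fun i => ?_)
    ext e
    simp only [mem_sub_edges, Finset.mem_filter, Finset.mem_erase]
    exact ⟨fun ⟨h1, h2, h3⟩ => ⟨h1, ⟨h2, fun hv => (h3 v hv).1 rfl⟩, h3⟩,
      fun ⟨h1, h2, h3⟩ => ⟨h1, h2.1, h3⟩⟩
  rw [e1 F] at h1
  have h2 := nodeDist_sub_le_of_cover U (W.erase v) X (F.filter (v ∉ ·)) (F'.filter (v ∉ ·)) (by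
    intro e he
    simp only [Finset.mem_symmDiff, Finset.mem_filter] at he
    refine hX e ?_ (by tauto)
    rw [Finset.mem_symmDiff]
    tauto)
  rw [e1 F']
  refine (nodeDist_triangle _ _ _).trans ((add_le_add h1 h2).trans ?_)
  rw [add_comm (2 * X.card)]
  simp

/-- Removing a node: the node can be removed together with its last edge. -/
theorem edgeDist_sub_erase_le (U : GraphStream V T) (W : Finset V) (F F' : Finset (Sym2 V)) (v : V)
    (hF' : ∀ e ∈ F', v ∉ e) :
    (U.sub W F).edgeDist (U.sub (W.erase v) F') ≤
      (((symmDiff F F').filter (v ∉ ·)).card + max 1 (F.filter (v ∈ ·)).card : ℕ) := by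
  have last : ∀ F₀ : Finset (Sym2 V), (F₀.filter (v ∈ ·)).card ≤ 1 →
      (U.sub W F₀).edgeDist (U.sub (W.erase v) F₀) ≤ 1 := by
    intro F₀ h
    refine SimpleGraph.edist_le_one_iff_adj_or_eq.mpr ?_
    refine (sub_removesNode_or_eq U W F₀ v).imp_left fun h' => Or.inl (Or.inr ⟨v, ?_, h'⟩)
    exact (Finset.card_le_card (Finset.filter_subset_filter _
      (sub_flatten_edges_subset U W F₀))).trans h
  have e1 : ∀ F : Finset (Sym2 V), U.sub (W.erase v) F = U.sub (W.erase v) (F.filter (v ∉ ·)) := by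
    intro F
    refine ext_of_eq (fun i => rfl) (fun i => ?_)
    ext e
    simp only [mem_sub_edges, Finset.mem_filter, Finset.mem_erase]
    exact ⟨fun ⟨h1, h2, h3⟩ => ⟨h1, ⟨h2, fun hv => (h3 v hv).1 rfl⟩, h3⟩,
      fun ⟨h1, h2, h3⟩ => ⟨h1, h2.1, h3⟩⟩
  have h2 : (U.sub (W.erase v) F).edgeDist (U.sub (W.erase v) F') ≤
      ((symmDiff F F').filter (v ∉ ·)).card := by
    rw [e1 F]
    refine (edgeDist_sub_le _ _ _ _).trans ?_
    have : symmDiff (F.filter (v ∉ ·)) F' = (symmDiff F F').filter (v ∉ ·) := by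
      ext e
      have := hF' e
      simp only [Finset.mem_symmDiff, Finset.mem_filter]
      tauto
    rw [this]
  -- The maximum with 1 accounts for an isolated `v`, whose removal still takes a step.
  have h1 : (U.sub W F).edgeDist (U.sub (W.erase v) F) ≤ (max 1 (F.filter (v ∈ ·)).card : ℕ) := by
    rcases (F.filter (v ∈ ·)).eq_empty_or_nonempty with h | ⟨e, he⟩
    · refine (last F (by rw [h]; simp)).trans ?_
      rw [h]; simp
    -- All edges at `v` but `e` are removed singly; `e` leaves together with `v`, which then has
    -- degree at most 1.
    · set F₀ := insert e (F.filter (v ∉ ·)) with hF₀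
      obtain ⟨heF, hve⟩ := Finset.mem_filter.mp he
      have a1 : (U.sub W F).edgeDist (U.sub W F₀) ≤ ((F.filter (v ∈ ·)).card - 1 : ℕ) := by
        refine (edgeDist_sub_le _ _ _ _).trans ?_
        rw [← Finset.card_erase_of_mem he]
        refine Nat.cast_le.mpr (Finset.card_le_card fun f hf => ?_)
        simp only [Finset.mem_symmDiff, hF₀, Finset.mem_insert, Finset.mem_filter,
          Finset.mem_erase] at hf ⊢
        rcases hf with ⟨h1, h2⟩ | ⟨h1, h2⟩
        · tauto
        · rcases h1 with rfl | h1
          · exact absurd heF h2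
          · tauto
      have a2 : (U.sub W F₀).edgeDist (U.sub (W.erase v) F₀) ≤ 1 := by
        refine last F₀ (Finset.card_le_one.mpr ?_)
        intro a ha b hb
        simp only [hF₀, Finset.mem_filter, Finset.mem_insert] at ha hb
        have h1 : a = e := by tauto
        have h2 : b = e := by tauto
        rw [h1, h2]
      have a3 : U.sub (W.erase v) F₀ = U.sub (W.erase v) F := by
        rw [e1 F₀, e1 F]
        congr 1
        ext f
        simp only [hF₀, Finset.mem_insert, Finset.mem_filter]
        constructor
        · rintro ⟨rfl | h, h'⟩
          · exact absurd hve h'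
          · exact h
        · exact fun h => ⟨Or.inr h, h.2⟩
      rw [a3] at a2
      refine (edgeDist_triangle _ _ _).trans ((add_le_add a1 a2).trans ?_)
      have hpos : 0 < (F.filter (v ∈ ·)).card := Finset.card_pos.mpr ⟨e, he⟩
      have : ((F.filter (v ∈ ·)).card - 1 : ℕ) + 1 ≤ max 1 (F.filter (v ∈ ·)).card := by omega
      exact_mod_cast this
  refine (edgeDist_triangle _ _ _).trans ((add_le_add h1 h2).trans ?_)
  rw [add_comm]
  push_cast
  exact le_rfl

/-! ### Lower bounds for the distances -/

theorem EdgeStep.card_symmDiff_le {S S' : GraphStream V T} (h : EdgeStep S S') :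
    (symmDiff S.flatten.edges S'.flatten.edges).card ≤ 1 := by
  rcases h with ⟨e, h⟩ | ⟨v, hd, h⟩
  · refine (Finset.card_le_card (t := {e}) fun f hf => ?_).trans (by simp)
    simp only [Finset.mem_symmDiff, mem_flatten_edges, h.2.2, Finset.mem_erase] at hf
    rw [Finset.mem_singleton]
    by_contra hne
    simp only [ne_eq, hne, not_false_eq_true, true_and] at hf
    tauto
  · refine le_trans (Finset.card_le_card fun f hf => ?_) hd
    simp only [Finset.mem_symmDiff, mem_flatten_edges, h.2.2, Finset.mem_filter] at hf ⊢
    by_cases hv : v ∈ f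
    · simp [hv] at hf
      simp [hv, hf]
    · simp only [hv, not_false_eq_true, and_true] at hf
      tauto

/-- No edge step changes more than one edge of the flattened graph, and symmetric differences obey a
triangle inequality along a chain. -/
theorem card_symmDiff_le_edgeDist (S S' : GraphStream V T) :
    ((symmDiff S.flatten.edges S'.flatten.edges).card : ℕ∞) ≤ S.edgeDist S' := by
  refine le_iInf fun w => ?_
  rw [Nat.cast_le]
  induction w with
  | nil => simp
  | @cons a b c h w ih =>
    have h1 : (symmDiff a.flatten.edges b.flatten.edges).card ≤ 1 := by
      rcases h with h | h
      · exact h.card_symmDiff_le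
      · rw [symmDiff_comm]; exact h.card_symmDiff_le
    have h2 := Finset.card_le_card (symmDiff_triangle a.flatten.edges b.flatten.edges
      c.flatten.edges)
    have h3 := Finset.card_union_le (symmDiff a.flatten.edges b.flatten.edges)
      (symmDiff b.flatten.edges c.flatten.edges)
    rw [SimpleGraph.Walk.length_cons]
    rw [Finset.sup_eq_union] at h2
    omega

theorem RemovesNode.verts_iff {S S' : GraphStream V T} {v : V} (h : RemovesNode S S' v) (u : V) :
    u ∈ S'.flatten.verts ↔ u ∈ S.flatten.verts ∧ u ≠ v := by
  simp only [mem_flatten_verts, h.2.1, Finset.mem_erase]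
  tauto

theorem RemovesNode.edges_iff {S S' : GraphStream V T} {v : V} (h : RemovesNode S S' v)
    (e : Sym2 V) : e ∈ S'.flatten.edges ↔ e ∈ S.flatten.edges ∧ v ∉ e := by
  simp only [mem_flatten_edges, h.2.2, Finset.mem_filter]
  tauto

/-- A chain of node-neighbors determines the list of the nodes removed or inserted along it. -/
theorem exists_labels {S S' : GraphStream V T} (w : (nodeNeighborGraph V T).Walk S S') :
    ∃ l : List V, l.length = w.length ∧
      (∀ u, Even (l.count u) ↔ (u ∈ S.flatten.verts ↔ u ∈ S'.flatten.verts)) ∧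
      ∀ e : Sym2 V, (∀ u ∈ e, u ∉ l) → (e ∈ S.flatten.edges ↔ e ∈ S'.flatten.edges) := by
  induction w with
  | nil => exact ⟨[], by simp⟩
  | @cons a b c h w ih =>
    obtain ⟨l, hl, h1, h2⟩ := ih
    have key : ∃ v, (∀ u, (u ∈ a.flatten.verts ↔ u ∈ b.flatten.verts) ↔ u ≠ v) ∧
        ∀ e : Sym2 V, v ∉ e → (e ∈ a.flatten.edges ↔ e ∈ b.flatten.edges) := by
      rcases h with ⟨v, h⟩ | ⟨v, h⟩
      · refine ⟨v, fun u => ?_, fun e he => ?_⟩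
        · rw [h.verts_iff]
          by_cases huv : u = v
          · subst huv; simp [h.1]
          · simp [huv]
        · rw [h.edges_iff]; simp [he]
      · refine ⟨v, fun u => ?_, fun e he => ?_⟩
        · rw [h.verts_iff]
          by_cases huv : u = v
          · subst huv; simp [h.1]
          · simp [huv]
        · rw [h.edges_iff]; simp [he]
    obtain ⟨v, k1, k2⟩ := key
    refine ⟨v :: l, by simp [hl], fun u => ?_, fun e he => ?_⟩
    · have a1 := h1 u
      have a2 := k1 u
      by_cases huv : u = v
      · subst huv
        rw [List.count_cons_self, Nat.even_add_one]
        tauto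
      · rw [List.count_cons_of_ne (Ne.symm huv)]
        tauto
    · rw [k2 e fun hv => he v hv (by simp)]
      exact h2 e fun u hu hul => he u hu (List.mem_cons_of_mem _ hul)

/-- Every edge of a matching of differing edges costs two steps, every differing node one. -/
theorem matching_le_nodeDist (S S' : GraphStream V T) (M : Finset (Sym2 V))
    (hM : ∀ e ∈ M, e ∈ symmDiff S.flatten.edges S'.flatten.edges)
    (hdisj : ∀ e ∈ M, ∀ f ∈ M, ∀ v, v ∈ e → v ∈ f → e = f)
    (hv : ∀ e ∈ M, ∀ v ∈ e, v ∈ S.flatten.verts ∧ v ∈ S'.flatten.verts) :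
    ((2 * M.card + (symmDiff S.flatten.verts S'.flatten.verts).card : ℕ) : ℕ∞) ≤
      S.nodeDist S' := by
  refine le_iInf fun w => ?_
  rw [Nat.cast_le]
  obtain ⟨l, hl, h1, h2⟩ := exists_labels w
  rw [← hl]
  -- An edge none of whose endpoints is a label never changes its status. Outside `M` the choice of
  -- `x` is arbitrary.
  have hx : ∀ e : Sym2 V, ∃ x, e ∈ M → x ∈ e ∧ x ∈ l := by
    intro e
    by_cases he : e ∈ M
    · by_contra hcon
      push Not at hcon
      have hlab : ∀ u ∈ e, u ∉ l := fun u hu => (hcon u).2 hu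
      have := h2 e hlab
      have hd := Finset.mem_symmDiff.mp (hM e he)
      tauto
    · induction e using Sym2.inductionOn with
      | _ a b => exact ⟨a, fun h => absurd h he⟩
  choose x hx using hx
  have hinj : Set.InjOn x M := fun e he f hf hef =>
    hdisj e he f hf (x e) (hx e he).1 (hef ▸ (hx f hf).1)
  set Y := symmDiff S.flatten.verts S'.flatten.verts
  have hdis : Disjoint (M.image x) Y := by
    rw [Finset.disjoint_left]
    intro u hu hY
    obtain ⟨e, he, rfl⟩ := Finset.mem_image.mp hu
    have := hv e he _ (hx e he).1
    have := Finset.mem_symmDiff.mp hY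
    tauto
  have hsum : ∑ u ∈ M.image x ∪ Y, l.count u ≤ l.length := by
    have := Multiset.sum_count_eq_card (s := M.image x ∪ Y ∪ l.toFinset) (m := (l : Multiset V))
      (by intro a ha; simp at ha; simp [ha])
    simp only [Multiset.coe_count, Multiset.coe_card] at this
    rw [← this]
    exact Finset.sum_le_sum_of_subset Finset.subset_union_left
  rw [Finset.sum_union hdis, Finset.sum_image hinj] at hsum
  -- The chosen endpoint lies in both streams, so its positive count is even.
  have c1 : ∑ e ∈ M, 2 ≤ ∑ e ∈ M, l.count (x e) := by
    refine Finset.sum_le_sum fun e he => ?_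
    have hpos := List.count_pos_iff.mpr (hx e he).2
    have heven := (h1 (x e)).mpr (by have := hv e he _ (hx e he).1; tauto)
    obtain ⟨k, hk⟩ := heven
    omega
  have c2 : ∑ e ∈ Y, 1 ≤ ∑ e ∈ Y, l.count e := by
    refine Finset.sum_le_sum fun u hu => ?_
    by_contra hlt
    have h0 : l.count u = 0 := by omega
    have := (h1 u).mp (by rw [h0]; exact Even.zero)
    have := Finset.mem_symmDiff.mp hu
    tauto
  simp only [Finset.sum_const, smul_eq_mul, mul_one] at c1 c2
  omega

end GraphStream

/-! ### Order-theoretic description of the projections -/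

section Projection

variable {V κ : Type*} [LinearOrder κ]

section

variable [DecidableEq V]

/-- The number of edges in `F` at `x`. -/
def edgeDeg (F : Finset (Sym2 V)) (x : V) : ℕ := (F.filter fun f => x ∈ f).card

/-- The number of edges in `F` at `x` that precede `e`. -/
def edgesBefore (τ : Sym2 V → κ) (F : Finset (Sym2 V)) (e : Sym2 V) (x : V) : ℕ :=
  (F.filter fun f => τ f < τ e ∧ x ∈ f).card

/-- The edges that are counted by the projection with criterion `c`. -/
def Criterion.counted (c : Criterion) (E A : Finset (Sym2 V)) : Finset (Sym2 V) :=
  match c with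
  | .original => E
  | .projected => A

/-- `A` is the set of edges output when the edges of `E` are processed in the order given by the
keys `τ`. -/
structure IsProj (c : Criterion) (τ : Sym2 V → κ) (D : ℕ) (E A : Finset (Sym2 V)) : Prop where
  subset : A ⊆ E
  mem_iff : ∀ e ∈ E, e ∈ A ↔ ∀ x ∈ e, edgesBefore τ (c.counted E A) e x < D

theorem edgesBefore_mono {τ : Sym2 V → κ} {F : Finset (Sym2 V)} {e e' : Sym2 V}
    (h : τ e ≤ τ e') (x : V) : edgesBefore τ F e x ≤ edgesBefore τ F e' x :=
  Finset.card_le_card fun _ hf => by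
    simp only [Finset.mem_filter] at hf ⊢
    exact ⟨hf.1, hf.2.1.trans_le h, hf.2.2⟩

theorem edgesBefore_le_of_subset {τ : Sym2 V → κ} {F F' : Finset (Sym2 V)} (h : F ⊆ F')
    (e : Sym2 V) (x : V) : edgesBefore τ F e x ≤ edgesBefore τ F' e x :=
  Finset.card_le_card (Finset.filter_subset_filter _ h)

theorem edgesBefore_lt_edgeDeg {τ : Sym2 V → κ} {F : Finset (Sym2 V)} {e : Sym2 V} {x : V}
    (he : e ∈ F) (hx : x ∈ e) : edgesBefore τ F e x < edgeDeg F x := by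
  refine Finset.card_lt_card (Finset.ssubset_iff_of_subset ?_ |>.mpr ⟨e, ?_, ?_⟩)
  · intro f hf
    simp only [Finset.mem_filter] at hf ⊢
    exact ⟨hf.1, hf.2.2⟩
  · simp [he, hx]
  · simp

theorem edgesBefore_lt_edgesBefore {τ : Sym2 V → κ} {F : Finset (Sym2 V)} {e e' : Sym2 V} {x : V}
    (he : e ∈ F) (hx : x ∈ e) (h : τ e < τ e') : edgesBefore τ F e x < edgesBefore τ F e' x := by
  refine Finset.card_lt_card (Finset.ssubset_iff_of_subset ?_ |>.mpr ⟨e, ?_, ?_⟩)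
  · intro f hf
    simp only [Finset.mem_filter] at hf ⊢
    exact ⟨hf.1, hf.2.1.trans h, hf.2.2⟩
  · simp [he, hx, h]
  · simp

/-! ### Degree bound, uniqueness and a criterion for the static projection -/

namespace IsProj

variable {c : Criterion} {τ : Sym2 V → κ} {D : ℕ} {E A : Finset (Sym2 V)}

theorem subset_counted (h : IsProj c τ D E A) : A ⊆ c.counted E A := by
  cases c
  · exact h.subset
  · exact subset_rfl

theorem edgesBefore_lt (h : IsProj c τ D E A) {e : Sym2 V} (he : e ∈ A) {x : V} (hx : x ∈ e) :
    edgesBefore τ (c.counted E A) e x < D :=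
  (h.mem_iff e (h.subset he)).mp he x hx

theorem exists_le_of_notMem (h : IsProj c τ D E A) {e : Sym2 V} (he : e ∈ E) (heA : e ∉ A) :
    ∃ x ∈ e, D ≤ edgesBefore τ (c.counted E A) e x := by
  have := mt (h.mem_iff e he).mpr heA
  push Not at this
  exact this

theorem edgeDeg_le (hτ : Function.Injective τ) (h : IsProj c τ D E A) (x : V) :
    edgeDeg A x ≤ D := by
  -- The last edge of `A` at `x` was accepted although all others precede it, and edges of `A` are
  -- counted under either criterion.
  rcases (A.filter (x ∈ ·)).eq_empty_or_nonempty with h0 | hne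
  · simp [edgeDeg, h0]
  · obtain ⟨e, he, hmax⟩ := Finset.exists_max_image _ τ hne
    have he' := Finset.mem_filter.mp he
    have h1 := h.edgesBefore_lt he'.1 he'.2
    have h2 := edgesBefore_le_of_subset (τ := τ) h.subset_counted e x
    have h3 : edgeDeg A x ≤ edgesBefore τ A e x + 1 := by
      unfold edgeDeg
      rw [← Finset.card_erase_add_one he]
      refine Nat.add_le_add_right (Finset.card_le_card fun f hf => ?_) 1
      obtain ⟨hfe, hf⟩ := Finset.mem_erase.mp hf
      have hf' := Finset.mem_filter.mp hf
      exact Finset.mem_filter.mpr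
        ⟨hf'.1, lt_of_le_of_ne (hmax f hf) fun h => hfe (hτ h), hf'.2⟩
    omega

/-- The output is determined by the input. -/
theorem unique (h : IsProj c τ D E A) {A' : Finset (Sym2 V)}
    (h' : IsProj c τ D E A') : A = A' := by
  -- The order on `κ` need not be well-founded, so the induction runs over the number of edges of
  -- `E` before `e`.
  have key : ∀ n : ℕ, ∀ e ∈ E, (E.filter fun f => τ f < τ e).card = n → (e ∈ A ↔ e ∈ A') := by
    intro n
    induction n using Nat.strong_induction_on with
    | _ n ih =>
      intro e he hn
      rw [h.mem_iff e he, h'.mem_iff e he]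
      have : ∀ x, edgesBefore τ (c.counted E A) e x = edgesBefore τ (c.counted E A') e x := by
        intro x
        cases c with
        | original => rfl
        | projected =>
          have hAA : ∀ f ∈ E, τ f < τ e → (f ∈ A ↔ f ∈ A') := by
            intro f hf hfe
            refine ih _ ?_ f hf rfl
            rw [← hn]
            refine Finset.card_lt_card (Finset.ssubset_iff_of_subset ?_ |>.mpr ⟨f, ?_, ?_⟩)
            · intro g hg
              simp only [Finset.mem_filter] at hg ⊢
              exact ⟨hg.1, hg.2.trans hfe⟩
            · simp [hf, hfe]
            · simp
          unfold edgesBefore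
          congr 1
          ext f
          simp only [Finset.mem_filter, Criterion.counted]
          constructor
          · rintro ⟨h1, h2, h3⟩
            exact ⟨(hAA f (h.subset h1) h2).mp h1, h2, h3⟩
          · rintro ⟨h1, h2, h3⟩
            exact ⟨(hAA f (h'.subset h1) h2).mpr h1, h2, h3⟩
      simp only [this]
  ext e
  constructor
  · exact fun he => (key _ e (h.subset he) rfl).mp he
  · exact fun he => (key _ e (h'.subset he) rfl).mpr he

/-- Bounded degrees and a saturated endpoint of every rejected edge characterize the projection
based on projected degrees. -/
theorem of_edgeDeg_le (hAE : A ⊆ E) (hA : ∀ x, edgeDeg A x ≤ D)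
    (hE : ∀ e ∈ E, e ∉ A → ∃ x ∈ e, D ≤ edgesBefore τ A e x) :
    IsProj .projected τ D E A := by
  refine ⟨hAE, fun e he => ⟨fun heA x hx => ?_, fun h => ?_⟩⟩
  · exact (edgesBefore_lt_edgeDeg heA hx).trans_le (hA x)
  · by_contra heA
    obtain ⟨x, hx, hle⟩ := hE e he heA
    exact absurd (h x hx) (not_lt.mpr hle)

end IsProj

open TimeAwareProjection

/-- Induction on the last edge: it precedes nothing and so leaves earlier counts unchanged
(`before_ins`), while the counts before it are full degrees (`before_old`), that is, the counters.
-/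
theorem isProj_foldl (c : Criterion) (τ : Sym2 V → κ) (D : ℕ) (L : List (Sym2 V))
    (hL : L.Pairwise fun e f => τ e < τ f) :
    IsProj c τ D L.toFinset (L.foldl (processEdge c D) (fun _ => 0, ∅)).2 ∧
      ∀ x, (L.foldl (processEdge c D) (fun _ => 0, ∅)).1 x =
        edgeDeg (c.counted L.toFinset (L.foldl (processEdge c D) (fun _ => 0, ∅)).2) x := by
  induction L using List.reverseRecOn with
  | nil =>
    refine ⟨⟨by simp, by simp⟩, fun x => ?_⟩
    cases c <;> simp [edgeDeg, Criterion.counted]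
  | append_singleton L e ih =>
    rw [List.pairwise_append] at hL
    obtain ⟨h1, -, h2⟩ := hL
    obtain ⟨ihp, ihc⟩ := ih h1
    have hlt : ∀ f ∈ L.toFinset, τ f < τ e := fun f hf =>
      h2 f (List.mem_toFinset.mp hf) e (by simp)
    rw [List.foldl_append, List.foldl_cons, List.foldl_nil]
    set s := L.foldl (processEdge c D) (fun _ => 0, ∅) with hs
    have hins : (L ++ [e]).toFinset = insert e L.toFinset := by
      rw [List.toFinset_append, Finset.union_comm]; simp
    rw [hins]
    have heL : e ∉ L.toFinset := fun h => lt_irrefl _ (hlt e h)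
    have heA : e ∉ s.2 := fun h => heL (ihp.subset h)
    have before_old : ∀ F : Finset (Sym2 V), F ⊆ L.toFinset → ∀ x,
        edgesBefore τ F e x = edgeDeg F x := by
      intro F hF x
      unfold edgesBefore edgeDeg
      congr 1
      ext f
      simp only [Finset.mem_filter]
      exact ⟨fun h => ⟨h.1, h.2.2⟩, fun h => ⟨h.1, hlt f (hF h.1), h.2⟩⟩
    have before_ins : ∀ (F : Finset (Sym2 V)), ∀ f ∈ insert e L.toFinset, ∀ x,
        edgesBefore τ (insert e F) f x = edgesBefore τ F f x := by
      intro F f hf x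
      have hef : ¬ τ e < τ f := by
        rcases Finset.mem_insert.mp hf with rfl | hf
        · exact lt_irrefl _
        · exact (hlt f hf).le.not_gt
      unfold edgesBefore
      rw [Finset.filter_insert, if_neg (fun h => hef h.1)]
    have deg_ins : ∀ (F : Finset (Sym2 V)), F ⊆ L.toFinset → ∀ x,
        edgeDeg (insert e F) x = if x ∈ e then edgeDeg F x + 1 else edgeDeg F x := by
      intro F hF x
      unfold edgeDeg
      rw [Finset.filter_insert]
      split_ifs with hx
      · rw [Finset.card_insert_of_notMem fun h => heL (hF (Finset.mem_filter.mp h).1)]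
      · rfl
    have hcsub : c.counted L.toFinset s.2 ⊆ L.toFinset := by
      cases c
      · exact subset_rfl
      · exact ihp.subset
    have hadd : AddEdge D s.1 e ↔ ∀ x ∈ e, edgesBefore τ (c.counted L.toFinset s.2) e x < D := by
      unfold AddEdge
      simp only [before_old _ hcsub, ihc]
    by_cases hadd' : AddEdge D s.1 e
    · have hstep : processEdge c D s e = (increment s.1 e, insert e s.2) := by
        simp [processEdge, hadd']
      rw [hstep]
      have hcount : c.counted (insert e L.toFinset) (insert e s.2) =
          insert e (c.counted L.toFinset s.2) := by cases c <;> rfl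
      refine ⟨⟨Finset.insert_subset_insert _ ihp.subset, fun f hf => ?_⟩, fun x => ?_⟩
      · rw [hcount]
        simp only [before_ins _ f hf]
        by_cases hfe : f = e
        · subst hfe
          exact ⟨fun _ => hadd.mp hadd', fun _ => Finset.mem_insert_self _ _⟩
        · rw [Finset.mem_insert, or_iff_right hfe]
          exact ihp.mem_iff f ((Finset.mem_insert.mp hf).resolve_left hfe)
      · rw [hcount, deg_ins _ hcsub]
        simp only [increment, ihc]
    · cases c with
      | original =>
        have hstep : processEdge .original D s e = (increment s.1 e, s.2) := by
          simp [processEdge, hadd']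
        rw [hstep]
        refine ⟨⟨ihp.subset.trans (Finset.subset_insert _ _), fun f hf => ?_⟩, fun x => ?_⟩
        · simp only [Criterion.counted, before_ins _ f hf]
          by_cases hfe : f = e
          · subst hfe
            exact ⟨fun h => absurd h heA, fun h => absurd (hadd.mpr h) hadd'⟩
          · exact ihp.mem_iff f ((Finset.mem_insert.mp hf).resolve_left hfe)
        · simp only [Criterion.counted]
          rw [deg_ins _ subset_rfl]
          simp only [increment, ihc, Criterion.counted]
      | projected =>
        have hstep : processEdge .projected D s e = s := by
          simp [processEdge, hadd']
        rw [hstep]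
        refine ⟨⟨ihp.subset.trans (Finset.subset_insert _ _), fun f hf => ?_⟩, fun x => ihc x⟩
        by_cases hfe : f = e
        · subst hfe
          exact ⟨fun h => absurd h heA, fun h => absurd (hadd.mpr h) hadd'⟩
        · exact ihp.mem_iff f ((Finset.mem_insert.mp hf).resolve_left hfe)

end

open TimeAwareProjection

/-! ### Keys of a stream and the passage from the algorithm to `IsProj` -/

namespace GraphStream

variable {T : ℕ}

/-- The keys `τ` sort the edges of `S` by arrival time and, within a time step, by `ord`. -/
structure IsKey (ord : LinearOrder (Sym2 V)) (S : GraphStream V T) (τ : Sym2 V → κ) : Prop where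
  injective : Function.Injective τ
  time_lt : ∀ i j, i < j → ∀ e ∈ S.edges i, ∀ f ∈ S.edges j, τ e < τ f
  ord_lt : ∀ i, ∀ e ∈ S.edges i, ∀ f ∈ S.edges i, ord.lt e f → τ e < τ f

/-- Lets one key order two neighboring streams, so that their outputs can be compared edge by edge.
-/
theorem IsKey.mono {ord : LinearOrder (Sym2 V)} {S S' : GraphStream V T} {τ : Sym2 V → κ}
    (h : S.IsKey ord τ) (hS : ∀ i, S'.edges i ⊆ S.edges i) : S'.IsKey ord τ :=
  ⟨h.injective, fun i j hij e he f hf => h.time_lt i j hij e (hS i he) f (hS j hf),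
    fun i e he f hf => h.ord_lt i e (hS i he) f (hS i hf)⟩

theorem exists_isKey_of_injective {K : Type*} [LinearOrder K] {g : Sym2 V → K}
    (hg : Function.Injective g) (ord : LinearOrder (Sym2 V)) (hlt : ∀ e f, ord.lt e f → g e < g f)
    (S : GraphStream V T) : ∃ τ : Sym2 V → ℕ ×ₗ K, S.IsKey ord τ := by
  classical
  -- The key is the pair (arrival time, `g e`); the time 0 of edges that never arrive is immaterial.
  let time : Sym2 V → ℕ := fun e => if h : ∃ i, e ∈ S.edges i then (h.choose : ℕ) else 0
  have htime : ∀ i, ∀ e ∈ S.edges i, time e = i := by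
    intro i e he
    have h : ∃ i, e ∈ S.edges i := ⟨i, he⟩
    simp only [time, dif_pos h]
    rw [edges_time_unique h.choose_spec he]
  refine ⟨fun e => toLex (time e, g e), fun e f h => ?_, fun i j hij e he f hf => ?_,
    fun i e he f hf hef => ?_⟩
  · exact hg (Prod.ext_iff.mp (toLex.injective h)).2
  · rw [Prod.Lex.toLex_lt_toLex, htime i e he, htime j f hf]
    exact Or.inl hij
  · rw [Prod.Lex.toLex_lt_toLex, htime i e he, htime i f hf]
    exact Or.inr ⟨rfl, hlt e f hef⟩

theorem exists_isKey.{u} {V : Type u} (ord : LinearOrder (Sym2 V)) (S : GraphStream V T) :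
    ∃ (κ : Type u) (_ : LinearOrder κ) (τ : Sym2 V → κ), S.IsKey ord τ :=
  ⟨_, _, @exists_isKey_of_injective V T (Sym2 V) ord id Function.injective_id ord
    (fun _ _ h => h) S⟩

/-- The edges of the first `n` time steps in the order in which they are processed. -/
def edgeList (ord : LinearOrder (Sym2 V)) (S : GraphStream V T) : ℕ → List (Sym2 V)
  | 0 => []
  | n + 1 => if h : n < T then S.edgeList ord n ++ arrivalList ord S ⟨n, h⟩ else S.edgeList ord n

theorem mem_edgeList {ord : LinearOrder (Sym2 V)} {S : GraphStream V T} {n : ℕ} {e : Sym2 V} :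
    e ∈ S.edgeList ord n ↔ ∃ i : Fin T, (i : ℕ) < n ∧ e ∈ S.edges i := by
  induction n with
  | zero => simp [edgeList]
  | succ n ih =>
    unfold edgeList
    split_ifs with h
    · rw [List.mem_append, ih, arrivalList, Finset.mem_sort]
      constructor
      · rintro (⟨i, hi, he⟩ | he)
        · exact ⟨i, by omega, he⟩
        · exact ⟨⟨n, h⟩, by simp, he⟩
      · rintro ⟨i, hi, he⟩
        rcases Nat.lt_succ_iff_lt_or_eq.mp hi with h' | h'
        · exact Or.inl ⟨i, h', he⟩
        · right
          have : i = ⟨n, h⟩ := Fin.ext h'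
          rwa [← this]
    · rw [ih]
      refine exists_congr fun i => and_congr_left fun _ => ?_
      have := i.isLt
      omega

theorem IsKey.pairwise_edgeList {ord : LinearOrder (Sym2 V)} {S : GraphStream V T}
    {τ : Sym2 V → κ} (h : S.IsKey ord τ) (n : ℕ) :
    (S.edgeList ord n).Pairwise fun e f => τ e < τ f := by
  induction n with
  | zero => simp [edgeList]
  | succ n ih =>
    unfold edgeList
    split_ifs with hn
    · rw [List.pairwise_append]
      refine ⟨ih, ?_, fun e he f hf => ?_⟩
      · have hp : (arrivalList ord S ⟨n, hn⟩).Pairwise ord.lt :=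
          ((Finset.pairwise_sort _ _).and (Finset.sort_nodup _ _)).imp
            fun {e f} hef => @lt_of_le_of_ne _ ord.toPartialOrder e f hef.1 hef.2
        refine hp.imp_of_mem fun {e f} he hf hef => ?_
        exact h.ord_lt ⟨n, hn⟩ e ((Finset.mem_sort _).mp he) f ((Finset.mem_sort _).mp hf) hef
      · obtain ⟨i, hi, he⟩ := mem_edgeList.mp he
        exact h.time_lt i ⟨n, hn⟩ (Fin.lt_def.mpr hi) e he f ((Finset.mem_sort _).mp hf)
    · exact ih

variable [DecidableEq V]

/-- Decisions read only the counters, never the edges already output. This reconciles one run over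
all edges with runs that restart from an empty output at every time step. -/
theorem foldl_processEdge_snd (c : Criterion) (D : ℕ) (L : List (Sym2 V)) (d : V → ℕ)
    (F : Finset (Sym2 V)) :
    (L.foldl (processEdge c D) (d, F)).1 = (L.foldl (processEdge c D) (d, ∅)).1 ∧
    (L.foldl (processEdge c D) (d, F)).2 = F ∪ (L.foldl (processEdge c D) (d, ∅)).2 := by
  induction L generalizing d F with
  | nil => simp
  | cons e L ih =>
    simp only [List.foldl_cons]
    by_cases h : AddEdge D d e
    · simp only [processEdge, h, if_true]
      rw [(ih _ (insert e F)).1, (ih _ (insert e F)).2, (ih _ (insert e ∅)).1,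
        (ih _ (insert e ∅)).2]
      refine ⟨rfl, ?_⟩
      ext f
      simp only [Finset.mem_union, Finset.mem_insert, Finset.notMem_empty]
      tauto
    · cases c <;> simp only [processEdge, h, if_false] <;> exact ih _ F

theorem foldl_edgeList (c : Criterion) (ord : LinearOrder (Sym2 V)) (D : ℕ) (S : GraphStream V T)
    (n : ℕ) :
    ((S.edgeList ord n).foldl (processEdge c D) (fun _ => 0, ∅)).1 = counters c ord D S n ∧
    ∀ e, e ∈ ((S.edgeList ord n).foldl (processEdge c D) (fun _ => 0, ∅)).2 ↔
      ∃ i : Fin T, (i : ℕ) < n ∧ e ∈ projEdges c ord D S i := by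
  induction n with
  | zero => exact ⟨rfl, by simp [edgeList]⟩
  | succ n ih =>
    unfold edgeList counters
    split_ifs with h
    · rw [List.foldl_append]
      obtain ⟨ih1, ih2⟩ := ih
      set s := (S.edgeList ord n).foldl (processEdge c D) (fun _ => 0, ∅)
      have hs : s = (s.1, s.2) := rfl
      rw [hs, (foldl_processEdge_snd c D _ s.1 s.2).1, (foldl_processEdge_snd c D _ s.1 s.2).2, ih1]
      refine ⟨rfl, fun e => ?_⟩
      rw [Finset.mem_union, ih2]
      constructor
      · rintro (⟨i, hi, he⟩ | he)
        · exact ⟨i, by omega, he⟩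
        · exact ⟨⟨n, h⟩, by simp, he⟩
      · rintro ⟨i, hi, he⟩
        rcases Nat.lt_succ_iff_lt_or_eq.mp hi with h' | h'
        · exact Or.inl ⟨i, h', he⟩
        · right
          obtain rfl : i = ⟨n, h⟩ := Fin.ext h'
          exact he
    · refine ⟨ih.1, fun e => (ih.2 e).trans ?_⟩
      refine exists_congr fun i => and_congr_left fun _ => ?_
      have := i.isLt
      omega

/-- The bridge from the algorithm to the static description; the counters play no role beyond this
point. -/
theorem IsKey.isProj {ord : LinearOrder (Sym2 V)} {S : GraphStream V T} {τ : Sym2 V → κ}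
    (h : S.IsKey ord τ) (c : Criterion) (D : ℕ) :
    IsProj c τ D S.flatten.edges (S.proj c ord D).flatten.edges := by
  have h1 := (isProj_foldl c τ D _ (h.pairwise_edgeList T)).1
  have e1 : (S.edgeList ord T).toFinset = S.flatten.edges := by
    ext e
    simp [mem_edgeList, mem_flatten_edges]
  have e2 : ((S.edgeList ord T).foldl (processEdge c D) (fun _ => 0, ∅)).2 =
      (S.proj c ord D).flatten.edges := by
    ext e
    rw [(foldl_edgeList c ord D S T).2, mem_flatten_edges]
    simp [proj]
  rwa [e1, e2] at h1

/-- Places the projections of both neighbors inside one ambient stream `S`, where the distance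
bounds for `sub` apply; arrival times are those in `S`. -/
theorem proj_eq_sub {c : Criterion} {ord : LinearOrder (Sym2 V)} {D : ℕ} {S S' : GraphStream V T}
    (W : Finset V)
    (hn : ∀ i, S'.nodes i = (S.nodes i).filter (· ∈ W)) (he : ∀ i, S'.edges i ⊆ S.edges i) :
    S'.proj c ord D = S.sub W (S'.proj c ord D).flatten.edges := by
  refine ext_of_eq (fun i => hn i) (fun i => ?_)
  ext e
  rw [mem_sub_edges]
  constructor
  · intro h
    refine ⟨he i (projEdges_subset c ord D S' i h), mem_flatten_edges.mpr ⟨i, h⟩, fun v hv => ?_⟩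
    obtain ⟨j, -, hj⟩ := (S'.proj c ord D).endpoint_arrived i e h v hv
    have hj' : v ∈ S'.nodes j := hj
    rw [hn j] at hj'
    exact (Finset.mem_filter.mp hj').2
  · rintro ⟨h1, h2, -⟩
    obtain ⟨j, hj⟩ := mem_flatten_edges.mp h2
    have := edges_time_unique h1 (he j (projEdges_subset c ord D S' j hj))
    rwa [this]

end GraphStream

end Projection

/-! ### Counting lemmas -/

section Counting

theorem Finset.sum_card_filter_comm {α β : Type*} (s : Finset α) (t : Finset β)
    (P : α → β → Prop) [∀ a b, Decidable (P a b)] :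
    ∑ a ∈ s, (t.filter fun b => P a b).card = ∑ b ∈ t, (s.filter fun a => P a b).card := by
  simp only [Finset.card_filter]
  exact Finset.sum_comm

/-- A finite set can be enumerated compatibly with a function to a linear order. -/
theorem Finset.exists_rank {α κ : Type*} [DecidableEq α] [LinearOrder κ] (X : Finset α)
    (g : α → κ) : ∃ r : α → ℕ, Set.InjOn r X ∧ (∀ x ∈ X, r x < X.card) ∧
      ∀ x ∈ X, ∀ y ∈ X, g x < g y → r x < r y := by
  induction X using Finset.induction_on_max_value g with
  | empty => exact ⟨fun _ => 0, by simp⟩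
  | insert a s ha hmax ih =>
    obtain ⟨r, h1, h2, h3⟩ := ih
    have hne : ∀ x ∈ s, x ≠ a := fun x hx h => ha (h ▸ hx)
    refine ⟨fun x => if x = a then s.card else r x, ?_, ?_, ?_⟩
    · intro x hx y hy hxy
      rw [Finset.mem_coe, Finset.mem_insert] at hx hy
      rcases hx with rfl | hx <;> rcases hy with rfl | hy
      · rfl
      · have := h2 y hy
        simp [hne y hy] at hxy
        omega
      · have := h2 x hx
        simp [hne x hx] at hxy
        omega
      · simp [hne x hx, hne y hy] at hxy
        exact h1 hx hy hxy
    · intro x hx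
      rw [Finset.card_insert_of_notMem ha]
      rcases Finset.mem_insert.mp hx with rfl | hx
      · simp
      · have := h2 x hx
        simp [hne x hx]
        omega
    · intro x hx y hy hxy
      rw [Finset.mem_insert] at hx hy
      rcases hx with rfl | hx <;> rcases hy with rfl | hy
      · exact absurd hxy (lt_irrefl _)
      · exact absurd (hmax y hy) (not_le.mpr hxy)
      · simp [hne x hx]
        exact h2 x hx
      · simp [hne x hx, hne y hy]
        exact h3 x hx y hy hxy

/-- The differences are distinct positive integers, so their sum is at least 1 + 2 + ⋯ + |s|. -/
theorem Finset.sq_card_le_two_mul_sum_sub (a : ℕ) (s : Finset ℕ) (hs : ∀ b ∈ s, a < b) :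
    s.card ^ 2 ≤ 2 * ∑ b ∈ s, (b - a) := by
  induction s using Finset.induction_on_max with
  | empty => simp
  | insert m s hm ih =>
    have hms : m ∉ s := fun h => lt_irrefl _ (hm m h)
    have ih' := ih fun b hb => hs b (Finset.mem_insert_of_mem hb)
    have h1 : s.card ≤ m - a - 1 := by
      have : s ⊆ Finset.Ioo a m := fun b hb =>
        Finset.mem_Ioo.mpr ⟨hs b (Finset.mem_insert_of_mem hb), hm b hb⟩
      have := Finset.card_le_card this
      rw [Nat.card_Ioo] at this
      exact this
    have h2 : a < m := hs m (Finset.mem_insert_self _ _)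
    rw [Finset.card_insert_of_notMem hms, Finset.sum_insert hms]
    have h3 : s.card + 1 ≤ m - a := by omega
    nlinarith

/-- A relation `R` on `{0, …, n - 1}` that only goes up and has at most `k` pairs across any cut
has `O(n √k)` pairs. -/
theorem sq_card_le_of_cut (n k : ℕ) (R : Finset (ℕ × ℕ)) (hR : ∀ q ∈ R, q.1 < q.2 ∧ q.2 < n)
    (hcut : ∀ m, (R.filter fun q => q.1 < m ∧ m ≤ q.2).card ≤ k) :
    R.card ^ 2 ≤ 2 * n * (n - 1) * k := by
  -- The length of a pair is the number of cuts it crosses, and there are only n - 1 cuts.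
  have h1 : ∑ q ∈ R, (q.2 - q.1) ≤ (n - 1) * k := by
    have : ∀ q ∈ R, q.2 - q.1 = ((Finset.Icc 1 (n - 1)).filter
        fun m => q.1 < m ∧ m ≤ q.2).card := by
      intro q hq
      have := hR q hq
      have e : ((Finset.Icc 1 (n - 1)).filter fun m => q.1 < m ∧ m ≤ q.2) =
          Finset.Ioc q.1 q.2 := by
        ext m
        simp only [Finset.mem_filter, Finset.mem_Icc, Finset.mem_Ioc]
        omega
      rw [e, Nat.card_Ioc]
    rw [Finset.sum_congr rfl this,
      Finset.sum_card_filter_comm R (Finset.Icc 1 (n - 1)) fun q m => q.1 < m ∧ m ≤ q.2]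
    refine (Finset.sum_le_sum fun m _ => hcut m).trans ?_
    simp
  have hmaps : ∀ q ∈ R, q.1 ∈ Finset.range n := fun q hq => by
    have := hR q hq
    rw [Finset.mem_range]
    omega
  -- Pairs with the same lower end have distinct upper ends, hence large total length.
  have h2 : ∑ a ∈ Finset.range n, (R.filter fun q => q.1 = a).card ^ 2 ≤
      2 * ∑ q ∈ R, (q.2 - q.1) := by
    rw [← Finset.sum_fiberwise_of_maps_to hmaps, Finset.mul_sum]
    refine Finset.sum_le_sum fun a _ => ?_
    have hinj : Set.InjOn Prod.snd
        ((R.filter fun q => q.1 = a : Finset (ℕ × ℕ)) : Set (ℕ × ℕ)) := by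
      intro q hq q' hq' h
      have e1 := (Finset.mem_filter.mp hq).2
      have e2 := (Finset.mem_filter.mp hq').2
      exact Prod.ext (e1.trans e2.symm) h
    have := Finset.sq_card_le_two_mul_sum_sub a ((R.filter fun q => q.1 = a).image Prod.snd) (by
      intro b hb
      obtain ⟨q, hq, rfl⟩ := Finset.mem_image.mp hb
      obtain ⟨hq1, hq2⟩ := Finset.mem_filter.mp hq
      rw [← hq2]
      exact (hR q hq1).1)
    rw [Finset.card_image_of_injOn hinj, Finset.sum_image hinj] at this
    refine this.trans (Nat.mul_le_mul_left _ (Finset.sum_le_sum fun q hq => ?_))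
    rw [(Finset.mem_filter.mp hq).2]
  have h3 : R.card = ∑ a ∈ Finset.range n, (R.filter fun q => q.1 = a).card :=
    Finset.card_eq_sum_card_fiberwise hmaps
  have h4 := sq_sum_le_card_mul_sum_sq (s := Finset.range n)
    (f := fun a => (R.filter fun q => q.1 = a).card)
  rw [← h3, Finset.card_range] at h4
  calc R.card ^ 2 ≤ n * ∑ a ∈ Finset.range n, (R.filter fun q => q.1 = a).card ^ 2 := h4
    _ ≤ n * (2 * ((n - 1) * k)) := by
        refine Nat.mul_le_mul_left _ (h2.trans (Nat.mul_le_mul_left _ h1))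
    _ = 2 * n * (n - 1) * k := by ring

/-- With a = √k ≤ b = √n the summand k is at most ab. It is absorbed because I ≤ (2b² - b)a, which
leaves exactly 2b²a = 2n√k. -/
theorem add_le_two_mul_mul_sqrt {I k n D l : ℕ} (hI : I ^ 2 ≤ 2 * n * (n - 1) * k) (hkn : k ≤ n)
    (hkD : k ≤ D) (hnl : n ≤ l) : ((I + k : ℕ) : ℝ) ≤ 2 * (l : ℝ) * √(min (D : ℝ) (l : ℝ)) := by
  rcases Nat.eq_zero_or_pos n with rfl | hn
  · have hk : k = 0 := by omega
    have : I = 0 := by simpa using hI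
    subst hk this
    simp
    positivity
  have hk' : √(k : ℝ) ≤ √(min (D : ℝ) (l : ℝ)) := by
    apply Real.sqrt_le_sqrt
    refine le_min (by exact_mod_cast hkD) (by exact_mod_cast hkn.trans hnl)
  have hl' : (n : ℝ) ≤ l := by exact_mod_cast hnl
  have hI' : (I : ℝ) ^ 2 ≤ 2 * n * (n - 1) * k := by
    have h1 : ((n - 1 : ℕ) : ℝ) = (n : ℝ) - 1 := by push_cast [hn]; ring
    rw [← h1]
    exact_mod_cast hI
  have hsk : √(k : ℝ) ^ 2 = k := Real.sq_sqrt (by positivity)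
  have hsn : √(n : ℝ) ^ 2 = n := Real.sq_sqrt (by positivity)
  have hskn : √(k : ℝ) ≤ √(n : ℝ) := Real.sqrt_le_sqrt (by exact_mod_cast hkn)
  set a := √(k : ℝ)
  set b := √(n : ℝ)
  have ha : 0 ≤ a := Real.sqrt_nonneg _
  have hb : 1 ≤ b := by
    rw [← Real.sqrt_one]
    exact Real.sqrt_le_sqrt (by exact_mod_cast hn)
  have key : (I : ℝ) ≤ (2 * b ^ 2 - b) * a := by
    refine le_of_sq_le_sq ?_ (mul_nonneg (by nlinarith) ha)
    rw [← hsn, ← hsk] at hI'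
    refine hI'.trans ?_
    -- With n² in place of n(n - 1) the last factor would be 2(b - 1)² - 1, which is negative at n =
    -- 1.
    have : ((2 * b ^ 2 - b) * a) ^ 2 - 2 * b ^ 2 * (b ^ 2 - 1) * a ^ 2 =
        (a * b) ^ 2 * (2 * (b - 1) ^ 2 + 1) := by ring
    have h0 : 0 ≤ (a * b) ^ 2 * (2 * (b - 1) ^ 2 + 1) := by positivity
    linarith
  have hfin : ((I + k : ℕ) : ℝ) ≤ 2 * n * a := by
    push_cast
    rw [← hsn, ← hsk]
    nlinarith
  calc ((I + k : ℕ) : ℝ) ≤ 2 * n * a := hfin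
    _ ≤ 2 * l * √(min (D : ℝ) (l : ℝ)) := by gcongr

end Counting

/-! ### Blocking systems -/

section Blocking

variable {V : Type*} [DecidableEq V]

open Classical in
/-- Every edge of `H` is blocked by one of its endpoints, the blocking nodes are in `X`, a node `x`
blocks at most `s x` edges more than the other edges at `x`, and blocking nodes are ranked. -/
structure IsBlocking (H : Finset (Sym2 V)) (X : Finset V) (Blk : V → Sym2 V → Prop) (s r : V → ℕ) :
    Prop where
  mem_edge : ∀ f ∈ H, ∀ x, Blk x f → x ∈ f
  mem : ∀ f ∈ H, ∀ x, Blk x f → x ∈ X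
  exists_blk : ∀ f ∈ H, ∃ x, Blk x f
  balance : ∀ x ∈ X, (H.filter fun f => Blk x f).card ≤
    (H.filter fun f => x ∈ f ∧ ¬ Blk x f).card + s x
  rank_lt : ∀ f ∈ H, ∀ x y, Blk x f → y ∈ f → ¬ Blk y f → y ∈ X → r x < r y
  rank_injOn : Set.InjOn r X
  rank_lt_card : ∀ x ∈ X, r x < X.card

theorem Sym2.eq_or_eq_of_mem {V : Type*} {f : Sym2 V} {x y z : V} (hx : x ∈ f) (hy : y ∈ f)
    (hxy : x ≠ y) (hz : z ∈ f) : z = x ∨ z = y := by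
  rw [(Sym2.mem_and_mem_iff hxy).mp ⟨hx, hy⟩] at hz
  exact Sym2.mem_iff.mp hz

namespace IsBlocking

variable {H : Finset (Sym2 V)} {X : Finset V} {Blk : V → Sym2 V → Prop} {s r : V → ℕ}

open Classical in
/-- At most `∑ s` edges leave an initial segment of the blocking nodes. -/
theorem card_crossing_le (h : IsBlocking H X Blk s r) (m : ℕ) :
    (H.filter fun f => ∃ x ∈ X.filter (r · < m), Blk x f ∧
      ∀ y ∈ f, y ∈ X.filter (r · < m) → y = x).card ≤ ∑ x ∈ X.filter (r · < m), s x := by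
  set U := X.filter (r · < m) with hU
  have hUX : U ⊆ X := Finset.filter_subset _ _
  have hsum : ∑ x ∈ U, (H.filter fun f => Blk x f).card ≤
      ∑ x ∈ U, (H.filter fun f => x ∈ f ∧ ¬ Blk x f).card + ∑ x ∈ U, s x := by
    rw [← Finset.sum_add_distrib]
    exact Finset.sum_le_sum fun x hx => h.balance x (hUX hx)
  rw [Finset.sum_card_filter_comm U H fun x f => Blk x f,
    Finset.sum_card_filter_comm U H fun x f => x ∈ f ∧ ¬ Blk x f] at hsum
  -- A non-blocking endpoint in `U` forces the blocker, of smaller rank, into `U` too, and the two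
  -- cancel. An edge leaving `U` contributes only to the blocked side.
  have hper : ∑ f ∈ H, ((U.filter fun x => x ∈ f ∧ ¬ Blk x f).card +
      if ∃ x ∈ U, Blk x f ∧ ∀ y ∈ f, y ∈ U → y = x then 1 else 0) ≤
      ∑ f ∈ H, (U.filter fun x => Blk x f).card := by
    refine Finset.sum_le_sum fun f hf => ?_
    rcases (U.filter fun x => x ∈ f ∧ ¬ Blk x f).eq_empty_or_nonempty with h0 | ⟨y, hy⟩
    · rw [h0, Finset.card_empty, zero_add]
      split_ifs with hc
      · obtain ⟨x, hx, hb, -⟩ := hc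
        exact Finset.card_pos.mpr ⟨x, Finset.mem_filter.mpr ⟨hx, hb⟩⟩
      · exact Nat.zero_le _
    · obtain ⟨hyU, hyf, hyb⟩ := Finset.mem_filter.mp hy
      obtain ⟨x, hxb⟩ := h.exists_blk f hf
      have hxf := h.mem_edge f hf x hxb
      have hxy : x ≠ y := fun e => hyb (e ▸ hxb)
      have hr := h.rank_lt f hf x y hxb hyf hyb (hUX hyU)
      have hxU : x ∈ U := Finset.mem_filter.mpr
        ⟨h.mem f hf x hxb, hr.trans (Finset.mem_filter.mp hyU).2⟩
      rw [if_neg]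
      · rw [add_zero]
        have h1 : (U.filter fun x => x ∈ f ∧ ¬ Blk x f) ⊆ {y} := by
          intro z hz
          obtain ⟨-, hzf, hzb⟩ := Finset.mem_filter.mp hz
          rcases Sym2.eq_or_eq_of_mem hxf hyf hxy hzf with rfl | rfl
          · exact absurd hxb hzb
          · simp
        have h2 := Finset.card_le_card h1
        have h3 : 0 < (U.filter fun x => Blk x f).card :=
          Finset.card_pos.mpr ⟨x, Finset.mem_filter.mpr ⟨hxU, hxb⟩⟩
        rw [Finset.card_singleton] at h2
        omega
      · rintro ⟨z, -, hzb, hz⟩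
        exact hyb (hz y hyf hyU ▸ hzb)
  rw [Finset.sum_add_distrib, ← Finset.card_filter] at hper
  omega

open Classical in
-- Edges at `x` that `x` does not block come from blockers of smaller rank, so they leave the
-- segment of ranks below `r x` and number at most its supply; the term `s x` completes a part of
-- the total.
theorem card_blocked_le (h : IsBlocking H X Blk s r) {x : V} (hx : x ∈ X) :
    (H.filter fun f => Blk x f).card ≤ ∑ x ∈ X, s x := by
  have h1 := h.balance x hx
  have h2 := h.card_crossing_le (r x)
  set U := X.filter (r · < r x) with hU
  have hxU : x ∉ U := by simp [hU]
  have h3 : (H.filter fun f => x ∈ f ∧ ¬ Blk x f) ⊆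
      H.filter fun f => ∃ x ∈ U, Blk x f ∧ ∀ y ∈ f, y ∈ U → y = x := by
    intro f hf
    obtain ⟨hf, hxf, hxb⟩ := Finset.mem_filter.mp hf
    obtain ⟨y, hyb⟩ := h.exists_blk f hf
    have hyf := h.mem_edge f hf y hyb
    have hxy : y ≠ x := fun e => hxb (e ▸ hyb)
    have hr := h.rank_lt f hf y x hyb hxf hxb hx
    refine Finset.mem_filter.mpr ⟨hf, y, Finset.mem_filter.mpr ⟨h.mem f hf y hyb, hr⟩, hyb, ?_⟩
    intro z hz hzU
    rcases Sym2.eq_or_eq_of_mem hyf hxf hxy hz with rfl | rfl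
    · rfl
    · exact absurd hzU hxU
  have h4 := Finset.card_le_card h3
  have h5 : ∑ y ∈ insert x U, s y ≤ ∑ y ∈ X, s y :=
    Finset.sum_le_sum_of_subset (Finset.insert_subset hx (Finset.filter_subset _ _))
  rw [Finset.sum_insert hxU] at h5
  omega

theorem card_le_mul (h : IsBlocking H X Blk s r) : H.card ≤ X.card * ∑ x ∈ X, s x := by
  classical
  have h1 : H ⊆ X.biUnion fun x => H.filter fun f => Blk x f := by
    intro f hf
    obtain ⟨x, hx⟩ := h.exists_blk f hf
    exact Finset.mem_biUnion.mpr ⟨x, h.mem f hf x hx, Finset.mem_filter.mpr ⟨hf, hx⟩⟩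
  refine (Finset.card_le_card h1).trans (Finset.card_biUnion_le.trans ?_)
  refine (Finset.sum_le_sum fun x hx => h.card_blocked_le hx).trans ?_
  simp

/-- Edges with only one end in `X` leave the whole segment `X`, so there are at most `k`. The others
become increasing pairs of ranks, and those across the cut `m` leave the segment of ranks below `m`,
so `sq_card_le_of_cut` bounds their number `I`. -/
theorem exists_card_le_add (h : IsBlocking H X Blk s r) {k : ℕ} (hk : ∑ x ∈ X, s x ≤ k) :
    ∃ I : ℕ, H.card ≤ I + k ∧ I ^ 2 ≤ 2 * X.card * (X.card - 1) * k := by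
  classical
  rcases X.eq_empty_or_nonempty with rfl | ⟨x₀, hx₀⟩
  · refine ⟨0, ?_, by simp⟩
    have := h.card_le_mul
    simp at this
    simp [this]
  have hsub : ∀ m, ∑ x ∈ X.filter (r · < m), s x ≤ k := fun m =>
    (Finset.sum_le_sum_of_subset (Finset.filter_subset _ _)).trans hk
  have : Nonempty V := ⟨x₀⟩
  -- `g` recovers a node of `X` from its rank; the conditions in `R` discard ranks that are not
  -- attained.
  let g : ℕ → V := Function.invFunOn r X
  have hg : ∀ x ∈ X, g (r x) = x := fun x hx => h.rank_injOn.leftInvOn_invFunOn hx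
  set n := X.card
  let R : Finset (ℕ × ℕ) := (Finset.range n ×ˢ Finset.range n).filter fun q =>
    q.1 < q.2 ∧ (g q.1 ∈ X ∧ r (g q.1) = q.1) ∧ (g q.2 ∈ X ∧ r (g q.2) = q.2) ∧
      s(g q.1, g q.2) ∈ H
  have hR : ∀ q ∈ R, q.1 < q.2 ∧ q.2 < n := by
    intro q hq
    obtain ⟨h1, h2, -⟩ := Finset.mem_filter.mp hq
    exact ⟨h2, Finset.mem_range.mp (Finset.mem_product.mp h1).2⟩
  have hXn : X.filter (r · < n) = X := Finset.filter_true_of_mem h.rank_lt_card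
  refine ⟨R.card, ?_, sq_card_le_of_cut n k R hR fun m => ?_⟩
  · have hcr := (h.card_crossing_le n).trans (hsub n)
    rw [hXn] at hcr
    refine le_trans ?_ (Nat.add_le_add_left hcr _)
    have hint : H ⊆ (R.image fun q => s(g q.1, g q.2)) ∪
        H.filter fun f => ∃ x ∈ X, Blk x f ∧ ∀ y ∈ f, y ∈ X → y = x := by
      intro f hf
      rw [Finset.mem_union]
      by_cases hc : ∃ x ∈ X, Blk x f ∧ ∀ y ∈ f, y ∈ X → y = x
      · exact Or.inr (Finset.mem_filter.mpr ⟨hf, hc⟩)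
      left
      push Not at hc
      obtain ⟨x, hxb⟩ := h.exists_blk f hf
      have hxX := h.mem f hf x hxb
      obtain ⟨y, hyf, hyX, hyx⟩ := hc x hxX hxb
      have hfe := (Sym2.mem_and_mem_iff hyx).mp ⟨hyf, h.mem_edge f hf x hxb⟩
      rw [Finset.mem_image]
      rcases lt_or_gt_of_ne fun e => hyx (h.rank_injOn hyX hxX e) with hlt | hlt
      · refine ⟨(r y, r x), Finset.mem_filter.mpr ⟨?_, hlt, ?_⟩, ?_⟩
        · simp [h.rank_lt_card x hxX, h.rank_lt_card y hyX, n]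
        · simp [hg x hxX, hg y hyX, hxX, hyX, ← hfe, hf]
        · simp [hg x hxX, hg y hyX, hfe]
      · refine ⟨(r x, r y), Finset.mem_filter.mpr ⟨?_, hlt, ?_⟩, ?_⟩
        · simp [h.rank_lt_card x hxX, h.rank_lt_card y hyX, n]
        · simp [hg x hxX, hg y hyX, hxX, hyX, Sym2.eq_swap (a := x), ← hfe, hf]
        · simp [hg x hxX, hg y hyX, hfe, Sym2.eq_swap (a := x)]
    refine (Finset.card_le_card hint).trans ((Finset.card_union_le _ _).trans ?_)
    exact Nat.add_le_add_right Finset.card_image_le _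
  · refine le_trans ?_ ((h.card_crossing_le m).trans (hsub m))
    refine Finset.card_le_card_of_injOn (fun q => s(g q.1, g q.2)) ?_ ?_
    · intro q hq
      obtain ⟨hq, hq1, hq2⟩ := Finset.mem_filter.mp hq
      obtain ⟨-, hlt, ⟨hx, hrx⟩, ⟨hy, hry⟩, hf⟩ := Finset.mem_filter.mp hq
      -- The lower end must block the edge: otherwise the upper end would be the blocker and have
      -- smaller rank.
      have hxb : Blk (g q.1) s(g q.1, g q.2) := by
        by_contra hnb
        obtain ⟨z, hz⟩ := h.exists_blk _ hf
        have hr := h.rank_lt _ hf z (g q.1) hz (by simp) hnb hx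
        rcases Sym2.mem_iff.mp (h.mem_edge _ hf z hz) with rfl | rfl
        · exact hnb hz
        · omega
      refine Finset.mem_filter.mpr ⟨hf, g q.1, Finset.mem_filter.mpr ⟨hx, by omega⟩, hxb, ?_⟩
      intro z hz hzU
      rcases Sym2.mem_iff.mp hz with rfl | rfl
      · rfl
      · have := (Finset.mem_filter.mp hzU).2
        omega
    · intro q hq q' hq' heq
      obtain ⟨hq, -, -⟩ := Finset.mem_filter.mp hq
      obtain ⟨-, hlt, ⟨hx, hrx⟩, ⟨hy, hry⟩, -⟩ := Finset.mem_filter.mp hq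
      obtain ⟨hq', -, -⟩ := Finset.mem_filter.mp hq'
      obtain ⟨-, hlt', ⟨hx', hrx'⟩, ⟨hy', hry'⟩, -⟩ := Finset.mem_filter.mp hq'
      rcases Sym2.eq_iff.mp heq with ⟨e1, e2⟩ | ⟨e1, e2⟩
      · rw [e1, hrx'] at hrx
        rw [e2, hry'] at hry
        exact Prod.ext hrx.symm hry.symm
      · rw [e1, hry'] at hrx
        rw [e2, hrx'] at hry
        omega

end IsBlocking

end Blocking

/-! ### Stability of the projections of edge sets -/

section Stability

variable {V κ : Type*} [DecidableEq V] [LinearOrder κ] {τ : Sym2 V → κ} {D : ℕ}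
  {E A B : Finset (Sym2 V)} {p : Sym2 V → Prop} [DecidablePred p]

theorem edgesBefore_filter_add_le (τ : Sym2 V → κ) (E : Finset (Sym2 V)) (p : Sym2 V → Prop)
    [DecidablePred p] (f : Sym2 V) (x : V) :
    edgesBefore τ E f x ≤
      edgesBefore τ (E.filter p) f x + edgeDeg (E.filter fun e => ¬ p e) x := by
  unfold edgesBefore edgeDeg
  refine le_trans (Finset.card_le_card fun g hg => ?_) (Finset.card_union_le _ _)
  simp only [Finset.mem_union, Finset.mem_filter] at hg ⊢
  tauto

/-- With original degrees, every surviving edge whose status changes is charged to a node of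
degree greater than `D` that lost an edge, and no node is charged twice. -/
theorem IsProj.original_card_le (hτ : Function.Injective τ) (hA : IsProj .original τ D E A)
    (hB : IsProj .original τ D (E.filter p) B)
    (hs : ∀ f ∈ E, p f → ∀ x ∈ f, edgeDeg (E.filter fun e => ¬ p e) x ≤ 1) (X : Finset V)
    (hX : ∀ f ∈ E, p f → ∀ x ∈ f, D < edgeDeg E x →
      0 < edgeDeg (E.filter fun e => ¬ p e) x → x ∈ X) :
    ((symmDiff A B).filter p).card ≤ X.card ∧
      ∀ f ∈ (symmDiff A B).filter p, ∃ x ∈ X, x ∈ f := by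
  have key : ∀ f, ∃ x, f ∈ (symmDiff A B).filter p →
      x ∈ X ∧ x ∈ f ∧ f ∈ E ∧ edgesBefore τ E f x = D := by
    intro f
    by_cases hf : f ∈ (symmDiff A B).filter p
    swap
    · induction f using Sym2.inductionOn with
      | _ a b => exact ⟨a, fun h => absurd h hf⟩
    obtain ⟨hf, hp⟩ := Finset.mem_filter.mp hf
    rcases Finset.mem_symmDiff.mp hf with ⟨hfA, hfB⟩ | ⟨hfB, hfA⟩
    -- Fewer original edges mean smaller counts, so no surviving edge turns from accepted to
    -- rejected.
    · exfalso
      obtain ⟨x, hx, hle⟩ := hB.exists_le_of_notMem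
        (Finset.mem_filter.mpr ⟨hA.subset hfA, hp⟩) hfB
      have h1 := hA.edgesBefore_lt hfA hx
      have h2 := edgesBefore_le_of_subset (τ := τ) (Finset.filter_subset p E) f x
      simp only [Criterion.counted] at hle h1
      omega
    · have hfE := (Finset.mem_filter.mp (hB.subset hfB)).1
      obtain ⟨x, hx, hle⟩ := hA.exists_le_of_notMem hfE hfA
      have h1 := hB.edgesBefore_lt hfB hx
      have h2 := edgesBefore_filter_add_le τ E p f x
      have h3 := hs f hfE hp x hx
      have h4 := edgesBefore_lt_edgeDeg (τ := τ) hfE hx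
      simp only [Criterion.counted] at hle h1
      -- The count at `x` falls from at least `D` to below `D` by losing at most one edge: it was
      -- exactly `D`, and one edge was lost.
      exact ⟨x, fun _ => ⟨hX f hfE hp x hx (by omega) (by omega), hx, hfE, by omega⟩⟩
  choose x hx using key
  refine ⟨Finset.card_le_card_of_injOn x (fun f hf => (hx f hf).1) fun f hf g hg hfg => ?_,
    fun f hf => ⟨x f, (hx f hf).1, (hx f hf).2.1⟩⟩
  obtain ⟨-, f1, f2, f3⟩ := hx f hf
  obtain ⟨-, g1, g2, g3⟩ := hx g hg
  -- Counts at `x` strictly increase along the edges at `x`, so only one edge sees the value `D`.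
  rw [← hfg] at g1 g3
  rcases lt_trichotomy (τ f) (τ g) with h | h | h
  · have := edgesBefore_lt_edgesBefore f2 f1 h
    omega
  · exact hτ h
  · have := edgesBefore_lt_edgesBefore g2 g1 h
    omega

/-- All edges of `B` at `x`, exactly `D` of them, precede `f`. Fewer than `D` edges of `A` at `x`
precede `f`, hence also any such edge of `B`. The cardinalities compare because `A` has at most `D`
edges at `x`. -/
theorem card_sdiff_le_of_saturated {x : V} (hA : ∀ e ∈ A, ∀ x ∈ e, edgesBefore τ A e x < D)
    (hAd : edgeDeg A x ≤ D) (hBd : edgeDeg B x ≤ D) {f : Sym2 V} (hf : f ∈ A) (hx : x ∈ f)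
    (hle : D ≤ edgesBefore τ B f x) :
    (∀ g ∈ B, x ∈ g → edgesBefore τ A g x < D) ∧
      (A.filter (x ∈ ·) \ B.filter (x ∈ ·)).card ≤ (B.filter (x ∈ ·) \ A.filter (x ∈ ·)).card := by
  have hsub : (B.filter fun g => τ g < τ f ∧ x ∈ g) ⊆ B.filter (x ∈ ·) := fun g hg => by
    simp only [Finset.mem_filter] at hg ⊢
    exact ⟨hg.1, hg.2.2⟩
  have heq := Finset.eq_of_subset_of_card_le hsub (hBd.trans hle)
  constructor
  · intro g hg hxg
    have : g ∈ B.filter fun g => τ g < τ f ∧ x ∈ g := by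
      rw [heq]; exact Finset.mem_filter.mpr ⟨hg, hxg⟩
    have hlt := (Finset.mem_filter.mp this).2.1
    exact (edgesBefore_mono hlt.le x).trans_lt (hA f hf x hx)
  · have h1 := Finset.card_sdiff_add_card_inter (A.filter (x ∈ ·)) (B.filter (x ∈ ·))
    have h2 := Finset.card_sdiff_add_card_inter (B.filter (x ∈ ·)) (A.filter (x ∈ ·))
    rw [Finset.inter_comm] at h2
    have h3 : D ≤ (B.filter (x ∈ ·)).card := hle.trans (Finset.card_le_card hsub)
    unfold edgeDeg at hAd
    omega

/-- The status of `f` differs, and `x` is saturated where `f` is rejected. -/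
structure Blocks (τ : Sym2 V → κ) (D : ℕ) (A B : Finset (Sym2 V)) (x : V) (f : Sym2 V) : Prop where
  mem : x ∈ f
  saturated : (f ∈ A ∧ f ∉ B ∧ D ≤ edgesBefore τ B f x) ∨
    (f ∈ B ∧ f ∉ A ∧ D ≤ edgesBefore τ A f x)

/-- With projected degrees, the surviving edges whose status changes form a blocking system. -/
theorem IsProj.exists_isBlocking (hτ : Function.Injective τ) (hA : IsProj .projected τ D E A)
    (hB : IsProj .projected τ D (E.filter p) B) :
    ∃ X Blk r, IsBlocking ((symmDiff A B).filter p) X Blk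
        (fun x => edgeDeg (A.filter fun e => ¬ p e) x) r ∧
      ∀ x ∈ X, D < edgeDeg E x ∧ ∃ f ∈ E, p f ∧ x ∈ f := by
  classical
  set H := (symmDiff A B).filter p with hH
  have hAlt : ∀ e ∈ A, ∀ x ∈ e, edgesBefore τ A e x < D := fun e he x hx => hA.edgesBefore_lt he hx
  have hBlt : ∀ e ∈ B, ∀ x ∈ e, edgesBefore τ B e x < D := fun e he x hx => hB.edgesBefore_lt he hx
  have hAd := hA.edgeDeg_le hτ
  have hBd := hB.edgeDeg_le hτ
  have hAE := hA.subset
  have hBE : ∀ e ∈ B, e ∈ E ∧ p e := fun e he => Finset.mem_filter.mp (hB.subset he)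
  have hmem : ∀ f, f ∈ H ↔ ((f ∈ A ∧ f ∉ B) ∨ (f ∈ B ∧ f ∉ A)) ∧ p f := fun f => by
    rw [hH, Finset.mem_filter, Finset.mem_symmDiff]
  have hHE : ∀ f ∈ H, f ∈ E := by
    intro f hf
    rcases ((hmem f).mp hf).1 with h | h
    · exact hAE h.1
    · exact (hBE f h.1).1
  let X : Finset V := (H.biUnion Sym2.toFinset).filter fun x => ∃ f ∈ H, Blocks τ D A B x f
  have hXmem : ∀ f ∈ H, ∀ x, Blocks τ D A B x f → x ∈ X := fun f hf x hx =>
    Finset.mem_filter.mpr ⟨Finset.mem_biUnion.mpr ⟨f, hf, Sym2.mem_toFinset.mpr hx.mem⟩, f, hf, hx⟩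
  have hfirst : ∀ x, ∃ f, x ∈ X →
      f ∈ H ∧ Blocks τ D A B x f ∧ ∀ g ∈ H, Blocks τ D A B x g → τ f ≤ τ g := by
    intro x
    by_cases hx : x ∈ X
    · obtain ⟨-, f, hf, hb⟩ := Finset.mem_filter.mp hx
      obtain ⟨g, hg, hmin⟩ := Finset.exists_min_image (H.filter fun f => Blocks τ D A B x f) τ
        ⟨f, Finset.mem_filter.mpr ⟨hf, hb⟩⟩
      obtain ⟨hg1, hg2⟩ := Finset.mem_filter.mp hg
      exact ⟨g, fun _ => ⟨hg1, hg2, fun k hk hkb => hmin k (Finset.mem_filter.mpr ⟨hk, hkb⟩)⟩⟩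
    · exact ⟨s(x, x), fun h => absurd h hx⟩
  choose first hfirst using hfirst
  -- The rank of a node is decided by the earliest edge it blocks.
  obtain ⟨r, hr1, hr2, hr3⟩ := X.exists_rank fun x => τ (first x)
  refine ⟨X, Blocks τ D A B, r, ⟨fun f _ x hx => hx.mem, hXmem, ?_, ?_, ?_, hr1, hr2⟩, ?_⟩
  · intro f hf
    obtain ⟨h, hp⟩ := (hmem f).mp hf
    rcases h with ⟨h1, h2⟩ | ⟨h1, h2⟩
    · obtain ⟨x, hx, hle⟩ := hB.exists_le_of_notMem (Finset.mem_filter.mpr ⟨hAE h1, hp⟩) h2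
      exact ⟨x, hx, Or.inl ⟨h1, h2, hle⟩⟩
    · obtain ⟨x, hx, hle⟩ := hA.exists_le_of_notMem (hBE f h1).1 h2
      exact ⟨x, hx, Or.inr ⟨h1, h2, hle⟩⟩
  · intro x hx
    obtain ⟨-, f, hf, hxf, hb⟩ := Finset.mem_filter.mp hx
    rcases hb with ⟨hfA, hfB, hle⟩ | ⟨hfB, hfA, hle⟩
    -- If `x` is saturated in `B`, it blocks only edges of `A \ B`, and none of `B \ A`. All edges
    -- of `B` survive, so the supply is not needed.
    · obtain ⟨hsat, hcard⟩ := card_sdiff_le_of_saturated hAlt (hAd x) (hBd x) hfA hxf hle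
      refine le_trans (Finset.card_le_card ?_) (hcard.trans (le_trans (Finset.card_le_card ?_)
        (Nat.le_add_right _ _)))
      · intro g hg
        obtain ⟨-, hxg, hg⟩ := Finset.mem_filter.mp hg
        simp only [Finset.mem_sdiff, Finset.mem_filter]
        rcases hg with hg | hg
        · tauto
        · have := hsat g hg.1 hxg
          omega
      · intro g hg
        simp only [Finset.mem_sdiff, Finset.mem_filter] at hg
        obtain ⟨⟨hgB, hxg⟩, hgA⟩ := hg
        have hgA' : g ∉ A := fun h => hgA ⟨h, hxg⟩
        refine Finset.mem_filter.mpr ⟨(hmem g).mpr ⟨Or.inr ⟨hgB, hgA'⟩, (hBE g hgB).2⟩, hxg, ?_⟩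
        rintro ⟨-, hg | hg⟩
        · exact hgA' hg.1
        · have := hsat g hgB hxg
          omega
    -- With the roles exchanged, the compensating edges of `A \ B` may be among the removed ones;
    -- these are the supply of `x`.
    · obtain ⟨hsat, hcard⟩ := card_sdiff_le_of_saturated hBlt (hBd x) (hAd x) hfB hxf hle
      refine le_trans (Finset.card_le_card ?_) (hcard.trans (le_trans (Finset.card_le_card ?_)
        (Finset.card_union_le _ _)))
      · intro g hg
        obtain ⟨-, hxg, hg⟩ := Finset.mem_filter.mp hg
        simp only [Finset.mem_sdiff, Finset.mem_filter]
        rcases hg with hg | hg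
        · have := hsat g hg.1 hxg
          omega
        · tauto
      · intro g hg
        simp only [Finset.mem_sdiff, Finset.mem_filter] at hg
        obtain ⟨⟨hgA, hxg⟩, hgB⟩ := hg
        have hgB' : g ∉ B := fun h => hgB ⟨h, hxg⟩
        rw [Finset.mem_union]
        by_cases hp : p g
        · refine Or.inl (Finset.mem_filter.mpr
            ⟨(hmem g).mpr ⟨Or.inl ⟨hgA, hgB'⟩, hp⟩, hxg, ?_⟩)
          rintro ⟨-, hg | hg⟩
          · have := hsat g hgA hxg
            omega
          · exact hgB' hg.1
        · exact Or.inr (Finset.mem_filter.mpr ⟨Finset.mem_filter.mpr ⟨hgA, hp⟩, hxg⟩)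
  · intro f hf x y hxb hyf hyb hyX
    have hxX := hXmem f hf x hxb
    obtain ⟨hg1, ⟨hyg, hg2⟩, -⟩ := hfirst y hyX
    -- If `y` blocked some edge no later than `f`, it would still be saturated before `f` in one of
    -- the outputs: impossible in the output accepting `f`, and in the other one `y` would block
    -- `f`.
    refine hr3 x hxX y hyX (((hfirst x hxX).2.2 f hf hxb).trans_lt (not_le.mp fun hgf => ?_))
    set g := first y
    have m1 := edgesBefore_mono (τ := τ) (F := A) hgf y
    have m2 := edgesBefore_mono (τ := τ) (F := B) hgf y
    rcases ((hmem f).mp hf).1 with ⟨hfA, hfB⟩ | ⟨hfB, hfA⟩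
    · have h1 := hAlt f hfA y hyf
      have h2 : edgesBefore τ B f y < D := by
        by_contra h
        exact hyb ⟨hyf, Or.inl ⟨hfA, hfB, not_lt.mp h⟩⟩
      rcases hg2 with ⟨-, -, h⟩ | ⟨-, -, h⟩ <;> omega
    · have h1 := hBlt f hfB y hyf
      have h2 : edgesBefore τ A f y < D := by
        by_contra h
        exact hyb ⟨hyf, Or.inr ⟨hfB, hfA, not_lt.mp h⟩⟩
      rcases hg2 with ⟨-, -, h⟩ | ⟨-, -, h⟩ <;> omega
  · intro x hx
    obtain ⟨-, f, hf, hxf, hb⟩ := Finset.mem_filter.mp hx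
    have hfE := hHE f hf
    refine ⟨?_, f, hfE, ((hmem f).mp hf).2, hxf⟩
    -- The `D` saturating edges and `f` itself give degree above `D`.
    have h1 := edgesBefore_lt_edgeDeg (τ := τ) hfE hxf
    have h2 := edgesBefore_le_of_subset (τ := τ) hAE f x
    have h3 := edgesBefore_le_of_subset (τ := τ) (fun e he => (hBE e he).1) f x
    rcases hb with ⟨-, -, h⟩ | ⟨-, -, h⟩ <;> omega

end Stability

/-! ### Stability of the projections of streams -/

section StreamStability

namespace GraphStream

variable {V : Type*} [DecidableEq V] {T : ℕ} {S S' : GraphStream V T}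
  {ord : LinearOrder (Sym2 V)} {D l : ℕ}

theorem proj_maxDegreeLE (c : Criterion) (ord : LinearOrder (Sym2 V)) (D : ℕ)
    (S : GraphStream V T) : (S.proj c ord D).flatten.MaxDegreeLE D := by
  obtain ⟨κ, _, τ, hτ⟩ := exists_isKey ord S
  exact fun v _ => (hτ.isProj c D).edgeDeg_le hτ.injective v

theorem nodes_eq_filter_verts (S : GraphStream V T) (i : Fin T) :
    S.nodes i = (S.nodes i).filter (· ∈ S.flatten.verts) :=
  (Finset.filter_true_of_mem fun _ hv => mem_flatten_verts.mpr ⟨i, hv⟩).symm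

theorem proj_eq_sub_self (c : Criterion) (ord : LinearOrder (Sym2 V)) (D : ℕ)
    (S : GraphStream V T) :
    S.proj c ord D = S.sub S.flatten.verts (S.proj c ord D).flatten.edges :=
  proj_eq_sub _ (nodes_eq_filter_verts S) fun _ => subset_rfl

theorem RemovesNode.proj_eq_sub {v : V} (h : RemovesNode S S' v) (c : Criterion)
    (ord : LinearOrder (Sym2 V)) (D : ℕ) :
    S'.proj c ord D = S.sub (S.flatten.verts.erase v) (S'.proj c ord D).flatten.edges := by
  refine GraphStream.proj_eq_sub _ (fun i => ?_) fun i => ?_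
  · rw [h.2.1 i]
    ext x
    simp only [Finset.mem_erase, Finset.mem_filter, mem_flatten_verts]
    exact ⟨fun hx => ⟨hx.2, hx.1, i, hx.2⟩, fun hx => ⟨hx.2.1, hx.1⟩⟩
  · rw [h.2.2 i]
    exact Finset.filter_subset _ _

theorem RemovesNode.exists_isProj.{u} {V : Type u} [DecidableEq V] {S S' : GraphStream V T} {v : V}
    (h : RemovesNode S S' v) (c : Criterion) (ord : LinearOrder (Sym2 V)) (D : ℕ) :
    ∃ (κ : Type u) (_ : LinearOrder κ) (τ : Sym2 V → κ), Function.Injective τ ∧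
      IsProj c τ D S.flatten.edges (S.proj c ord D).flatten.edges ∧
      IsProj c τ D (S.flatten.edges.filter (v ∉ ·)) (S'.proj c ord D).flatten.edges := by
  obtain ⟨κ, i, τ, hτ⟩ := exists_isKey ord S
  refine ⟨κ, i, τ, hτ.injective, hτ.isProj c D, ?_⟩
  have h1 := (hτ.mono (S' := S') fun i => by
    rw [h.2.2 i]; exact Finset.filter_subset _ _).isProj c D
  have h2 : S'.flatten.edges = S.flatten.edges.filter (v ∉ ·) := by
    ext e
    rw [h.edges_iff, Finset.mem_filter]
  rwa [h2] at h1

theorem RemovesEdge.exists_isProj.{u} {V : Type u} [DecidableEq V] {S S' : GraphStream V T}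
    {e : Sym2 V} (h : RemovesEdge S S' e) (c : Criterion) (ord : LinearOrder (Sym2 V)) (D : ℕ) :
    ∃ (κ : Type u) (_ : LinearOrder κ) (τ : Sym2 V → κ), Function.Injective τ ∧
      IsProj c τ D S.flatten.edges (S.proj c ord D).flatten.edges ∧
      IsProj c τ D (S.flatten.edges.filter (· ≠ e)) (S'.proj c ord D).flatten.edges := by
  obtain ⟨κ, i, τ, hτ⟩ := exists_isKey ord S
  refine ⟨κ, i, τ, hτ.injective, hτ.isProj c D, ?_⟩
  have h1 := (hτ.mono (S' := S') fun i => by rw [h.2.2 i]; exact Finset.erase_subset _ _).isProj c D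
  have h2 : S'.flatten.edges = S.flatten.edges.filter (· ≠ e) := by
    ext f
    simp only [mem_flatten_edges, h.2.2, Finset.mem_filter, Finset.mem_erase]
    tauto
  rwa [h2] at h1

theorem card_filter_mem_le_one {V : Type*} [DecidableEq V] (X : Finset V) {v : V} (hv : v ∉ X)
    {f : Sym2 V} (hf : v ∈ f) : (X.filter (· ∈ f)).card ≤ 1 := by
  refine Finset.card_le_one.mpr fun a ha b hb => ?_
  obtain ⟨haX, haf⟩ := Finset.mem_filter.mp ha
  obtain ⟨hbX, hbf⟩ := Finset.mem_filter.mp hb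
  have hva : v ≠ a := fun h => hv (h ▸ haX)
  rcases Sym2.eq_or_eq_of_mem hf haf hva hbf with rfl | rfl
  · exact absurd hbX hv
  · rfl

/-- Simplicity of the graph: removing `v` costs any other node at most one edge. -/
theorem edgeDeg_through_le_one (F : Finset (Sym2 V)) {v x : V} (hx : x ≠ v) :
    edgeDeg (F.filter fun e => ¬ v ∉ e) x ≤ 1 := by
  refine Finset.card_le_one.mpr fun a ha b hb => ?_
  simp only [Finset.mem_filter, not_not] at ha hb
  rw [(Sym2.mem_and_mem_iff hx).mp ⟨ha.2, ha.1.2⟩, (Sym2.mem_and_mem_iff hx).mp ⟨hb.2, hb.1.2⟩]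

/-- An edge at `v` has at most one endpoint in `X`. This bounds the total supply by the degree of
`v` in the output. -/
theorem sum_edgeDeg_through_le (F : Finset (Sym2 V)) {v : V} {X : Finset V} (hX : v ∉ X) :
    ∑ x ∈ X, edgeDeg (F.filter fun e => ¬ v ∉ e) x ≤ edgeDeg F v := by
  unfold edgeDeg
  rw [Finset.sum_card_filter_comm X _ fun x f => x ∈ f]
  refine (Finset.sum_le_sum (g := fun _ => 1) fun f hf => ?_).trans ?_
  · exact card_filter_mem_le_one X hX (not_not.mp (Finset.mem_filter.mp hf).2)
  · simp

theorem card_le_of_forall_degree (hS : S.flatten.IsBounded D l) {X : Finset V}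
    (hX : ∀ x ∈ X, D < edgeDeg S.flatten.edges x ∧ ∃ f ∈ S.flatten.edges, x ∈ f) :
    X.card ≤ l := by
  refine (Finset.card_le_card fun x hx => ?_).trans hS
  obtain ⟨h1, f, hf, hxf⟩ := hX x hx
  exact Finset.mem_filter.mpr ⟨S.flatten.endpoint_mem f hf x hxf, h1⟩

theorem RemovesNode.edgeDist_le {v : V} (h : RemovesNode S S' v) (c : Criterion)
    (ord : LinearOrder (Sym2 V)) (D : ℕ) :
    (S.proj c ord D).edgeDist (S'.proj c ord D) ≤
      (((symmDiff (S.proj c ord D).flatten.edges (S'.proj c ord D).flatten.edges).filter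
        (v ∉ ·)).card + max 1 (edgeDeg (S.proj c ord D).flatten.edges v) : ℕ) := by
  obtain ⟨κ, _, τ, hτ, hA, hB⟩ := h.exists_isProj c ord D
  have := edgeDist_sub_erase_le S S.flatten.verts (S.proj c ord D).flatten.edges
    (S'.proj c ord D).flatten.edges v fun e he => (Finset.mem_filter.mp (hB.subset he)).2
  rwa [← proj_eq_sub_self, ← h.proj_eq_sub] at this

theorem RemovesNode.nodeDist_le {v : V} (h : RemovesNode S S' v) (c : Criterion)
    (ord : LinearOrder (Sym2 V)) (D : ℕ) (X : Finset V)
    (hX : ∀ e ∈ (symmDiff (S.proj c ord D).flatten.edges (S'.proj c ord D).flatten.edges).filter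
      (v ∉ ·), ∃ x ∈ X, x ∈ e) :
    (S.proj c ord D).nodeDist (S'.proj c ord D) ≤ (2 * X.card + 1 : ℕ) := by
  have := nodeDist_sub_erase_le_of_cover S S.flatten.verts X (S.proj c ord D).flatten.edges
    (S'.proj c ord D).flatten.edges v fun e he hv => hX e (Finset.mem_filter.mpr ⟨he, hv⟩)
  rwa [← proj_eq_sub_self, ← h.proj_eq_sub] at this

theorem RemovesEdge.edgeDist_le {e : Sym2 V} (h : RemovesEdge S S' e) (c : Criterion)
    (ord : LinearOrder (Sym2 V)) (D : ℕ) :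
    (S.proj c ord D).edgeDist (S'.proj c ord D) ≤
      (((symmDiff (S.proj c ord D).flatten.edges (S'.proj c ord D).flatten.edges).filter
        (· ≠ e)).card + 1 : ℕ) := by
  have h' : S'.proj c ord D = S.sub S.flatten.verts (S'.proj c ord D).flatten.edges := by
    refine GraphStream.proj_eq_sub _ (fun i => ?_) fun i => ?_
    · rw [h.2.1 i]
      exact S.nodes_eq_filter_verts i
    · rw [h.2.2 i]
      exact Finset.erase_subset _ _
  have := edgeDist_sub_le S S.flatten.verts (S.proj c ord D).flatten.edges
    (S'.proj c ord D).flatten.edges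
  rw [← proj_eq_sub_self, ← h'] at this
  refine this.trans (Nat.cast_le.mpr ?_)
  rw [Finset.filter_ne']
  exact Nat.le_add_of_sub_le Finset.pred_card_le_card_erase

/-! #### Node neighbors -/

/-- The nodes of degree above `D` both count the changed edges, for the edge distance, and cover
them, for the node distance. -/
theorem RemovesNode.exists_cover_bbds {v : V} (h : RemovesNode S S' v)
    (hS : S.flatten.IsBounded D l) :
    ∃ X : Finset V, X.card ≤ l ∧
      ((symmDiff (S.proj .original ord D).flatten.edges
        (S'.proj .original ord D).flatten.edges).filter
        (v ∉ ·)).card ≤ X.card ∧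
      ∀ e ∈ (symmDiff (S.proj .original ord D).flatten.edges
        (S'.proj .original ord D).flatten.edges).filter
        (v ∉ ·), ∃ x ∈ X, x ∈ e := by
  obtain ⟨κ, _, τ, hτ, hA, hB⟩ := h.exists_isProj .original ord D
  refine ⟨S.flatten.verts.filter fun x => D < S.flatten.degree x, hS, ?_⟩
  refine IsProj.original_card_le hτ hA hB (fun f _ hvf x hx => edgeDeg_through_le_one _ ?_) _ ?_
  · rintro rfl
    exact hvf hx
  · intro f hf _ x hx hd _
    exact Finset.mem_filter.mpr ⟨S.flatten.endpoint_mem f hf x hx, hd⟩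

theorem RemovesNode.edgeDist_bbds_le {v : V} (h : RemovesNode S S' v) (hD : 1 ≤ D)
    (hS : S.flatten.IsBounded D l) :
    (S.bbds ord D).edgeDist (S'.bbds ord D) ≤ (D + l : ℕ) := by
  obtain ⟨X, h1, h2, -⟩ := h.exists_cover_bbds (ord := ord) hS
  refine (h.edgeDist_le .original ord D).trans (Nat.cast_le.mpr ?_)
  obtain ⟨κ, _, τ, hτ, hA, -⟩ := h.exists_isProj .original ord D
  have := hA.edgeDeg_le hτ v
  omega

theorem RemovesNode.nodeDist_bbds_le {v : V} (h : RemovesNode S S' v)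
    (hS : S.flatten.IsBounded D l) :
    (S.bbds ord D).nodeDist (S'.bbds ord D) ≤ (2 * l + 1 : ℕ) := by
  obtain ⟨X, h1, -, h2⟩ := h.exists_cover_bbds (ord := ord) hS
  exact (h.nodeDist_le .original ord D X h2).trans (Nat.cast_le.mpr (by omega))

/-- Each blocking node loses at most one output edge, and all lost edges are output edges at `v`.
These two bounds on the supply produce min {D, l}. -/
theorem RemovesNode.exists_isBlocking_dll {v : V} (h : RemovesNode S S' v)
    (hS : S.flatten.IsBounded D l) :
    ∃ X Blk s r, IsBlocking ((symmDiff (S.proj .projected ord D).flatten.edges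
      (S'.proj .projected ord D).flatten.edges).filter (v ∉ ·)) X Blk s r ∧ X.card ≤ l ∧
      ∑ x ∈ X, s x ≤ X.card ∧ ∑ x ∈ X, s x ≤ edgeDeg (S.proj .projected ord D).flatten.edges v := by
  obtain ⟨κ, _, τ, hτ, hA, hB⟩ := h.exists_isProj .projected ord D
  obtain ⟨X, Blk, r, hblk, hX⟩ := IsProj.exists_isBlocking hτ hA hB
  have hv : ∀ x ∈ X, x ≠ v := by
    rintro x hx rfl
    obtain ⟨-, f, -, h1, h2⟩ := hX x hx
    exact h1 h2
  refine ⟨X, Blk, _, r, hblk, ?_, ?_, ?_⟩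
  · refine card_le_of_forall_degree hS fun x hx => ?_
    obtain ⟨h1, f, hf, -, hxf⟩ := hX x hx
    exact ⟨h1, f, hf, hxf⟩
  · refine (Finset.sum_le_sum fun x hx => edgeDeg_through_le_one _ (hv x hx)).trans ?_
    simp
  · exact sum_edgeDeg_through_le _ fun h => hv v h rfl

theorem RemovesNode.nodeDist_dll_le {v : V} (h : RemovesNode S S' v)
    (hS : S.flatten.IsBounded D l) :
    (S.dll ord D).nodeDist (S'.dll ord D) ≤ (2 * l + 1 : ℕ) := by
  obtain ⟨X, Blk, s, r, hb, h1, -, -⟩ := h.exists_isBlocking_dll (ord := ord) hS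
  refine (h.nodeDist_le .projected ord D X fun e he => ?_).trans (Nat.cast_le.mpr (by omega))
  obtain ⟨x, hx⟩ := hb.exists_blk e he
  exact ⟨x, hb.mem e he x hx, hb.mem_edge e he x hx⟩

theorem RemovesNode.edgeDist_dll_le {v : V} (h : RemovesNode S S' v) (hD : 1 ≤ D)
    (hS : S.flatten.IsBounded D l) :
    ∃ n : ℕ, (S.dll ord D).edgeDist (S'.dll ord D) = n ∧
      (n : ℝ) ≤ (D : ℝ) + 2 * (l : ℝ) * √(min (D : ℝ) (l : ℝ)) := by
  obtain ⟨X, Blk, s, r, hb, h1, h2, h3⟩ := h.exists_isBlocking_dll (ord := ord) hS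
  obtain ⟨I, hI1, hI2⟩ := hb.exists_card_le_add le_rfl
  obtain ⟨κ, _, τ, hτ, hA, -⟩ := h.exists_isProj .projected ord D
  have hdeg := hA.edgeDeg_le hτ v
  have hle := h.edgeDist_le .projected ord D
  -- Finiteness turns the extended distance into a natural number, comparable with a real bound.
  obtain ⟨n, hn⟩ := ENat.ne_top_iff_exists.mp (ne_top_of_le_ne_top (ENat.natCast_ne_top _) hle)
  refine ⟨n, hn.symm, ?_⟩
  rw [← hn, Nat.cast_le] at hle
  have hfin := add_le_two_mul_mul_sqrt hI2 h2 (h3.trans hdeg) h1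
  have hn' : n ≤ D + (I + ∑ x ∈ X, s x) := by omega
  have hn'' : (n : ℝ) ≤ (D : ℝ) + ((I + ∑ x ∈ X, s x : ℕ) : ℝ) := by exact_mod_cast hn'
  linarith

/-! #### Edge neighbors -/

/-- Only the endpoints of the single removed edge lose an edge, so at most two survivors change, and
one more step is the removal itself. -/
theorem EdgeStep.edgeDist_bbds_le (h : EdgeStep S S') :
    (S.bbds ord D).edgeDist (S'.bbds ord D) ≤ 3 := by
  rcases h with ⟨e, h⟩ | ⟨v, hdeg, h⟩
  · obtain ⟨κ, _, τ, hτ, hA, hB⟩ := h.exists_isProj .original ord D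
    have hsub : S.flatten.edges.filter (fun f => ¬ f ≠ e) ⊆ {e} := fun f hf => by
      simp only [Finset.mem_filter, not_not] at hf
      simp [hf.2]
    have hc := (IsProj.original_card_le hτ hA hB (fun f _ _ x _ => ?_) e.toFinset ?_).1
    · refine (h.edgeDist_le .original ord D).trans (Nat.cast_le (n := 3).mpr ?_)
      have := Sym2.card_toFinset e
      split_ifs at this <;> omega
    · refine (Finset.card_le_card (Finset.filter_subset _ _)).trans ?_
      exact (Finset.card_le_card hsub).trans (by simp)
    · intro f _ _ x _ _ hpos
      obtain ⟨g, hg⟩ := Finset.card_pos.mp hpos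
      obtain ⟨hg1, hg2⟩ := Finset.mem_filter.mp hg
      rw [Finset.mem_singleton.mp (hsub hg1)] at hg2
      exact Sym2.mem_toFinset.mpr hg2
  · obtain ⟨κ, _, τ, hτ, hA, hB⟩ := h.exists_isProj .original ord D
    have hc := (IsProj.original_card_le hτ hA hB
      (fun f _ hvf x hx => edgeDeg_through_le_one _ ?_)
      ((S.flatten.edges.filter (v ∈ ·)).biUnion Sym2.toFinset) ?_).1
    · refine (h.edgeDist_le .original ord D).trans (Nat.cast_le (n := 3).mpr ?_)
      have h1 : ((S.flatten.edges.filter (v ∈ ·)).biUnion Sym2.toFinset).card ≤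
          (S.flatten.edges.filter (v ∈ ·)).card * 2 := by
        refine Finset.card_biUnion_le_card_mul _ _ _ fun e _ => ?_
        have := Sym2.card_toFinset e
        split_ifs at this <;> omega
      have h2 : edgeDeg (S.proj .original ord D).flatten.edges v ≤ S.flatten.degree v :=
        Finset.card_le_card (Finset.filter_subset_filter _ hA.subset)
      have h3 : (S.flatten.edges.filter (v ∈ ·)).card = S.flatten.degree v := rfl
      omega
    · rintro rfl
      exact hvf hx
    · intro f _ _ x _ _ hpos
      obtain ⟨g, hg⟩ := Finset.card_pos.mp hpos
      simp only [Finset.mem_filter, not_not] at hg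
      exact Finset.mem_biUnion.mpr ⟨g, Finset.mem_filter.mpr ⟨hg.1.1, hg.1.2⟩,
        Sym2.mem_toFinset.mpr hg.2⟩

/-- The total supply is at most 2, one for each endpoint of the removed edge, and at most 1 when a
node of degree at most 1 goes; each of at most `l` blocking nodes blocks no more edges than this. -/
theorem EdgeStep.edgeDist_dll_le (h : EdgeStep S S') (hS : S.flatten.IsBounded D l) :
    (S.dll ord D).edgeDist (S'.dll ord D) ≤ (2 * l + 1 : ℕ) := by
  rcases h with ⟨e, h⟩ | ⟨v, hdeg, h⟩
  · obtain ⟨κ, _, τ, hτ, hA, hB⟩ := h.exists_isProj .projected ord D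
    obtain ⟨X, Blk, r, hblk, hX⟩ := IsProj.exists_isBlocking hτ hA hB
    have hXl : X.card ≤ l := by
      refine card_le_of_forall_degree hS fun x hx => ?_
      obtain ⟨h1, f, hf, -, hxf⟩ := hX x hx
      exact ⟨h1, f, hf, hxf⟩
    refine (h.edgeDist_le .projected ord D).trans (Nat.cast_le.mpr ?_)
    have hsum : ∑ x ∈ X, edgeDeg ((S.dll ord D).flatten.edges.filter fun f => ¬ f ≠ e) x ≤ 2 := by
      unfold edgeDeg
      rw [Finset.sum_card_filter_comm X _ fun x f => x ∈ f]
      refine (Finset.sum_le_sum_of_subset (t := {e}) fun f hf => ?_).trans ?_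
      · simp only [Finset.mem_filter, not_not] at hf
        simp [hf.2]
      · rw [Finset.sum_singleton]
        refine (Finset.card_le_card (t := e.toFinset) fun x hx => ?_).trans ?_
        · exact Sym2.mem_toFinset.mpr (Finset.mem_filter.mp hx).2
        · have := Sym2.card_toFinset e
          split_ifs at this <;> omega
    have := hblk.card_le_mul.trans (Nat.mul_le_mul hXl hsum)
    omega
  · obtain ⟨X, Blk, s, r, hb, h1, -, h3⟩ := h.exists_isBlocking_dll (ord := ord) hS
    obtain ⟨κ, _, τ, hτ, hA, hB⟩ := h.exists_isProj .projected ord D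
    have h2 : edgeDeg (S.proj .projected ord D).flatten.edges v ≤ S.flatten.degree v :=
      Finset.card_le_card (Finset.filter_subset_filter _ hA.subset)
    refine (h.edgeDist_le .projected ord D).trans (Nat.cast_le.mpr ?_)
    have := hb.card_le_mul.trans (Nat.mul_le_mul h1 (h3.trans (h2.trans hdeg)))
    omega

/-! #### Stability through time `t` -/

theorem proj_stability_of_edgeNeighbor (h : S.EdgeNeighbor S') (t : ℕ) (ht : t ≤ T) :
    ((S.bbds ord D).upTo t ht).edgeDist ((S'.bbds ord D).upTo t ht) ≤ 3 ∧
    (S.BoundedThrough D l t ht → S'.BoundedThrough D l t ht →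
      ((S.dll ord D).upTo t ht).edgeDist ((S'.dll ord D).upTo t ht) ≤ (2 * l + 1 : ℕ)) := by
  have key : ∀ S S' : GraphStream V T, EdgeStep S S' →
      ((S.bbds ord D).upTo t ht).edgeDist ((S'.bbds ord D).upTo t ht) ≤ 3 ∧
      (S.BoundedThrough D l t ht →
        ((S.dll ord D).upTo t ht).edgeDist ((S'.dll ord D).upTo t ht) ≤ (2 * l + 1 : ℕ)) := by
    intro S S' h
    simp only [proj_upTo]
    rcases h.upTo t ht with h | h
    · rw [h]
      simp [edgeDist_self]
    · exact ⟨h.edgeDist_bbds_le, fun hS => h.edgeDist_dll_le hS⟩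
  rcases h with h | h
  · exact ⟨(key S S' h).1, fun hS _ => (key S S' h).2 hS⟩
  · rw [edgeDist_comm]
    refine ⟨(key S' S h).1, fun _ hS => ?_⟩
    rw [edgeDist_comm]
    exact (key S' S h).2 hS

theorem proj_stability_of_nodeNeighbor (h : S.NodeNeighbor S') (t : ℕ) (ht : t ≤ T) (hD : 1 ≤ D)
    (hS : S.BoundedThrough D l t ht) (hS' : S'.BoundedThrough D l t ht) :
    ((S.bbds ord D).upTo t ht).edgeDist ((S'.bbds ord D).upTo t ht) ≤ (D + l : ℕ) ∧
    (∃ n : ℕ, ((S.dll ord D).upTo t ht).edgeDist ((S'.dll ord D).upTo t ht) = n ∧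
      (n : ℝ) ≤ (D : ℝ) + 2 * (l : ℝ) * √(min (D : ℝ) (l : ℝ))) ∧
    ((S.bbds ord D).upTo t ht).nodeDist ((S'.bbds ord D).upTo t ht) ≤ (2 * l + 1 : ℕ) ∧
    ((S.dll ord D).upTo t ht).nodeDist ((S'.dll ord D).upTo t ht) ≤ (2 * l + 1 : ℕ) := by
  have key : ∀ S S' : GraphStream V T, NodeStep S S' → S.BoundedThrough D l t ht →
      ((S.bbds ord D).upTo t ht).edgeDist ((S'.bbds ord D).upTo t ht) ≤ (D + l : ℕ) ∧
      (∃ n : ℕ, ((S.dll ord D).upTo t ht).edgeDist ((S'.dll ord D).upTo t ht) = n ∧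
        (n : ℝ) ≤ (D : ℝ) + 2 * (l : ℝ) * √(min (D : ℝ) (l : ℝ))) ∧
      ((S.bbds ord D).upTo t ht).nodeDist ((S'.bbds ord D).upTo t ht) ≤ (2 * l + 1 : ℕ) ∧
      ((S.dll ord D).upTo t ht).nodeDist ((S'.dll ord D).upTo t ht) ≤ (2 * l + 1 : ℕ) := by
    rintro S S' ⟨v, h⟩ hS
    simp only [proj_upTo]
    rcases h.upTo t ht with h | h
    · rw [h]
      refine ⟨by simp [edgeDist_self], ⟨0, by simp [edgeDist_self], ?_⟩, by simp [nodeDist_self],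
        by simp [nodeDist_self]⟩
      rw [Nat.cast_zero]
      positivity
    · exact ⟨h.edgeDist_bbds_le hD hS, h.edgeDist_dll_le hD hS, h.nodeDist_bbds_le hS,
        h.nodeDist_dll_le hS⟩
  rcases h with h | h
  · exact key S S' h hS
  · have := key S' S h hS'
    rwa [edgeDist_comm, edgeDist_comm ((S'.dll ord D).upTo t ht), nodeDist_comm,
      nodeDist_comm ((S'.dll ord D).upTo t ht)] at this

end GraphStream

end StreamStability

/-! ### Graphs arriving in a single time step -/

namespace FinGraph

variable {V : Type*}

/-- The stream in which all of `G` arrives at the first time step. -/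
def instant (G : FinGraph V) (T : ℕ) : GraphStream V T where
  nodes i := if (i : ℕ) = 0 then G.verts else ∅
  edges i := if (i : ℕ) = 0 then G.edges else ∅
  nodes_disjoint i j hij := by
    split_ifs with h1 h2
    · exact absurd (Fin.ext (h1.trans h2.symm)) hij
    all_goals simp
  edges_disjoint i j hij := by
    split_ifs with h1 h2
    · exact absurd (Fin.ext (h1.trans h2.symm)) hij
    all_goals simp
  not_isDiag i e he := by
    split_ifs at he
    · exact G.not_isDiag e he
    · simp at he
  endpoint_arrived i e he v hv := by
    refine ⟨i, le_rfl, ?_⟩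
    split_ifs at he ⊢
    · exact G.endpoint_mem e he v hv
    · simp at he

variable [DecidableEq V]

theorem instant_flatten_edges (G : FinGraph V) {T : ℕ} (hT : 1 ≤ T) :
    (G.instant T).flatten.edges = G.edges := by
  ext e
  rw [GraphStream.mem_flatten_edges]
  constructor
  · rintro ⟨i, hi⟩
    simp only [instant] at hi
    split_ifs at hi
    · exact hi
    · simp at hi
  · intro he
    exact ⟨⟨0, hT⟩, by simpa [instant] using he⟩

theorem instant_flatten_verts (G : FinGraph V) {T : ℕ} (hT : 1 ≤ T) :
    (G.instant T).flatten.verts = G.verts := by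
  ext e
  rw [GraphStream.mem_flatten_verts]
  constructor
  · rintro ⟨i, hi⟩
    simp only [instant] at hi
    split_ifs at hi
    · exact hi
    · simp at hi
  · intro he
    exact ⟨⟨0, hT⟩, by simpa [instant] using he⟩

theorem instant_isBounded_iff (G : FinGraph V) {T : ℕ} (hT : 1 ≤ T) (D l : ℕ) :
    (G.instant T).flatten.IsBounded D l ↔ G.IsBounded D l := by
  unfold IsBounded degree
  rw [G.instant_flatten_edges hT, G.instant_flatten_verts hT]

/-- Remove a node and its edges. -/
def removeNode (G : FinGraph V) (v : V) : FinGraph V where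
  verts := G.verts.erase v
  edges := G.edges.filter (v ∉ ·)
  not_isDiag e he := G.not_isDiag e (Finset.mem_filter.mp he).1
  endpoint_mem e he x hx := by
    obtain ⟨h1, h2⟩ := Finset.mem_filter.mp he
    exact Finset.mem_erase.mpr ⟨fun h => h2 (h ▸ hx), G.endpoint_mem e h1 x hx⟩

/-- Remove an edge. -/
def removeEdge (G : FinGraph V) (e : Sym2 V) : FinGraph V where
  verts := G.verts
  edges := G.edges.erase e
  not_isDiag f hf := G.not_isDiag f (Finset.mem_of_mem_erase hf)
  endpoint_mem f hf x hx := G.endpoint_mem f (Finset.mem_of_mem_erase hf) x hx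

theorem instant_removesNode (G : FinGraph V) {T : ℕ} (hT : 1 ≤ T) {v : V} (hv : v ∈ G.verts) :
    (G.instant T).RemovesNode ((G.removeNode v).instant T) v := by
  refine ⟨by rwa [G.instant_flatten_verts hT], fun i => ?_, fun i => ?_⟩ <;>
  · simp only [instant, removeNode]
    split_ifs <;> simp

theorem instant_removesEdge (G : FinGraph V) {T : ℕ} (hT : 1 ≤ T) {e : Sym2 V}
    (he : e ∈ G.edges) : (G.instant T).RemovesEdge ((G.removeEdge e).instant T) e := by
  refine ⟨by rwa [G.instant_flatten_edges hT], fun i => rfl, fun i => ?_⟩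
  simp only [instant, removeEdge]
  split_ifs <;> simp

theorem IsBounded.removeNode {G : FinGraph V} {D l : ℕ} (h : G.IsBounded D l) (v : V) :
    (G.removeNode v).IsBounded D l := by
  refine (Finset.card_le_card fun x hx => ?_).trans h
  obtain ⟨h1, h2⟩ := Finset.mem_filter.mp hx
  refine Finset.mem_filter.mpr ⟨Finset.mem_of_mem_erase h1, h2.trans_le ?_⟩
  exact Finset.card_le_card (Finset.filter_subset_filter _ (Finset.filter_subset _ _))

end FinGraph

/-- The lexicographic key of an edge. -/
def lexKey {V : Type*} [LinearOrder V] (e : Sym2 V) : V ×ₗ V := toLex (e.inf, e.sup)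

theorem lexKey_mk {V : Type*} [LinearOrder V] {a b : V} (h : a < b) :
    lexKey s(a, b) = toLex (a, b) := by
  simp [lexKey, h.le]

/-! ### Exact distances for graphs under the lexicographic order -/

namespace FinGraph

variable {V : Type*} [LinearOrder V]

theorem instant_isKey (G : FinGraph V) (T : ℕ) :
    (G.instant T).IsKey (lexEdgeOrder V) lexKey := by
  refine ⟨fun e f h => ?_, fun i j hij e he f hf => ?_, fun i e he f hf hef => hef⟩
  · exact Sym2.inf_eq_inf_and_sup_eq_sup.mp (Prod.ext_iff.mp (toLex.injective h))
  · simp only [instant] at hf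
    split_ifs at hf with hj
    · have := Fin.lt_def.mp hij
      omega
    · simp at hf

/-- By uniqueness, computing a projection amounts to guessing its output and checking `IsProj`. -/
theorem instant_proj_edges (G : FinGraph V) {T : ℕ} (hT : 1 ≤ T) {c : Criterion} {D : ℕ}
    {A : Finset (Sym2 V)} (hA : IsProj c lexKey D G.edges A) :
    ((G.instant T).proj c (lexEdgeOrder V) D).flatten.edges = A := by
  have := (G.instant_isKey T).isProj c D
  rw [G.instant_flatten_edges hT] at this
  exact this.unique hA

/-- The edge distance of the projections when a node that keeps an edge is removed. -/
theorem edgeDist_removeNode_eq (G : FinGraph V) {T : ℕ} (hT : 1 ≤ T) {v : V} (hv : v ∈ G.verts)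
    {c : Criterion} {D : ℕ} {A B : Finset (Sym2 V)} (hA : IsProj c lexKey D G.edges A)
    (hB : IsProj c lexKey D (G.removeNode v).edges B) (hdeg : ∃ e ∈ A, v ∈ e) :
    ((G.instant T).proj c (lexEdgeOrder V) D).edgeDist
      (((G.removeNode v).instant T).proj c (lexEdgeOrder V) D) = (symmDiff A B).card := by
  refine le_antisymm ?_ ?_
  · refine ((G.instant_removesNode hT hv).edgeDist_le c (lexEdgeOrder V) D).trans ?_
    rw [G.instant_proj_edges hT hA, (G.removeNode v).instant_proj_edges hT hB, Nat.cast_le]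
    obtain ⟨e, heA, hve⟩ := hdeg
    have hpos : 0 < edgeDeg A v := Finset.card_pos.mpr ⟨e, Finset.mem_filter.mpr ⟨heA, hve⟩⟩
    rw [max_eq_right hpos]
    -- `B` avoids `v`, so every edge of `A` at `v` differs; the upper bound becomes the whole
    -- symmetric difference.
    have heq : A.filter (v ∈ ·) = (symmDiff A B).filter (v ∈ ·) := by
      ext f
      simp only [Finset.mem_filter, Finset.mem_symmDiff]
      have : f ∈ B → v ∉ f := fun hf => (Finset.mem_filter.mp (hB.subset hf)).2
      tauto
    unfold edgeDeg
    rw [heq, add_comm, Finset.card_filter_add_card_filter_not]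
  · have := GraphStream.card_symmDiff_le_edgeDist ((G.instant T).proj c (lexEdgeOrder V) D)
      (((G.removeNode v).instant T).proj c (lexEdgeOrder V) D)
    rwa [G.instant_proj_edges hT hA, (G.removeNode v).instant_proj_edges hT hB] at this

/-- The node distance of the projections when a node is removed and the remaining differing edges
have a matching and a cover of the same size. -/
theorem nodeDist_removeNode_eq (G : FinGraph V) {T : ℕ} (hT : 1 ≤ T) {v : V} (hv : v ∈ G.verts)
    {c : Criterion} {D n : ℕ} {A B M : Finset (Sym2 V)} {X : Finset V}
    (hA : IsProj c lexKey D G.edges A)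
    (hB : IsProj c lexKey D (G.removeNode v).edges B)
    (hX : ∀ e ∈ symmDiff A B, v ∉ e → ∃ x ∈ X, x ∈ e) (hXn : X.card ≤ n)
    (hM : ∀ e ∈ M, e ∈ symmDiff A B ∧ v ∉ e)
    (hdisj : ∀ e ∈ M, ∀ f ∈ M, ∀ x, x ∈ e → x ∈ f → e = f) (hMn : n ≤ M.card) :
    ((G.instant T).proj c (lexEdgeOrder V) D).nodeDist
      (((G.removeNode v).instant T).proj c (lexEdgeOrder V) D) = (2 * n + 1 : ℕ) := by
  have eA := G.instant_proj_edges hT hA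
  have eB := (G.removeNode v).instant_proj_edges hT hB
  refine le_antisymm ?_ ?_
  · refine ((G.instant_removesNode hT hv).nodeDist_le c (lexEdgeOrder V) D X ?_).trans
      (Nat.cast_le.mpr (by omega))
    rw [eA, eB]
    intro e he
    obtain ⟨h1, h2⟩ := Finset.mem_filter.mp he
    exact hX e h1 h2
  · have vA : ((G.instant T).proj c (lexEdgeOrder V) D).flatten.verts = G.verts :=
      G.instant_flatten_verts hT
    have vB : (((G.removeNode v).instant T).proj c (lexEdgeOrder V) D).flatten.verts =
        G.verts.erase v := (G.removeNode v).instant_flatten_verts hT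
    have hle := GraphStream.matching_le_nodeDist ((G.instant T).proj c (lexEdgeOrder V) D)
      (((G.removeNode v).instant T).proj c (lexEdgeOrder V) D) M
      (by rw [eA, eB]; exact fun e he => (hM e he).1) hdisj (by
        rw [vA, vB]
        intro e he x hx
        have hxv : x ≠ v := fun h => (hM e he).2 (h ▸ hx)
        have hxG : x ∈ G.verts := by
          rcases Finset.mem_symmDiff.mp (hM e he).1 with h | h
          · exact G.endpoint_mem e (hA.subset h.1) x hx
          · exact G.endpoint_mem e (Finset.mem_filter.mp (hB.subset h.1)).1 x hx
        exact ⟨hxG, Finset.mem_erase.mpr ⟨hxv, hxG⟩⟩)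
    refine le_trans (Nat.cast_le.mpr ?_) hle
    have hpos : 0 < (symmDiff G.verts (G.verts.erase v)).card :=
      Finset.card_pos.mpr ⟨v, by simp [Finset.mem_symmDiff, hv]⟩
    rw [vA, vB]
    omega

end FinGraph

/-! ### Graphs given by increasing pairs -/

/-- The constructions prescribe only comparisons between different ranks, and every infinite linear
order contains finite chains of any size. -/
theorem exists_injective_of_rank {α V : Type*} [Fintype α] [LinearOrder V] [Infinite V]
    (rk : α → ℕ) : ∃ φ : α → V, Function.Injective φ ∧ ∀ a b, rk a < rk b → φ a < φ b := by
  classical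
  obtain ⟨r, h1, h2, h3⟩ := Finset.univ.exists_rank rk
  obtain ⟨s, hs⟩ := Infinite.exists_subset_card_eq V (Finset.univ : Finset α).card
  refine ⟨fun a => s.orderEmbOfFin hs ⟨r a, h2 a (Finset.mem_univ a)⟩, fun a b h => ?_,
    fun a b h => ?_⟩
  · have := Fin.ext_iff.mp ((s.orderEmbOfFin hs).injective h)
    exact h1 (by simp) (by simp) this
  · exact (s.orderEmbOfFin hs).strictMono
      (Fin.lt_def.mpr (h3 a (Finset.mem_univ a) b (Finset.mem_univ b) h))

section Pairs

variable {α V : Type*} {φ : α → V} {D : ℕ} {F A : Finset (α × α)}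

/-- The edge spanned by a pair. -/
def pairEdge (φ : α → V) (q : α × α) : Sym2 V := s(φ q.1, φ q.2)

theorem mem_pairEdge (hφ : Function.Injective φ) {q : α × α} {x : α} :
    φ x ∈ pairEdge φ q ↔ q.1 = x ∨ q.2 = x := by
  unfold pairEdge
  rw [Sym2.mem_iff, hφ.eq_iff, hφ.eq_iff, eq_comm, @eq_comm _ x q.2]

theorem exists_of_mem_pairEdge {q : α × α} {v : V} (h : v ∈ pairEdge φ q) :
    ∃ x, v = φ x ∧ (q.1 = x ∨ q.2 = x) := by
  rcases Sym2.mem_iff.mp h with h | h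
  · exact ⟨q.1, h, Or.inl rfl⟩
  · exact ⟨q.2, h, Or.inr rfl⟩

variable [LinearOrder V]

theorem pairEdge_injOn (hφ : Function.Injective φ) (hF : ∀ q ∈ F, φ q.1 < φ q.2) :
    Set.InjOn (pairEdge φ) F := by
  intro q hq q' hq' h
  have h1 := hF q hq
  have h2 := hF q' hq'
  rcases Sym2.eq_iff.mp h with ⟨e1, e2⟩ | ⟨e1, e2⟩
  · exact Prod.ext (hφ e1) (hφ e2)
  · rw [e1, e2] at h1
    exact absurd h1 h2.not_gt

theorem lexKey_pairEdge {q : α × α} (hq : φ q.1 < φ q.2) :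
    lexKey (pairEdge φ q) = toLex (φ q.1, φ q.2) :=
  lexKey_mk hq

theorem lexKey_pairEdge_lt_iff {q q' : α × α} (hq : φ q.1 < φ q.2) (hq' : φ q'.1 < φ q'.2) :
    lexKey (pairEdge φ q) < lexKey (pairEdge φ q') ↔
      φ q.1 < φ q'.1 ∨ φ q.1 = φ q'.1 ∧ φ q.2 < φ q'.2 := by
  rw [lexKey_pairEdge hq, lexKey_pairEdge hq', Prod.Lex.toLex_lt_toLex]

theorem edgeDeg_image_of_notMem {v : V} (hv : ∀ x, φ x ≠ v) :
    edgeDeg (F.image (pairEdge φ)) v = 0 := by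
  unfold edgeDeg
  rw [Finset.card_eq_zero, Finset.filter_eq_empty_iff]
  intro e he hve
  obtain ⟨q, -, rfl⟩ := Finset.mem_image.mp he
  obtain ⟨x, hx, -⟩ := exists_of_mem_pairEdge hve
  exact hv x hx.symm

/-- Lexicographically, every edge from a smaller neighbor down to `q.1` precedes all edges going up
from `q.1`. -/
theorem le_edgesBefore_image (hφ : Function.Injective φ) (hF : ∀ q ∈ F, φ q.1 < φ q.2)
    {q : α × α} (hq : φ q.1 < φ q.2) {s : Finset (α × α)} (hs : D ≤ s.card) (hsF : s ⊆ F)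
    (hlt : ∀ q' ∈ s, q'.2 = q.1 ∨ q'.1 = q.1 ∧ φ q'.2 < φ q.2) :
    D ≤ edgesBefore lexKey (F.image (pairEdge φ)) (pairEdge φ q) (φ q.1) := by
  rw [← Finset.card_image_of_injOn ((pairEdge_injOn hφ hF).mono hsF)] at hs
  refine hs.trans (Finset.card_le_card fun e he => ?_)
  obtain ⟨q', hq', rfl⟩ := Finset.mem_image.mp he
  have hF' := hF q' (hsF hq')
  refine Finset.mem_filter.mpr ⟨Finset.mem_image_of_mem _ (hsF hq'), ?_, ?_⟩
  · rw [lexKey_pairEdge_lt_iff hF' hq]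
    rcases hlt q' hq' with h | ⟨h1, h2⟩
    · rw [← h]
      exact Or.inl hF'
    · rw [h1]
      exact Or.inr ⟨rfl, h2⟩
  · rw [mem_pairEdge hφ]
    rcases hlt q' hq' with h | h
    · exact Or.inr h
    · exact Or.inl h.1

/-- The graph spanned by a set of pairs. -/
def FinGraph.ofPairs [Fintype α] (φ : α → V) (F : Finset (α × α)) (hF : ∀ q ∈ F, φ q.1 < φ q.2) :
    FinGraph V where
  verts := Finset.univ.image φ
  edges := F.image (pairEdge φ)
  not_isDiag e he := by
    obtain ⟨q, hq, rfl⟩ := Finset.mem_image.mp he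
    exact fun h => (hF q hq).ne (Sym2.mk_isDiag_iff.mp h)
  endpoint_mem e he v hv := by
    obtain ⟨q, hq, rfl⟩ := Finset.mem_image.mp he
    obtain ⟨x, rfl, -⟩ := exists_of_mem_pairEdge hv
    simp

theorem FinGraph.mem_ofPairs_verts [Fintype α] (hF : ∀ q ∈ F, φ q.1 < φ q.2) (x : α) :
    φ x ∈ (FinGraph.ofPairs φ F hF).verts :=
  Finset.mem_image_of_mem _ (Finset.mem_univ x)

variable [DecidableEq α]

theorem edgeDeg_image_le (hφ : Function.Injective φ) (x : α) :
    edgeDeg (F.image (pairEdge φ)) (φ x) ≤ (F.filter fun q => q.1 = x ∨ q.2 = x).card := by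
  unfold edgeDeg
  rw [Finset.filter_image]
  refine Finset.card_image_le.trans (Finset.card_le_card fun q hq => ?_)
  simp only [Finset.mem_filter, mem_pairEdge hφ] at hq ⊢
  exact hq

theorem edgeDeg_image_le_of_forall (hφ : Function.Injective φ)
    (h : ∀ x, (F.filter fun q => q.1 = x ∨ q.2 = x).card ≤ D) (v : V) :
    edgeDeg (F.image (pairEdge φ)) v ≤ D := by
  by_cases hv : ∃ x, φ x = v
  · obtain ⟨x, rfl⟩ := hv
    exact (edgeDeg_image_le hφ x).trans (h x)
  · push Not at hv
    rw [edgeDeg_image_of_notMem hv]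
    exact Nat.zero_le _

/-- Verification of the projection based on projected degrees for graphs given by pairs: every
rejected edge has its smaller endpoint saturated by smaller neighbors. -/
theorem isProj_projected_of_pairs (hφ : Function.Injective φ) (hF : ∀ q ∈ F, φ q.1 < φ q.2)
    (hAF : A ⊆ F) (hA : ∀ x, (A.filter fun q => q.1 = x ∨ q.2 = x).card ≤ D)
    (hrej : ∀ q ∈ F, q ∉ A → D ≤ (A.filter fun q' => q'.2 = q.1).card) :
    IsProj .projected lexKey D (F.image (pairEdge φ)) (A.image (pairEdge φ)) := by
  refine IsProj.of_edgeDeg_le (Finset.image_subset_image hAF) (edgeDeg_image_le_of_forall hφ hA) ?_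
  intro e he heA
  obtain ⟨q, hq, rfl⟩ := Finset.mem_image.mp he
  have hqA : q ∉ A := fun h => heA (Finset.mem_image_of_mem _ h)
  refine ⟨φ q.1, (mem_pairEdge hφ).mpr (Or.inl rfl), ?_⟩
  exact le_edgesBefore_image hφ (fun q hq => hF q (hAF hq)) (hF q hq) (hrej q hq hqA)
    (Finset.filter_subset _ _) fun q' hq' => Or.inl (Finset.mem_filter.mp hq').2

/-- Verification of the projection based on original degrees for graphs given by pairs. -/
theorem isProj_original_of_pairs (hφ : Function.Injective φ) (hF : ∀ q ∈ F, φ q.1 < φ q.2)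
    (hAF : A ⊆ F)
    (hfst : ∀ q ∈ A, (F.filter fun q' => q'.2 = q.1 ∨ q'.1 = q.1 ∧ φ q'.2 < φ q.2).card < D)
    (hsnd : ∀ q ∈ A, (F.filter fun q' => q' ≠ q ∧ q'.2 = q.2).card < D)
    (hrej : ∀ q ∈ F, q ∉ A →
      D ≤ (F.filter fun q' => q'.2 = q.1 ∨ q'.1 = q.1 ∧ φ q'.2 < φ q.2).card) :
    IsProj .original lexKey D (F.image (pairEdge φ)) (A.image (pairEdge φ)) := by
  refine ⟨Finset.image_subset_image hAF, fun e he => ⟨fun heA v hv => ?_, fun h => ?_⟩⟩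
  · obtain ⟨q, hq, rfl⟩ := Finset.mem_image.mp heA
    have hqF := hF q (hAF hq)
    have key : ∀ (x : α) (s : Finset (α × α)), (∀ q' ∈ F, (q'.1 = x ∨ q'.2 = x) →
        (φ q'.1 < φ q.1 ∨ φ q'.1 = φ q.1 ∧ φ q'.2 < φ q.2) → q' ∈ s) → s.card < D →
        edgesBefore lexKey (F.image (pairEdge φ)) (pairEdge φ q) (φ x) < D := by
      intro x s hs hsD
      refine lt_of_le_of_lt ?_ hsD
      unfold edgesBefore
      rw [Finset.filter_image]
      refine Finset.card_image_le.trans (Finset.card_le_card fun q' hq' => ?_)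
      obtain ⟨h1, h2, h3⟩ := Finset.mem_filter.mp hq'
      exact hs q' h1 ((mem_pairEdge hφ).mp h3)
        ((lexKey_pairEdge_lt_iff (hF q' h1) hqF).mp h2)
    obtain ⟨x, rfl, rfl | rfl⟩ := exists_of_mem_pairEdge hv
    · refine key _ _ (fun q' h1 h2 h3 => ?_) (hfst q hq)
      refine Finset.mem_filter.mpr ⟨h1, ?_⟩
      rcases h2 with h2 | h2
      · rw [h2] at h3
        exact Or.inr ⟨h2, (h3.resolve_left (lt_irrefl _)).2⟩
      · exact Or.inl h2
    · refine key _ _ (fun q' h1 h2 h3 => ?_) (hsnd q hq)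
      refine Finset.mem_filter.mpr ⟨h1, ?_⟩
      -- A preceding pair starts no higher than `q.1`, hence below `q.2`, and can meet `q.2` only as
      -- its upper end.
      have hne : q'.1 ≠ q.2 := by
        intro h
        rw [h] at h3
        rcases h3 with h3 | h3
        · exact absurd h3 hqF.not_gt
        · exact absurd h3.1 hqF.ne'
      refine ⟨?_, h2.resolve_left hne⟩
      rintro rfl
      rcases h3 with h3 | h3
      · exact lt_irrefl _ h3
      · exact lt_irrefl _ h3.2
  · by_contra heA
    obtain ⟨q, hq, rfl⟩ := Finset.mem_image.mp he
    have hqA : q ∉ A := fun h => heA (Finset.mem_image_of_mem _ h)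
    have h1 := h (φ q.1) ((mem_pairEdge hφ).mpr (Or.inl rfl))
    have h2 := le_edgesBefore_image hφ hF (hF q hq) (hrej q hq hqA)
      (Finset.filter_subset _ _) fun q' hq' => (Finset.mem_filter.mp hq').2
    exact absurd h1 (not_lt.mpr h2)

theorem symmDiff_image_pairEdge (hφ : Function.Injective φ) (hF : ∀ q ∈ F, φ q.1 < φ q.2)
    {A B : Finset (α × α)} (hA : A ⊆ F) (hB : B ⊆ F) :
    symmDiff (A.image (pairEdge φ)) (B.image (pairEdge φ)) =
      (symmDiff A B).image (pairEdge φ) := by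
  have hinj := pairEdge_injOn hφ hF
  have aux : ∀ {C C' : Finset (α × α)}, C ⊆ F → C' ⊆ F →
      C.image (pairEdge φ) \ C'.image (pairEdge φ) = (C \ C').image (pairEdge φ) := by
    intro C C' hC hC'
    ext e
    simp only [Finset.mem_sdiff, Finset.mem_image]
    constructor
    · rintro ⟨⟨q, hq, rfl⟩, h⟩
      exact ⟨q, ⟨hq, fun h' => h ⟨q, h', rfl⟩⟩, rfl⟩
    · rintro ⟨q, ⟨hq, hq'⟩, rfl⟩
      refine ⟨⟨q, hq, rfl⟩, ?_⟩
      rintro ⟨q', h1, h2⟩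
      exact hq' (hinj (hC' h1) (hC hq) h2 ▸ h1)
  simp only [symmDiff, Finset.sup_eq_union, Finset.image_union]
  rw [aux hA hB, aux hB hA]

theorem card_symmDiff_image_pairEdge (hφ : Function.Injective φ) (hF : ∀ q ∈ F, φ q.1 < φ q.2)
    {A B : Finset (α × α)} (hA : A ⊆ F) (hB : B ⊆ F) :
    (symmDiff (A.image (pairEdge φ)) (B.image (pairEdge φ))).card = (symmDiff A B).card := by
  rw [symmDiff_image_pairEdge hφ hF hA hB]
  refine Finset.card_image_of_injOn ((pairEdge_injOn hφ hF).mono fun q hq => ?_)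
  rcases Finset.mem_symmDiff.mp hq with h | h
  · exact hA h.1
  · exact hB h.1

variable [Fintype α]

theorem FinGraph.ofPairs_isBounded (hφ : Function.Injective φ) (hF : ∀ q ∈ F, φ q.1 < φ q.2)
    {X : Finset α} {l : ℕ} (hXl : X.card ≤ l)
    (hX : ∀ x, x ∉ X → (F.filter fun q => q.1 = x ∨ q.2 = x).card ≤ D) :
    (FinGraph.ofPairs φ F hF).IsBounded D l := by
  refine le_trans (Finset.card_le_card (t := X.image φ) fun v hv => ?_)
    (Finset.card_image_le.trans hXl)
  obtain ⟨h1, h2⟩ := Finset.mem_filter.mp hv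
  obtain ⟨x, -, rfl⟩ := Finset.mem_image.mp h1
  by_contra hx
  have hxX : x ∉ X := fun h => hx (Finset.mem_image_of_mem _ h)
  exact absurd (h2.trans_le (edgeDeg_image_le hφ x)) (not_lt.mpr (hX x hxX))

theorem FinGraph.removeNode_ofPairs_edges (hφ : Function.Injective φ)
    (hF : ∀ q ∈ F, φ q.1 < φ q.2) (x : α) :
    ((FinGraph.ofPairs φ F hF).removeNode (φ x)).edges =
      (F.filter fun q => ¬ (q.1 = x ∨ q.2 = x)).image (pairEdge φ) := by
  change (F.image (pairEdge φ)).filter (φ x ∉ ·) = _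
  rw [Finset.filter_image]
  simp only [mem_pairEdge hφ]

end Pairs

/-! ### Tightness for the projection based on original degrees -/

section OriginalTightness

variable {V : Type*} [LinearOrder V]

theorem card_insert_image_Iio {β : Type*} [DecidableEq β] {D : ℕ} {f : Fin D → β}
    (hf : Function.Injective f) {p : β} (hp : ∀ j, p ≠ f j) (i : Fin D) :
    (insert p ((Finset.Iio i).image f)).card = i + 1 := by
  rw [Finset.card_insert_of_notMem, Finset.card_image_of_injective _ hf, Fin.card_Iio]
  intro h
  obtain ⟨j, -, hj⟩ := Finset.mem_image.mp h
  exact hp j hj.symm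

theorem FinGraph.removeEdge_ofPairs_edges {α : Type*} [Fintype α] [DecidableEq α] {φ : α → V}
    (hφ : Function.Injective φ) {F : Finset (α × α)} (hF : ∀ q ∈ F, φ q.1 < φ q.2) {p : α × α}
    (hp : p ∈ F) :
    ((FinGraph.ofPairs φ F hF).removeEdge (pairEdge φ p)).edges =
      (F.erase p).image (pairEdge φ) := by
  change (F.image (pairEdge φ)).erase (pairEdge φ p) = _
  ext e
  simp only [Finset.mem_erase, Finset.mem_image]
  constructor
  · rintro ⟨h1, q, hq, rfl⟩
    exact ⟨q, ⟨fun h => h1 (h ▸ rfl), hq⟩, rfl⟩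
  · rintro ⟨q, ⟨h1, hq⟩, rfl⟩
    exact ⟨fun h => h1 (pairEdge_injOn hφ hF hq hp h), q, hq, rfl⟩

variable [Infinite V]

/-- Two adjacent hubs with `D` leaves each. -/
theorem exists_edgeNeighbor_bbds (D : ℕ) (hD : 1 ≤ D) :
    ∃ G G' : FinGraph V, ∀ T : ℕ, 1 ≤ T → (G.instant T).EdgeNeighbor (G'.instant T) ∧
      ((G.instant T).bbds (lexEdgeOrder V) D).edgeDist
        ((G'.instant T).bbds (lexEdgeOrder V) D) = 3 := by
  let rk : Bool × Option (Fin D) → ℕ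
    | (false, none) => 0
    | (true, none) => 1
    | (_, some i) => 2 + i
  obtain ⟨φ, hφ, hrk⟩ := exists_injective_of_rank (V := V) rk
  let leaf : Bool × Fin D → (Bool × Option (Fin D)) × (Bool × Option (Fin D)) :=
    fun x => ((x.1, none), (x.1, some x.2))
  let p : (Bool × Option (Fin D)) × (Bool × Option (Fin D)) := ((false, none), (true, none))
  have hleaf : Function.Injective leaf := by
    rintro ⟨b, i⟩ ⟨b', i'⟩ h
    simp [leaf] at h
    simp [h]
  have hpl : ∀ x, p ≠ leaf x := by
    rintro ⟨b, i⟩ h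
    simp [p, leaf] at h
  let F := insert p (Finset.univ.image leaf)
  -- The edge `p` between the hubs is processed before all leaf edges, so leaf `i` sees i + 1
  -- earlier edges at its hub and each hub loses its last leaf. Without `p` all leaves are kept.
  let A := insert p ((Finset.univ.filter fun x : Bool × Fin D => (x.2 : ℕ) + 1 < D).image leaf)
  have hlt_leaf : ∀ (b b' : Bool) (j : Fin D), φ (b, none) < φ (b', some j) := by
    intro b b' j
    apply hrk
    cases b <;> simp only [rk] <;> omega
  have hlt_p : φ p.1 < φ p.2 := hrk _ _ (by simp [rk, p])
  have hlt_iff : ∀ b i j, φ (b, some j) < φ (b, some i) ↔ j < i := by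
    intro b i j
    have h1 : ∀ i j : Fin D, j < i → φ (b, some j) < φ (b, some i) := fun i j hij =>
      hrk _ _ (by have := Fin.lt_def.mp hij; simp only [rk]; omega)
    refine ⟨fun h => ?_, h1 i j⟩
    by_contra hij
    rcases (not_lt.mp hij).lt_or_eq with h' | h'
    · exact absurd h (h1 j i h').not_gt
    · rw [h'] at h
      exact lt_irrefl _ h
  have hmemF : ∀ q, q ∈ F ↔ q = p ∨ ∃ x, leaf x = q := by
    intro q
    simp [F]
  have hF : ∀ q ∈ F, φ q.1 < φ q.2 := by
    intro q hq
    rcases (hmemF q).mp hq with rfl | ⟨x, rfl⟩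
    · exact hlt_p
    · exact hlt_leaf _ _ _
  have hpF : p ∈ F := Finset.mem_insert_self _ _
  have hAF : A ⊆ F := Finset.insert_subset_insert _
    (Finset.image_subset_image (Finset.filter_subset _ _))
  have herase : F.erase p = Finset.univ.image leaf := by
    refine Finset.erase_insert fun h => ?_
    obtain ⟨x, -, hx⟩ := Finset.mem_image.mp h
    exact hpl x hx.symm
  have hbefore : ∀ b i, (F.filter fun q' => q'.2 = (leaf (b, i)).1 ∨
      q'.1 = (leaf (b, i)).1 ∧ φ q'.2 < φ (leaf (b, i)).2) =
      insert p ((Finset.Iio i).image fun j => leaf (b, j)) := by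
    intro b i
    ext q
    simp only [Finset.mem_filter, Finset.mem_insert, Finset.mem_image, Finset.mem_Iio, hmemF]
    constructor
    · rintro ⟨rfl | ⟨⟨b', j⟩, rfl⟩, h⟩
      · exact Or.inl rfl
      · right
        simp only [leaf, Prod.mk.injEq, reduceCtorEq, and_false, false_or, and_true] at h
        obtain ⟨rfl, h⟩ := h
        exact ⟨j, (hlt_iff _ _ _).mp h, rfl⟩
    · rintro (rfl | ⟨j, hj, rfl⟩)
      · refine ⟨Or.inl rfl, ?_⟩
        cases b
        · exact Or.inr ⟨rfl, hlt_leaf _ _ _⟩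
        · exact Or.inl rfl
      · exact ⟨Or.inr ⟨_, rfl⟩, Or.inr ⟨rfl, (hlt_iff _ _ _).mpr hj⟩⟩
  have hcard : ∀ b i, (insert p ((Finset.Iio i).image fun j => leaf (b, j))).card = (i : ℕ) + 1 :=
    fun b i => card_insert_image_Iio (fun j j' h => (Prod.ext_iff.mp (hleaf h)).2)
      (fun j => hpl (b, j)) i
  have hsnd : ∀ q ∈ F, (F.filter fun q' => q' ≠ q ∧ q'.2 = q.2).card = 0 := by
    intro q hq
    rw [Finset.card_eq_zero, Finset.filter_eq_empty_iff]
    rintro q' hq' ⟨hne, h⟩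
    rcases (hmemF q).mp hq with rfl | ⟨⟨b, i⟩, rfl⟩ <;>
      rcases (hmemF q').mp hq' with rfl | ⟨⟨b', i'⟩, rfl⟩
    · exact hne rfl
    · simp [p, leaf] at h
    · simp [p, leaf] at h
    · simp only [leaf, Prod.mk.injEq, Option.some.injEq] at h
      exact hne (by rw [h.1, h.2])
  have hA : IsProj .original lexKey D (F.image (pairEdge φ)) (A.image (pairEdge φ)) := by
    refine isProj_original_of_pairs hφ hF hAF (fun q hq => ?_) (fun q hq => ?_) fun q hq hqA => ?_
    · rcases Finset.mem_insert.mp hq with rfl | hq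
      · rw [Finset.filter_false_of_mem, Finset.card_empty]
        · exact hD
        · intro q hq h
          rcases (hmemF q).mp hq with rfl | ⟨⟨b, i⟩, rfl⟩
          · simp [p] at h
          · simp only [leaf, p, Prod.mk.injEq, reduceCtorEq, and_false, false_or] at h
            exact absurd h.2 (hlt_leaf _ _ _).not_gt
      · obtain ⟨⟨b, i⟩, hi, rfl⟩ := Finset.mem_image.mp hq
        rw [hbefore, hcard]
        exact (Finset.mem_filter.mp hi).2
    · rw [hsnd q (hAF hq)]
      exact hD
    · rcases (hmemF q).mp hq with rfl | ⟨⟨b, i⟩, rfl⟩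
      · exact absurd (Finset.mem_insert_self _ _) hqA
      · rw [hbefore, hcard]
        by_contra hlt
        exact hqA (Finset.mem_insert_of_mem (Finset.mem_image_of_mem _
          (Finset.mem_filter.mpr ⟨Finset.mem_univ _, not_le.mp hlt⟩)))
  have hB : IsProj .original lexKey D ((F.erase p).image (pairEdge φ))
      ((F.erase p).image (pairEdge φ)) := by
    refine isProj_original_of_pairs hφ (fun q hq => hF q (Finset.mem_of_mem_erase hq)) subset_rfl
      (fun q hq => ?_) (fun q hq => ?_) fun q hq hqA => absurd hq hqA
    · rw [Finset.filter_erase]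
      rw [herase] at hq
      obtain ⟨⟨b, i⟩, -, rfl⟩ := Finset.mem_image.mp hq
      have h := hcard b i
      rw [← hbefore] at h
      have hp' : p ∈ F.filter fun q' => q'.2 = (leaf (b, i)).1 ∨
          q'.1 = (leaf (b, i)).1 ∧ φ q'.2 < φ (leaf (b, i)).2 := by
        rw [hbefore]
        exact Finset.mem_insert_self _ _
      rw [Finset.card_erase_of_mem hp', h]
      exact i.isLt
    · refine lt_of_le_of_lt (Finset.card_le_card (Finset.filter_subset_filter _
        (Finset.erase_subset p F))) ?_
      rw [hsnd q (Finset.mem_of_mem_erase hq)]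
      exact hD
  have hthree : 3 ≤ (symmDiff A (F.erase p)).card := by
    have hlast : ∀ b, leaf (b, ⟨D - 1, by omega⟩) ∈ symmDiff A (F.erase p) := by
      intro b
      rw [Finset.mem_symmDiff]
      refine Or.inr ⟨by rw [herase]; simp, fun h => ?_⟩
      rcases Finset.mem_insert.mp h with h | h
      · exact hpl _ h.symm
      · obtain ⟨x, hx, hxe⟩ := Finset.mem_image.mp h
        have := (Finset.mem_filter.mp hx).2
        rw [hleaf hxe] at this
        simp only at this
        omega
    have hsub : {p, leaf (false, ⟨D - 1, by omega⟩), leaf (true, ⟨D - 1, by omega⟩)} ⊆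
        symmDiff A (F.erase p) := by
      intro q hq
      simp only [Finset.mem_insert, Finset.mem_singleton] at hq
      rcases hq with rfl | rfl | rfl
      · rw [Finset.mem_symmDiff]
        exact Or.inl ⟨Finset.mem_insert_self _ _, Finset.notMem_erase _ _⟩
      · exact hlast _
      · exact hlast _
    refine le_of_eq_of_le ?_ (Finset.card_le_card hsub)
    rw [Finset.card_insert_of_notMem, Finset.card_insert_of_notMem, Finset.card_singleton]
    · simp [leaf]
    · simp [leaf, p]
  refine ⟨FinGraph.ofPairs φ F hF, (FinGraph.ofPairs φ F hF).removeEdge (pairEdge φ p),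
    fun T hT => ?_⟩
  have hstep : ((FinGraph.ofPairs φ F hF).instant T).EdgeStep
      (((FinGraph.ofPairs φ F hF).removeEdge (pairEdge φ p)).instant T) :=
    Or.inl ⟨_, FinGraph.instant_removesEdge _ hT (Finset.mem_image_of_mem _ hpF)⟩
  refine ⟨Or.inl hstep, le_antisymm hstep.edgeDist_bbds_le ?_⟩
  have hle := GraphStream.card_symmDiff_le_edgeDist
    (((FinGraph.ofPairs φ F hF).instant T).bbds (lexEdgeOrder V) D)
    ((((FinGraph.ofPairs φ F hF).removeEdge (pairEdge φ p)).instant T).bbds (lexEdgeOrder V) D)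
  rw [FinGraph.instant_proj_edges _ hT hA, FinGraph.instant_proj_edges (A :=
    (F.erase p).image (pairEdge φ)) _ hT (by
      rw [FinGraph.removeEdge_ofPairs_edges hφ hF hpF]; exact hB),
    card_symmDiff_image_pairEdge hφ hF hAF (Finset.erase_subset _ _)] at hle
  exact le_trans (Nat.cast_le.mpr hthree) hle

/-- The nodes of a graph with a root `(none, none)`, hubs `(some h, none)` and leaves. -/
abbrev HubVert (m D : ℕ) : Type := Option (Fin m) × Option (Fin D)

/-- A root with `D` leaves that is adjacent to `l - 1` hubs with `D` leaves each. -/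
theorem exists_nodeNeighbor_bbds (D l : ℕ) (hD : 1 ≤ D) :
    ∃ G G' : FinGraph V, G.IsBounded D l ∧ G'.IsBounded D l ∧
      ∀ T : ℕ, 1 ≤ T → (G.instant T).NodeNeighbor (G'.instant T) ∧
        ((G.instant T).bbds (lexEdgeOrder V) D).edgeDist
          ((G'.instant T).bbds (lexEdgeOrder V) D) = (D + (l - 1) : ℕ) ∧
        ((G.instant T).bbds (lexEdgeOrder V) D).nodeDist
          ((G'.instant T).bbds (lexEdgeOrder V) D) = (2 * (l - 1) + 1 : ℕ) := by
  set m := l - 1 with hm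
  -- The root's leaves precede the hubs, so the root is full before its edges to the hubs are
  -- processed. Those edges are rejected, but they still count at the hubs and displace the last
  -- leaf of each.
  let rk : HubVert m D → ℕ
    | (none, none) => 0
    | (none, some _) => 1
    | (some _, none) => 2
    | (some _, some i) => 3 + i
  obtain ⟨φ, hφ, hrk⟩ := exists_injective_of_rank (V := V) rk
  let root : HubVert m D := (none, none)
  let R : Fin D → HubVert m D × HubVert m D := fun i => ((none, none), (none, some i))
  let H : Fin m → HubVert m D × HubVert m D := fun h => ((none, none), (some h, none))
  let L : Fin m × Fin D → HubVert m D × HubVert m D :=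
    fun x => ((some x.1, none), (some x.1, some x.2))
  have hR : Function.Injective R := fun i j h => by simpa [R] using h
  have hL : Function.Injective L := by
    rintro ⟨h, i⟩ ⟨h', i'⟩ he
    simp [L] at he
    simp [he]
  let F := Finset.univ.image R ∪ (Finset.univ.image H ∪ Finset.univ.image L)
  let A := Finset.univ.image R ∪
    (Finset.univ.filter fun x : Fin m × Fin D => (x.2 : ℕ) + 1 < D).image L
  let B := Finset.univ.image L
  have hmemF : ∀ q, q ∈ F ↔ (∃ i, R i = q) ∨ (∃ h, H h = q) ∨ ∃ x, L x = q := by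
    intro q
    simp [F]
  have hF : ∀ q ∈ F, φ q.1 < φ q.2 := by
    intro q hq
    rcases (hmemF q).mp hq with ⟨i, rfl⟩ | ⟨h, rfl⟩ | ⟨x, rfl⟩ <;> apply hrk
    · simp [rk, R]
    · simp [rk, H]
    · simp only [rk, L]; omega
  have hBF : B ⊆ F := Finset.subset_union_right.trans Finset.subset_union_right
  have hAF : A ⊆ F := Finset.union_subset_union subset_rfl
    ((Finset.image_subset_image (Finset.filter_subset _ _)).trans Finset.subset_union_right)
  have hlt_iff : ∀ (h : Fin m) i j, φ (some h, some j) < φ (some h, some i) ↔ j < i := by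
    intro b i j
    have h1 : ∀ i j : Fin D, j < i → φ (some b, some j) < φ (some b, some i) := fun i j hij =>
      hrk _ _ (by have := Fin.lt_def.mp hij; simp only [rk]; omega)
    refine ⟨fun h => ?_, h1 i j⟩
    by_contra hij
    rcases (not_lt.mp hij).lt_or_eq with h' | h'
    · exact absurd h (h1 j i h').not_gt
    · rw [h'] at h
      exact lt_irrefl _ h
  have hFroot : (F.filter fun q => ¬ (q.1 = root ∨ q.2 = root)) = B := by
    ext q
    simp only [Finset.mem_filter, hmemF, B, Finset.mem_image, Finset.mem_univ, true_and]
    constructor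
    · rintro ⟨⟨i, rfl⟩ | ⟨h, rfl⟩ | ⟨x, rfl⟩, hne⟩
      · exact absurd (Or.inl rfl) hne
      · exact absurd (Or.inl rfl) hne
      · exact ⟨x, rfl⟩
    · rintro ⟨x, rfl⟩
      exact ⟨Or.inr (Or.inr ⟨x, rfl⟩), by simp [L, root]⟩
  have hbefore : ∀ h i, (F.filter fun q' => q'.2 = (L (h, i)).1 ∨
      q'.1 = (L (h, i)).1 ∧ φ q'.2 < φ (L (h, i)).2) =
      insert (H h) ((Finset.Iio i).image fun j => L (h, j)) := by
    intro h i
    ext q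
    simp only [Finset.mem_filter, Finset.mem_insert, Finset.mem_image, Finset.mem_Iio, hmemF]
    constructor
    · rintro ⟨⟨j, rfl⟩ | ⟨h', rfl⟩ | ⟨⟨h', j⟩, rfl⟩, hq⟩
      · simp [R, L] at hq
      · simp only [H, L, Prod.mk.injEq, Option.some.injEq, and_true, reduceCtorEq, false_and,
          or_false] at hq
        rw [hq]
        exact Or.inl rfl
      · right
        simp only [L, Prod.mk.injEq, reduceCtorEq, and_false, false_or, and_true,
          Option.some.injEq] at hq
        obtain ⟨rfl, hq⟩ := hq
        exact ⟨j, (hlt_iff _ _ _).mp hq, rfl⟩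
    · rintro (rfl | ⟨j, hj, rfl⟩)
      · exact ⟨Or.inr (Or.inl ⟨h, rfl⟩), Or.inl rfl⟩
      · exact ⟨Or.inr (Or.inr ⟨_, rfl⟩), Or.inr ⟨rfl, (hlt_iff _ _ _).mpr hj⟩⟩
  have hcard : ∀ h i, (insert (H h) ((Finset.Iio i).image fun j => L (h, j))).card = (i : ℕ) + 1 :=
    fun h i => card_insert_image_Iio (fun j j' he => (Prod.ext_iff.mp (hL he)).2)
      (fun j he => by simp [H, L] at he) i
  have hsnd : ∀ q ∈ F, (F.filter fun q' => q' ≠ q ∧ q'.2 = q.2).card = 0 := by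
    intro q hq
    rw [Finset.card_eq_zero, Finset.filter_eq_empty_iff]
    rintro q' hq' ⟨hne, h⟩
    rcases (hmemF q).mp hq with ⟨i, rfl⟩ | ⟨i, rfl⟩ | ⟨⟨i, j⟩, rfl⟩ <;>
      rcases (hmemF q').mp hq' with ⟨i', rfl⟩ | ⟨i', rfl⟩ | ⟨⟨i', j'⟩, rfl⟩ <;>
      simp [R, H, L] at h hne
    · exact hne h
    · exact hne h
    · exact hne h.1 h.2
  have hA : IsProj .original lexKey D (F.image (pairEdge φ)) (A.image (pairEdge φ)) := by
    refine isProj_original_of_pairs hφ hF hAF (fun q hq => ?_) (fun q hq => ?_) fun q hq hqA => ?_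
    · rcases Finset.mem_union.mp hq with hq | hq
      · obtain ⟨i, -, rfl⟩ := Finset.mem_image.mp hq
        have hsub : (F.filter fun q' => q'.2 = (R i).1 ∨ q'.1 = (R i).1 ∧ φ q'.2 < φ (R i).2) ⊆
            (Finset.univ.erase i).image R := by
          intro q hq
          obtain ⟨hq, h⟩ := Finset.mem_filter.mp hq
          rcases (hmemF q).mp hq with ⟨j, rfl⟩ | ⟨h', rfl⟩ | ⟨x, rfl⟩
          · refine Finset.mem_image_of_mem _ (Finset.mem_erase.mpr ⟨?_, Finset.mem_univ _⟩)
            rintro rfl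
            rcases h with h | h
            · simp [R] at h
            · exact lt_irrefl _ h.2
          · rcases h with h | h
            · simp [R, H] at h
            · exact absurd h.2 (hrk _ _ (by simp [rk, R, H])).not_gt
          · simp [R, L] at h
        refine (Finset.card_le_card hsub).trans_lt (Finset.card_image_le.trans_lt ?_)
        rw [Finset.card_erase_of_mem (Finset.mem_univ _), Finset.card_univ, Fintype.card_fin]
        omega
      · obtain ⟨⟨h, i⟩, hi, rfl⟩ := Finset.mem_image.mp hq
        rw [hbefore, hcard]
        exact (Finset.mem_filter.mp hi).2
    · rw [hsnd q (hAF hq)]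
      exact hD
    · rcases (hmemF q).mp hq with ⟨i, rfl⟩ | ⟨h, rfl⟩ | ⟨⟨h, i⟩, rfl⟩
      · exact absurd (Finset.mem_union_left _ (Finset.mem_image_of_mem _ (Finset.mem_univ _))) hqA
      · have : (Finset.univ.image R).card = D := by
          rw [Finset.card_image_of_injective _ hR, Finset.card_univ, Fintype.card_fin]
        refine le_of_eq_of_le this.symm (Finset.card_le_card fun q hq => ?_)
        obtain ⟨j, -, rfl⟩ := Finset.mem_image.mp hq
        refine Finset.mem_filter.mpr ⟨(hmemF _).mpr (Or.inl ⟨j, rfl⟩), Or.inr ⟨rfl, ?_⟩⟩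
        exact hrk _ _ (by simp [rk, R, H])
      · rw [hbefore, hcard]
        by_contra hlt
        exact hqA (Finset.mem_union_right _ (Finset.mem_image_of_mem _
          (Finset.mem_filter.mpr ⟨Finset.mem_univ _, not_le.mp hlt⟩)))
  have hB : IsProj .original lexKey D (B.image (pairEdge φ)) (B.image (pairEdge φ)) := by
    refine isProj_original_of_pairs hφ (fun q hq => hF q (hBF hq)) subset_rfl
      (fun q hq => ?_) (fun q hq => ?_) fun q hq hqA => absurd hq hqA
    · obtain ⟨⟨h, i⟩, -, rfl⟩ := Finset.mem_image.mp hq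
      refine lt_of_le_of_lt (Finset.card_le_card (t := (Finset.Iio i).image fun j => L (h, j))
        fun q hq => ?_) (Finset.card_image_le.trans_lt (by rw [Fin.card_Iio]; exact i.isLt))
      obtain ⟨hqB, hq⟩ := Finset.mem_filter.mp hq
      have : q ∈ insert (H h) ((Finset.Iio i).image fun j => L (h, j)) := by
        rw [← hbefore]
        exact Finset.mem_filter.mpr ⟨hBF hqB, hq⟩
      refine (Finset.mem_insert.mp this).resolve_left ?_
      rintro rfl
      obtain ⟨x, -, hx⟩ := Finset.mem_image.mp hqB
      simp [H, L] at hx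
    · refine lt_of_le_of_lt (Finset.card_le_card (Finset.filter_subset_filter _ hBF)) ?_
      rw [hsnd q (hBF hq)]
      exact hD
  let last : Fin m → HubVert m D × HubVert m D := fun h => L (h, ⟨D - 1, by omega⟩)
  have hlast : Function.Injective last := fun h h' he => (Prod.ext_iff.mp (hL he)).1
  have hdiff : symmDiff A B = Finset.univ.image R ∪ Finset.univ.image last := by
    ext q
    simp only [Finset.mem_symmDiff, A, B, Finset.mem_union, Finset.mem_image, Finset.mem_univ,
      true_and, Finset.mem_filter]
    constructor
    · rintro (⟨⟨i, rfl⟩ | ⟨x, hx, rfl⟩, h⟩ | ⟨⟨⟨h, i⟩, rfl⟩, hn⟩)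
      · exact Or.inl ⟨i, rfl⟩
      · exact absurd ⟨x, rfl⟩ h
      · right
        refine ⟨h, ?_⟩
        have hi : ¬ ((i : ℕ) + 1 < D) := fun hi => hn (Or.inr ⟨(h, i), hi, rfl⟩)
        have : i = ⟨D - 1, by omega⟩ := Fin.ext (by have := i.isLt; simp only; omega)
        rw [this]
    · rintro (⟨i, rfl⟩ | ⟨h, rfl⟩)
      · exact Or.inl ⟨Or.inl ⟨i, rfl⟩, by rintro ⟨x, hx⟩; simp [R, L] at hx⟩
      · refine Or.inr ⟨⟨_, rfl⟩, ?_⟩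
        rintro (⟨i, hi⟩ | ⟨x, hx, hxe⟩)
        · simp [R, L, last] at hi
        · rw [hL hxe] at hx
          simp only at hx
          omega
  have hdcard : (symmDiff A B).card = D + m := by
    rw [hdiff, Finset.card_union_of_disjoint, Finset.card_image_of_injective _ hR,
      Finset.card_image_of_injective _ hlast]
    · simp
    · rw [Finset.disjoint_left]
      intro q h1 h2
      obtain ⟨i, -, rfl⟩ := Finset.mem_image.mp h1
      obtain ⟨h, -, hq⟩ := Finset.mem_image.mp h2
      simp [R, L, last] at hq
  set G := FinGraph.ofPairs φ F hF with hG
  have hB' : IsProj .original lexKey D (G.removeNode (φ root)).edges (B.image (pairEdge φ)) := by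
    rw [hG, FinGraph.removeNode_ofPairs_edges hφ, hFroot]
    exact hB
  have hsymm := symmDiff_image_pairEdge hφ hF hAF hBF
  have hbdd : G.IsBounded D l := by
    -- Without hubs the root has degree exactly `D`, so nothing exceeds `D` even if l = 0; otherwise
    -- the root and the l - 1 hubs are the `l` exceptions.
    let X : Finset (HubVert m D) := if m = 0 then ∅ else
      insert root (Finset.univ.image fun h : Fin m => ((some h, none) : HubVert m D))
    refine FinGraph.ofPairs_isBounded hφ hF (X := X) ?_ fun x hx => ?_
    · by_cases h0 : m = 0
      · simp [X, h0]
      · simp only [X, if_neg h0]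
        refine (Finset.card_insert_le _ _).trans ?_
        have := Finset.card_image_le (s := (Finset.univ : Finset (Fin m)))
          (f := fun h : Fin m => ((some h, none) : HubVert m D))
        rw [Finset.card_univ, Fintype.card_fin] at this
        omega
    · have hone : ∀ q₀ : HubVert m D × HubVert m D, (∀ q ∈ F, (q.1 = x ∨ q.2 = x) → q = q₀) →
          (F.filter fun q => q.1 = x ∨ q.2 = x).card ≤ D := by
        intro q₀ h
        refine (Finset.card_le_card (t := {q₀}) fun q hq => ?_).trans (by simpa using hD)
        rw [Finset.mem_singleton]
        exact h q (Finset.mem_filter.mp hq).1 (Finset.mem_filter.mp hq).2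
      obtain ⟨_ | h, _ | i⟩ := x
      · have h0 : m = 0 := by
          by_contra h0
          simp [X, h0, root] at hx
        refine (Finset.card_le_card (t := Finset.univ.image R) fun q hq => ?_).trans ?_
        · obtain ⟨hq, -⟩ := Finset.mem_filter.mp hq
          rcases (hmemF q).mp hq with ⟨i, rfl⟩ | ⟨h, rfl⟩ | ⟨x, rfl⟩
          · simp
          · exact absurd h.isLt (by omega)
          · exact absurd x.1.isLt (by omega)
        · exact Finset.card_image_le.trans (by simp)
      · refine hone (R i) fun q hq h => ?_
        rcases (hmemF q).mp hq with ⟨j, rfl⟩ | ⟨h', rfl⟩ | ⟨x, rfl⟩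
        · simp [R] at h ⊢
          exact h
        · simp [H] at h
        · simp [L] at h
      · have h0 : m ≠ 0 := by have := h.isLt; omega
        simp [X, h0] at hx
      · refine hone (L (h, i)) fun q hq hx => ?_
        rcases (hmemF q).mp hq with ⟨j, rfl⟩ | ⟨h', rfl⟩ | ⟨x, rfl⟩
        · simp [R] at hx
        · simp [H] at hx
        · simp only [L, Prod.mk.injEq, reduceCtorEq, and_false, false_or, Option.some.injEq] at hx
          simp [L, hx]
  refine ⟨G, G.removeNode (φ root), hbdd, hbdd.removeNode _, fun T hT => ⟨?_, ?_, ?_⟩⟩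
  · exact Or.inl ⟨_, G.instant_removesNode hT (FinGraph.mem_ofPairs_verts hF root)⟩
  · refine (G.edgeDist_removeNode_eq hT (FinGraph.mem_ofPairs_verts hF root) hA hB' ?_).trans ?_
    · refine ⟨pairEdge φ (R ⟨0, hD⟩), Finset.mem_image_of_mem _ ?_, ?_⟩
      · exact Finset.mem_union_left _ (Finset.mem_image_of_mem _ (Finset.mem_univ _))
      · exact (mem_pairEdge hφ).mpr (Or.inl rfl)
    · rw [card_symmDiff_image_pairEdge hφ hF hAF hBF, hdcard]
  · refine G.nodeDist_removeNode_eq hT (FinGraph.mem_ofPairs_verts hF root) hA hB' (n := m)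
      (X := Finset.univ.image fun h : Fin m => φ (some h, none))
      (M := Finset.univ.image fun h => pairEdge φ (last h)) ?_ ?_ ?_ ?_ ?_
    · rw [hsymm, hdiff]
      intro e he hne
      obtain ⟨q, hq, rfl⟩ := Finset.mem_image.mp he
      rcases Finset.mem_union.mp hq with hq | hq
      · obtain ⟨i, -, rfl⟩ := Finset.mem_image.mp hq
        exact absurd ((mem_pairEdge hφ).mpr (Or.inl rfl)) hne
      · obtain ⟨h, -, rfl⟩ := Finset.mem_image.mp hq
        exact ⟨φ (some h, none), Finset.mem_image_of_mem _ (Finset.mem_univ _),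
          (mem_pairEdge hφ).mpr (Or.inl rfl)⟩
    · exact Finset.card_image_le.trans (by simp)
    · intro e he
      obtain ⟨h, -, rfl⟩ := Finset.mem_image.mp he
      rw [hsymm, hdiff, mem_pairEdge hφ]
      refine ⟨Finset.mem_image_of_mem _ (Finset.mem_union_right _
        (Finset.mem_image_of_mem _ (Finset.mem_univ _))), ?_⟩
      simp [last, L, root]
    · intro e he f hf v hv hv'
      obtain ⟨h, -, rfl⟩ := Finset.mem_image.mp he
      obtain ⟨h', -, rfl⟩ := Finset.mem_image.mp hf
      obtain ⟨x, rfl, hx⟩ := exists_of_mem_pairEdge hv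
      rw [mem_pairEdge hφ] at hv'
      have e1 : x.1 = some h := by rcases hx with rfl | rfl <;> rfl
      have e2 : x.1 = some h' := by rcases hv' with rfl | rfl <;> rfl
      rw [e1, Option.some.injEq] at e2
      rw [e2]
    · rw [Finset.card_image_of_injOn]
      · simp
      · intro h _ h' _ he
        refine hlast (pairEdge_injOn hφ hF (hBF ?_) (hBF ?_) he) <;>
          exact Finset.mem_image_of_mem _ (Finset.mem_univ _)

end OriginalTightness

/-! ### Tightness for the projection based on projected degrees -/

section Network

/-- The nodes of a network: the root `(none, none)`, leaves `(none, some i)` of the root, hubs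
`(some h, none)` and pendant leaves `(some h, some i)` of the hubs. -/
abbrev NetVert (Hub : Type) (D : ℕ) : Type := Option Hub × Option (Fin D)

variable {Hub : Type} [Fintype Hub] [DecidableEq Hub] (level : Hub → ℕ) (next : Hub → Finset Hub)
  (D k : ℕ)

/-- The number of lower neighbors of a hub that are not pendant; a hub of level `0` has the root. -/
def netIndeg (h : Hub) : ℕ :=
  if level h = 0 then 1 else (Finset.univ.filter fun h' => h ∈ next h').card

open Classical in
/-- The edges of a network: the pendant edges, which fill up the lower degree of every hub to `D`,
the edges at the root if `P 0`, and the edges ending at a hub of level `n` for all `n` with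
`P n`. -/
noncomputable def netPairs (P : ℕ → Prop) : Finset (NetVert Hub D × NetVert Hub D) :=
  Finset.univ.filter fun q =>
    (∃ (h : Hub) (i : Fin D), (i : ℕ) < D - netIndeg level next h ∧
      q = ((some h, some i), (some h, none))) ∨
    (P 0 ∧ ∃ i : Fin D, (i : ℕ) < k ∧ q = ((none, none), (none, some i))) ∨
    (P 0 ∧ ∃ h : Hub, level h = 0 ∧ q = ((none, none), (some h, none))) ∨
    ∃ h h' : Hub, h' ∈ next h ∧ P (level h + 1) ∧ q = ((some h, none), (some h', none))

variable {level next D k}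

theorem mem_netPairs {P : ℕ → Prop} {q : NetVert Hub D × NetVert Hub D} :
    q ∈ netPairs level next D k P ↔
    (∃ (h : Hub) (i : Fin D), (i : ℕ) < D - netIndeg level next h ∧
      q = ((some h, some i), (some h, none))) ∨
    (P 0 ∧ ∃ i : Fin D, (i : ℕ) < k ∧ q = ((none, none), (none, some i))) ∨
    (P 0 ∧ ∃ h : Hub, level h = 0 ∧ q = ((none, none), (some h, none))) ∨
    ∃ h h' : Hub, h' ∈ next h ∧ P (level h + 1) ∧ q = ((some h, none), (some h', none)) := by
  simp [netPairs]

theorem netPairs_mono {P Q : ℕ → Prop} (h : ∀ n, P n → Q n) :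
    netPairs level next D k P ⊆ netPairs level next D k Q := by
  intro q hq
  rw [mem_netPairs] at hq ⊢
  rcases hq with h1 | ⟨h0, h1⟩ | ⟨h0, h1⟩ | ⟨a, b, h1, h2, h3⟩
  · exact Or.inl h1
  · exact Or.inr (Or.inl ⟨h _ h0, h1⟩)
  · exact Or.inr (Or.inr (Or.inl ⟨h _ h0, h1⟩))
  · exact Or.inr (Or.inr (Or.inr ⟨a, b, h1, h _ h2, h3⟩))

theorem card_filter_lt_fin {D n : ℕ} (hn : n ≤ D) :
    (Finset.univ.filter fun i : Fin D => (i : ℕ) < n).card = n := by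
  rw [Fin.card_filter_val_lt]
  exact min_eq_right hn

/-- A hub that keeps its edges from below is saturated by smaller neighbors alone, which forces the
rejection of its upward edges. -/
theorem card_netPairs_in (hlevel : ∀ h, ∀ h' ∈ next h, level h' = level h + 1)
    (hin : ∀ h, netIndeg level next h ≤ D) {P : ℕ → Prop} {h : Hub} (hP : P (level h)) :
    ((netPairs level next D k P).filter fun q => q.2 = (some h, none)).card = D := by
  let priv : Fin D → NetVert Hub D × NetVert Hub D := fun i => ((some h, some i), (some h, none))
  let lower : Finset (NetVert Hub D × NetVert Hub D) :=
    if level h = 0 then {((none, none), (some h, none))} else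
      (Finset.univ.filter fun h' => h ∈ next h').image fun h' => ((some h', none), (some h, none))
  have hlower : lower.card = netIndeg level next h := by
    simp only [lower, netIndeg]
    split_ifs
    · simp
    · refine Finset.card_image_of_injective _ fun a b hab => ?_
      simpa using hab
  have heq : ((netPairs level next D k P).filter fun q => q.2 = (some h, none)) =
      (Finset.univ.filter fun i : Fin D => (i : ℕ) < D - netIndeg level next h).image priv ∪
        lower := by
    ext q
    simp only [Finset.mem_filter, mem_netPairs, Finset.mem_union, Finset.mem_image, Finset.mem_univ,
      true_and]
    constructor
    · rintro ⟨⟨a, i, hi, rfl⟩ | ⟨-, i, hi, rfl⟩ | ⟨-, a, ha, rfl⟩ | ⟨a, b, hb, -, rfl⟩, hq⟩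
      · simp only [Prod.mk.injEq, Option.some.injEq, and_true] at hq
        subst hq
        exact Or.inl ⟨i, hi, rfl⟩
      · simp at hq
      · simp only [Prod.mk.injEq, Option.some.injEq, and_true] at hq
        subst hq
        right
        simp [lower, ha]
      · simp only [Prod.mk.injEq, Option.some.injEq, and_true] at hq
        subst hq
        right
        have : level b ≠ 0 := by rw [hlevel a b hb]; omega
        simp [lower, this, hb]
    · rintro (⟨i, hi, rfl⟩ | hq)
      · exact ⟨Or.inl ⟨h, i, hi, rfl⟩, rfl⟩
      · by_cases h0 : level h = 0
        · simp only [lower, h0, if_true, Finset.mem_singleton] at hq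
          subst hq
          rw [h0] at hP
          exact ⟨Or.inr (Or.inr (Or.inl ⟨hP, h, h0, rfl⟩)), rfl⟩
        · simp only [lower, h0, if_false, Finset.mem_image, Finset.mem_filter, Finset.mem_univ,
            true_and] at hq
          obtain ⟨a, ha, rfl⟩ := hq
          refine ⟨Or.inr (Or.inr (Or.inr ⟨a, h, ha, ?_, rfl⟩)), rfl⟩
          rwa [← hlevel a h ha]
  rw [heq, Finset.card_union_of_disjoint, hlower, Finset.card_image_of_injective,
    card_filter_lt_fin (Nat.sub_le _ _)]
  · have := hin h
    omega
  · intro i j hij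
    simpa [priv] using hij
  · rw [Finset.disjoint_left]
    intro q h1 h2
    obtain ⟨i, -, rfl⟩ := Finset.mem_image.mp h1
    simp only [lower] at h2
    split_ifs at h2
    · simp [priv] at h2
    · simp [priv] at h2

theorem card_netPairs_in_le (hlevel : ∀ h, ∀ h' ∈ next h, level h' = level h + 1)
    {P : ℕ → Prop} {h : Hub} (hP : ¬ P (level h)) :
    ((netPairs level next D k P).filter fun q => q.2 = (some h, none)).card ≤
      D - netIndeg level next h := by
  refine (Finset.card_le_card (t := (Finset.univ.filter fun i : Fin D =>
    (i : ℕ) < D - netIndeg level next h).image fun i => ((some h, some i), (some h, none)))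
    fun q hq => ?_).trans (Finset.card_image_le.trans (card_filter_lt_fin (Nat.sub_le _ _)).le)
  obtain ⟨hq, hq2⟩ := Finset.mem_filter.mp hq
  rcases mem_netPairs.mp hq with ⟨a, i, hi, rfl⟩ | ⟨-, i, hi, rfl⟩ | ⟨h0, a, ha, rfl⟩ |
    ⟨a, b, hb, h0, rfl⟩
  · simp only [Prod.mk.injEq, Option.some.injEq, and_true] at hq2
    subst hq2
    exact Finset.mem_image.mpr ⟨i, by simpa using hi, rfl⟩
  · simp at hq2
  · simp only [Prod.mk.injEq, Option.some.injEq, and_true] at hq2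
    subst hq2
    exact absurd (ha ▸ h0) hP
  · simp only [Prod.mk.injEq, Option.some.injEq, and_true] at hq2
    subst hq2
    exact absurd (hlevel a b hb ▸ h0) hP

theorem card_netPairs_out_le {P : ℕ → Prop} (h : Hub) :
    ((netPairs level next D k P).filter fun q => q.1 = (some h, none)).card ≤ (next h).card := by
  refine (Finset.card_le_card (t := (next h).image fun h' => ((some h, none), (some h', none)))
    fun q hq => ?_).trans Finset.card_image_le
  obtain ⟨hq, hq1⟩ := Finset.mem_filter.mp hq
  rcases mem_netPairs.mp hq with ⟨a, i, hi, rfl⟩ | ⟨-, i, hi, rfl⟩ | ⟨h0, a, ha, rfl⟩ |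
    ⟨a, b, hb, h0, rfl⟩
  · simp at hq1
  · simp at hq1
  · simp at hq1
  · simp only [Prod.mk.injEq, Option.some.injEq, and_true] at hq1
    subst hq1
    exact Finset.mem_image_of_mem _ hb

theorem card_netPairs_out_eq_zero {P : ℕ → Prop} {h : Hub} (hP : ¬ P (level h + 1)) :
    ((netPairs level next D k P).filter fun q => q.1 = (some h, none)).card = 0 := by
  rw [Finset.card_eq_zero, Finset.filter_eq_empty_iff]
  intro q hq hq1
  rcases mem_netPairs.mp hq with ⟨a, i, hi, rfl⟩ | ⟨-, i, hi, rfl⟩ | ⟨h0, a, ha, rfl⟩ |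
    ⟨a, b, hb, h0, rfl⟩
  · simp at hq1
  · simp at hq1
  · simp at hq1
  · simp only [Prod.mk.injEq, Option.some.injEq, and_true] at hq1
    subst hq1
    exact hP h0

theorem card_netPairs_root_le (hk : k ≤ D) (P : ℕ → Prop) :
    ((netPairs level next D k P).filter fun q => q.1 = (none, none) ∨ q.2 = (none, none)).card ≤
      k + (Finset.univ.filter (level · = 0)).card := by
  refine (Finset.card_le_card (t := (Finset.univ.filter fun i : Fin D => (i : ℕ) < k).image
      (fun i => ((none, none), (none, some i))) ∪
      (Finset.univ.filter (level · = 0)).image (fun h => ((none, none), (some h, none))))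
      fun q hq => ?_).trans ((Finset.card_union_le _ _).trans
      ((add_le_add Finset.card_image_le Finset.card_image_le).trans ?_))
  · obtain ⟨hq, hq1⟩ := Finset.mem_filter.mp hq
    rw [Finset.mem_union]
    rcases mem_netPairs.mp hq with ⟨a, i, hi, rfl⟩ | ⟨-, i, hi, rfl⟩ | ⟨h0, a, ha, rfl⟩ |
      ⟨a, b, hb, h0, rfl⟩
    · simp at hq1
    · exact Or.inl (Finset.mem_image.mpr ⟨i, by simpa using hi, rfl⟩)
    · exact Or.inr (Finset.mem_image.mpr ⟨a, by simpa using ha, rfl⟩)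
    · simp at hq1
  · rw [card_filter_lt_fin hk]

theorem card_netPairs_le_of_ne_hub (hD : 1 ≤ D)
    (hk : k + (Finset.univ.filter (level · = 0)).card ≤ D)
    {P : ℕ → Prop} {x : NetVert Hub D} (hx : ∀ h, x ≠ (some h, none)) :
    ((netPairs level next D k P).filter fun q => q.1 = x ∨ q.2 = x).card ≤ D := by
  obtain ⟨_ | h, _ | i⟩ := x
  · exact (card_netPairs_root_le (by omega) P).trans hk
  · refine (Finset.card_le_one.mpr fun q hq q' hq' => ?_).trans hD
    have key : ∀ q ∈ (netPairs level next D k P).filter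
        fun q => q.1 = (none, some i) ∨ q.2 = (none, some i),
        q = ((none, none), (none, some i)) := by
      intro q hq
      obtain ⟨hq, hq1⟩ := Finset.mem_filter.mp hq
      rcases mem_netPairs.mp hq with ⟨a, i, hi, rfl⟩ | ⟨-, i, hi, rfl⟩ | ⟨h0, a, ha, rfl⟩ |
        ⟨a, b, hb, h0, rfl⟩ <;> simp at hq1
      rw [hq1]
    rw [key q hq, key q' hq']
  · exact absurd rfl (hx h)
  · refine (Finset.card_le_one.mpr fun q hq q' hq' => ?_).trans hD
    have key : ∀ q ∈ (netPairs level next D k P).filter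
        fun q => q.1 = (some h, some i) ∨ q.2 = (some h, some i),
        q = ((some h, some i), (some h, none)) := by
      intro q hq
      obtain ⟨hq, hq1⟩ := Finset.mem_filter.mp hq
      rcases mem_netPairs.mp hq with ⟨a, i, hi, rfl⟩ | ⟨-, i, hi, rfl⟩ | ⟨h0, a, ha, rfl⟩ |
        ⟨a, b, hb, h0, rfl⟩ <;> simp at hq1
      rw [hq1.1, hq1.2]
    rw [key q hq, key q' hq']

theorem card_netPairs_hub_le (P : ℕ → Prop) (h : Hub) :
    ((netPairs level next D k P).filter fun q => q.1 = (some h, none) ∨ q.2 = (some h, none)).card ≤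
      ((netPairs level next D k P).filter fun q => q.1 = (some h, none)).card +
      ((netPairs level next D k P).filter fun q => q.2 = (some h, none)).card := by
  rw [Finset.filter_or]
  exact Finset.card_union_le _ _

/-- The hypotheses on a network. -/
structure IsNetwork (level : Hub → ℕ) (next : Hub → Finset Hub) (D k : ℕ) : Prop where
  one_le : 1 ≤ D
  level_next : ∀ h, ∀ h' ∈ next h, level h' = level h + 1
  indeg_le : ∀ h, netIndeg level next h ≤ D
  outdeg_le : ∀ h, (next h).card ≤ netIndeg level next h
  root_le : k + (Finset.univ.filter (level · = 0)).card ≤ D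

namespace IsNetwork

variable {V : Type*} [LinearOrder V] {φ : NetVert Hub D → V}

/-- If `P n`, hubs of level `n` are saturated from below and keep no upward edge (`halt`). Otherwise
the missing lower edges leave room for all upward edges, by `outdeg_le`. A rejected edge starts at a
level satisfying `P` (`hrej`), so its lower end is saturated. -/
theorem isProj (hN : IsNetwork level next D k) (hφ : Function.Injective φ) {P Q : ℕ → Prop}
    (hF : ∀ q ∈ netPairs level next D k Q, φ q.1 < φ q.2) (hPQ : ∀ n, P n → Q n)
    (halt : ∀ n, P n → ¬ P (n + 1)) (hrej : ∀ n, Q n → ¬ P n → ∃ m, n = m + 1 ∧ P m) :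
    IsProj .projected lexKey D ((netPairs level next D k Q).image (pairEdge φ))
      ((netPairs level next D k P).image (pairEdge φ)) := by
  refine isProj_projected_of_pairs hφ hF (netPairs_mono hPQ) (fun x => ?_) fun q hq hqP => ?_
  · by_cases hx : ∃ h, x = (some h, none)
    · obtain ⟨h, rfl⟩ := hx
      refine (card_netPairs_hub_le P h).trans ?_
      by_cases hP : P (level h)
      · rw [card_netPairs_out_eq_zero (halt _ hP),
          card_netPairs_in hN.level_next hN.indeg_le hP, zero_add]
      · have h1 := card_netPairs_out_le (level := level) (next := next) (D := D) (k := k) (P := P) h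
        have h2 := card_netPairs_in_le (D := D) (k := k) hN.level_next hP
        have h3 := hN.outdeg_le h
        have h4 := hN.indeg_le h
        omega
    · push Not at hx
      exact card_netPairs_le_of_ne_hub hN.one_le hN.root_le hx
  · rw [mem_netPairs] at hq hqP
    push Not at hqP
    obtain ⟨n1, n2, n3, n4⟩ := hqP
    rcases hq with ⟨a, i, hi, rfl⟩ | ⟨h0, i, hi, rfl⟩ | ⟨h0, a, ha, rfl⟩ | ⟨a, b, hb, h0, rfl⟩
    · exact absurd rfl (n1 a i hi)
    · by_cases hP : P 0
      · exact absurd rfl (n2 hP i hi)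
      · obtain ⟨m, hm, -⟩ := hrej 0 h0 hP
        omega
    · by_cases hP : P 0
      · exact absurd rfl (n3 hP a ha)
      · obtain ⟨m, hm, -⟩ := hrej 0 h0 hP
        omega
    · by_cases hP : P (level a + 1)
      · exact absurd rfl (n4 a b hb hP)
      · obtain ⟨m, hm, hPm⟩ := hrej _ h0 hP
        obtain rfl : level a = m := by omega
        exact (card_netPairs_in hN.level_next hN.indeg_le hPm).ge

theorem filter_root (P : ℕ → Prop) :
    ((netPairs level next D k P).filter fun q => ¬ (q.1 = (none, none) ∨ q.2 = (none, none))) =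
      netPairs level next D k fun n => P n ∧ n ≠ 0 := by
  ext q
  rw [Finset.mem_filter, mem_netPairs, mem_netPairs]
  constructor
  · rintro ⟨⟨a, i, hi, rfl⟩ | ⟨h0, i, hi, rfl⟩ | ⟨h0, a, ha, rfl⟩ | ⟨a, b, hb, h0, rfl⟩, hq⟩
    · exact Or.inl ⟨a, i, hi, rfl⟩
    · exact absurd (Or.inl rfl) hq
    · exact absurd (Or.inl rfl) hq
    · exact Or.inr (Or.inr (Or.inr ⟨a, b, hb, ⟨h0, Nat.succ_ne_zero _⟩, rfl⟩))
  · rintro (⟨a, i, hi, rfl⟩ | ⟨h0, i, hi, rfl⟩ | ⟨h0, a, ha, rfl⟩ | ⟨a, b, hb, h0, rfl⟩)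
    · exact ⟨Or.inl ⟨a, i, hi, rfl⟩, by simp⟩
    · exact absurd rfl h0.2
    · exact absurd rfl h0.2
    · exact ⟨Or.inr (Or.inr (Or.inr ⟨a, b, hb, h0.1, rfl⟩)), by simp⟩

/-- Edges between hubs end at a level of exactly one parity, root edges occur only in the even
output, and the edges pendant at hubs lie in both. -/
theorem mem_symmDiff {q : NetVert Hub D × NetVert Hub D} :
    q ∈ symmDiff (netPairs level next D k Even) (netPairs level next D k Odd) ↔
    (∃ i : Fin D, (i : ℕ) < k ∧ q = ((none, none), (none, some i))) ∨
    (∃ h : Hub, level h = 0 ∧ q = ((none, none), (some h, none))) ∨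
    ∃ h h' : Hub, h' ∈ next h ∧ q = ((some h, none), (some h', none)) := by
  rw [Finset.mem_symmDiff, mem_netPairs, mem_netPairs]
  constructor
  · rintro (⟨h1, h2⟩ | ⟨h1, h2⟩)
    all_goals
      rcases h1 with ⟨a, i, hi, rfl⟩ | ⟨h0, i, hi, rfl⟩ | ⟨h0, a, ha, rfl⟩ | ⟨a, b, hb, h0, rfl⟩
      · exact absurd (Or.inl ⟨a, i, hi, rfl⟩) h2
      · exact Or.inl ⟨i, hi, rfl⟩
      · exact Or.inr (Or.inl ⟨a, ha, rfl⟩)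
      · exact Or.inr (Or.inr ⟨a, b, hb, rfl⟩)
  · rintro (⟨i, hi, rfl⟩ | ⟨a, ha, rfl⟩ | ⟨a, b, hb, rfl⟩)
    · exact Or.inl ⟨Or.inr (Or.inl ⟨Even.zero, i, hi, rfl⟩), by simp⟩
    · exact Or.inl ⟨Or.inr (Or.inr (Or.inl ⟨Even.zero, a, ha, rfl⟩)), by simp⟩
    · rcases Nat.even_or_odd (level a + 1) with h | h
      · refine Or.inl ⟨Or.inr (Or.inr (Or.inr ⟨a, b, hb, h, rfl⟩)), ?_⟩
        simp only [Prod.mk.injEq, reduceCtorEq, and_false, exists_false, false_and,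
          Option.some.injEq, and_true, false_or, not_exists, not_and]
        rintro x y - h' rfl
        exact absurd h (Nat.not_even_iff_odd.mpr h')
      · refine Or.inr ⟨Or.inr (Or.inr (Or.inr ⟨a, b, hb, h, rfl⟩)), ?_⟩
        simp only [Prod.mk.injEq, reduceCtorEq, and_false, exists_false, false_and,
          Option.some.injEq, and_true, false_or, not_exists, not_and]
        rintro x y - h' rfl
        exact absurd h' (Nat.not_even_iff_odd.mpr h)

theorem card_symmDiff (hk : k ≤ D) :
    (symmDiff (netPairs level next D k Even) (netPairs level next D k Odd)).card =
      k + (Finset.univ.filter (level · = 0)).card + ∑ h, (next h).card := by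
  have heq : symmDiff (netPairs level next D k Even) (netPairs level next D k Odd) =
      ((Finset.univ.filter fun i : Fin D => (i : ℕ) < k).image
        (fun i => (((none, none), (none, some i)) : NetVert Hub D × NetVert Hub D)) ∪
      (Finset.univ.filter (level · = 0)).image (fun h => ((none, none), (some h, none)))) ∪
      (Finset.univ.sigma next).image (fun x => ((some x.1, none), (some x.2, none))) := by
    ext q
    rw [mem_symmDiff]
    simp only [Finset.mem_union, Finset.mem_image, Finset.mem_filter, Finset.mem_univ, true_and,
      Finset.mem_sigma, or_assoc]
    refine or_congr ?_ (or_congr ?_ ?_)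
    · exact exists_congr fun i => and_congr_right fun _ => eq_comm
    · exact exists_congr fun i => and_congr_right fun _ => eq_comm
    · constructor
      · rintro ⟨a, b, hb, rfl⟩
        exact ⟨⟨a, b⟩, hb, rfl⟩
      · rintro ⟨⟨a, b⟩, hb, rfl⟩
        exact ⟨a, b, hb, rfl⟩
  rw [heq, Finset.card_union_of_disjoint, Finset.card_union_of_disjoint,
    Finset.card_image_of_injective, Finset.card_image_of_injective, Finset.card_image_of_injective,
    card_filter_lt_fin hk, Finset.card_sigma]
  · rintro ⟨a, b⟩ ⟨a', b'⟩ h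
    simp at h
    obtain ⟨rfl, rfl⟩ := h
    rfl
  · intro a b h
    simpa using h
  · intro a b h
    simpa using h
  · rw [Finset.disjoint_left]
    intro q h1 h2
    obtain ⟨i, -, rfl⟩ := Finset.mem_image.mp h1
    simp at h2
  · rw [Finset.disjoint_left]
    intro q h1 h2
    obtain ⟨x, -, rfl⟩ := Finset.mem_image.mp h2
    simp at h1

/-- A network realized on an infinite linear order: the graph `G`, its image `φ` on the network,
the projections of `G` and of `G` without the root, and their edge distance. -/
theorem exists_graph [Infinite V] (hN : IsNetwork level next D k) (hroot : ∃ h, level h = 0)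
    {l : ℕ} (hl : (Finset.univ.filter fun h => (next h).Nonempty).card ≤ l) :
    ∃ (G : FinGraph V) (φ : NetVert Hub D → V), Function.Injective φ ∧ (∀ x, φ x ∈ G.verts) ∧
      G.IsBounded D l ∧ G.degree (φ (none, none)) ≤ k + (Finset.univ.filter (level · = 0)).card ∧
      IsProj .projected lexKey D G.edges ((netPairs level next D k Even).image (pairEdge φ)) ∧
      IsProj .projected lexKey D (G.removeNode (φ (none, none))).edges
        ((netPairs level next D k Odd).image (pairEdge φ)) ∧
      symmDiff ((netPairs level next D k Even).image (pairEdge φ))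
        ((netPairs level next D k Odd).image (pairEdge φ)) =
        (symmDiff (netPairs level next D k Even) (netPairs level next D k Odd)).image
          (pairEdge φ) ∧
      Set.InjOn (pairEdge φ)
        (symmDiff (netPairs level next D k Even) (netPairs level next D k Odd) :
          Finset (NetVert Hub D × NetVert Hub D)) ∧
      ∀ T : ℕ, 1 ≤ T → ((G.instant T).dll (lexEdgeOrder V) D).edgeDist
        (((G.removeNode (φ (none, none))).instant T).dll (lexEdgeOrder V) D) =
          (k + (Finset.univ.filter (level · = 0)).card + ∑ h, (next h).card : ℕ) := by
  -- Leaves lie below the hubs, so the pendant edges of a hub precede its upward edges and count as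
  -- lower edges.
  let rk : NetVert Hub D → ℕ
    | (none, none) => 0
    | (_, some _) => 1
    | (some h, none) => 2 + level h
  obtain ⟨φ, hφ, hrk⟩ := exists_injective_of_rank (V := V) rk
  let F := netPairs level next D k fun _ => True
  have hF : ∀ q ∈ F, φ q.1 < φ q.2 := by
    intro q hq
    apply hrk
    rcases mem_netPairs.mp hq with ⟨a, i, hi, rfl⟩ | ⟨-, i, hi, rfl⟩ | ⟨h0, a, ha, rfl⟩ |
      ⟨a, b, hb, h0, rfl⟩
    · simp only [rk]; omega
    · simp [rk]
    · simp only [rk]; omega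
    · simp only [rk]
      rw [hN.level_next a b hb]
      omega
  have hEF : netPairs level next D k Even ⊆ F := netPairs_mono fun _ _ => trivial
  have hOF : netPairs level next D k Odd ⊆ F := netPairs_mono fun _ _ => trivial
  -- With the root, level 0 is saturated and the edges ending at even levels are kept.
  have hA := hN.isProj (P := Even) (Q := fun _ => True) hφ hF (fun _ _ => trivial)
    (fun n hn => by rw [Nat.even_add_one]; exact not_not.mpr hn)
    (fun n _ hn => by
      obtain ⟨m, rfl⟩ := Nat.not_even_iff_odd.mp hn
      exact ⟨2 * m, rfl, even_two_mul m⟩)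
  -- Without the root, level 0 has room for its upward edges, so the kept levels are the odd ones.
  have hB := hN.isProj (P := Odd) (Q := fun n => True ∧ n ≠ 0) hφ
    (fun q hq => hF q (netPairs_mono (fun _ _ => trivial) hq))
    (fun n hn => ⟨trivial, hn.pos.ne'⟩)
    (fun n hn => by rw [Nat.odd_add_one]; exact not_not.mpr hn)
    (fun n hn hn' => by
      obtain ⟨m, rfl⟩ := Nat.exists_eq_succ_of_ne_zero hn.2
      refine ⟨m, rfl, ?_⟩
      rw [Nat.succ_eq_add_one, Nat.odd_add_one, not_not] at hn'
      exact hn')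
  set G := FinGraph.ofPairs φ F hF with hG
  have hB' : IsProj .projected lexKey D (G.removeNode (φ (none, none))).edges
      ((netPairs level next D k Odd).image (pairEdge φ)) := by
    rw [hG, FinGraph.removeNode_ofPairs_edges hφ, filter_root]
    exact hB
  have hkD : k ≤ D := by have := hN.root_le; omega
  refine ⟨G, φ, hφ, FinGraph.mem_ofPairs_verts hF, ?_, ?_, hA, hB',
    symmDiff_image_pairEdge hφ hF hEF hOF, (pairEdge_injOn hφ hF).mono ?_, fun T hT => ?_⟩
  -- Lower degrees are exactly `D`, so a hub exceeds `D` only if it has upward edges.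
  · refine FinGraph.ofPairs_isBounded hφ hF (X := (Finset.univ.filter
      fun h => (next h).Nonempty).image fun h => (some h, none)) (Finset.card_image_le.trans hl)
      fun x hx => ?_
    by_cases hx' : ∃ h, x = (some h, none)
    · obtain ⟨h, rfl⟩ := hx'
      have hne : next h = ∅ := by
        by_contra hne
        exact hx (Finset.mem_image_of_mem _ (Finset.mem_filter.mpr
          ⟨Finset.mem_univ _, Finset.nonempty_iff_ne_empty.mpr hne⟩))
      refine (card_netPairs_hub_le _ h).trans ?_
      have h1 := card_netPairs_out_le (level := level) (next := next) (D := D) (k := k)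
        (P := fun _ => True) h
      rw [hne, Finset.card_empty] at h1
      rw [card_netPairs_in hN.level_next hN.indeg_le trivial]
      omega
    · push Not at hx'
      exact card_netPairs_le_of_ne_hub hN.one_le hN.root_le hx'
  · exact (edgeDeg_image_le hφ _).trans (card_netPairs_root_le hkD _)
  · intro q hq
    rcases Finset.mem_symmDiff.mp hq with h | h
    · exact hEF h.1
    · exact hOF h.1
  · refine (G.edgeDist_removeNode_eq hT (FinGraph.mem_ofPairs_verts hF _) hA hB' ?_).trans ?_
    · obtain ⟨h, h0⟩ := hroot
      refine ⟨pairEdge φ ((none, none), (some h, none)), Finset.mem_image_of_mem _ ?_,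
        (mem_pairEdge hφ).mpr (Or.inl rfl)⟩
      exact mem_netPairs.mpr (Or.inr (Or.inr (Or.inl ⟨Even.zero, h, h0, rfl⟩)))
    · rw [card_symmDiff_image_pairEdge hφ hF hEF hOF, card_symmDiff hkD]

end IsNetwork

end Network

/-! ### Path and grid networks -/

section ProjectedTightness

variable {V : Type*} [LinearOrder V] [Infinite V]

theorem isNetwork_path (D l : ℕ) (hD : 1 ≤ D) :
    IsNetwork (Hub := Fin (l + 1)) (fun h => h)
      (fun h => Finset.univ.filter fun h' => (h' : ℕ) = h + 1) D 0 := by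
  have hone : ∀ n : ℕ, (Finset.univ.filter fun h : Fin (l + 1) => (h : ℕ) = n).card ≤ 1 := fun n =>
    Finset.card_le_one.mpr fun a ha b hb => Fin.ext
      ((Finset.mem_filter.mp ha).2.trans (Finset.mem_filter.mp hb).2.symm)
  have hin : ∀ h : Fin (l + 1), netIndeg (fun h : Fin (l + 1) => (h : ℕ))
      (fun h => Finset.univ.filter fun h' => (h' : ℕ) = h + 1) h = 1 := by
    intro h
    unfold netIndeg
    split_ifs with h0
    · rfl
    · have hpos : (h : ℕ) ≠ 0 := h0
      rw [Finset.card_eq_one]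
      refine ⟨⟨h - 1, by omega⟩, ?_⟩
      ext h'
      simp only [Finset.mem_filter, Finset.mem_univ, true_and, Finset.mem_singleton, Fin.ext_iff]
      omega
  refine ⟨hD, fun h h' hh => (Finset.mem_filter.mp hh).2, fun h => ?_, fun h => ?_, ?_⟩
  · rw [hin]
    exact hD
  · rw [hin]
    exact hone _
  · rw [zero_add]
    exact (hone 0).trans hD

/-- A path whose inner nodes have `D - 1` pendant leaves. -/
theorem exists_neighbor_dll (D l : ℕ) (hD : 1 ≤ D) :
    ∃ G G' : FinGraph V, G.IsBounded D l ∧ G'.IsBounded D l ∧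
      ∀ T : ℕ, 1 ≤ T → (G.instant T).EdgeNeighbor (G'.instant T) ∧
        (G.instant T).NodeNeighbor (G'.instant T) ∧
        ((G.instant T).dll (lexEdgeOrder V) D).edgeDist
          ((G'.instant T).dll (lexEdgeOrder V) D) = (l + 1 : ℕ) ∧
        ((G.instant T).dll (lexEdgeOrder V) D).nodeDist
          ((G'.instant T).dll (lexEdgeOrder V) D) = (if Even l then l + 1 else l + 2 : ℕ) := by
  have hN := isNetwork_path D l hD
  have hroot : (Finset.univ.filter fun h : Fin (l + 1) => (h : ℕ) = 0).card = 1 := by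
    rw [Finset.card_eq_one]
    refine ⟨0, ?_⟩
    ext h
    simp only [Finset.mem_filter, Finset.mem_univ, true_and, Finset.mem_singleton, Fin.ext_iff,
      Fin.val_zero]
  have hnext : ∀ h : Fin (l + 1), (Finset.univ.filter fun h' : Fin (l + 1) =>
      (h' : ℕ) = h + 1).card = if (h : ℕ) < l then 1 else 0 := by
    intro h
    split_ifs with hl
    · rw [Finset.card_eq_one]
      refine ⟨⟨h + 1, by omega⟩, ?_⟩
      ext h'
      simp [Fin.ext_iff]
    · rw [Finset.card_eq_zero, Finset.filter_eq_empty_iff]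
      intro h' _ h1
      have := h'.isLt
      omega
  have hsum : ∑ h : Fin (l + 1), (if (h : ℕ) < l then 1 else 0) = l := by
    rw [← Finset.card_filter]
    exact card_filter_lt_fin (Nat.le_succ l)
  obtain ⟨G, φ, hφ, hverts, hbdd, hdeg, hA, hB, hsymm, hinj, hdist⟩ :=
    hN.exists_graph (V := V) ⟨0, rfl⟩ (l := l) (by
      -- The last of the l + 1 hubs has no upward edge, so only `l` of them exceed degree `D`.
      refine (Finset.card_le_card (t := Finset.univ.filter fun h : Fin (l + 1) => (h : ℕ) < l)
        fun h hh => ?_).trans (card_filter_lt_fin (Nat.le_succ l)).le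
      refine Finset.mem_filter.mpr ⟨Finset.mem_univ _, ?_⟩
      have := Finset.card_pos.mpr (Finset.mem_filter.mp hh).2
      rw [hnext] at this
      by_contra hl
      simp [hl] at this)
  refine ⟨G, G.removeNode (φ (none, none)), hbdd, hbdd.removeNode _, fun T hT => ?_⟩
  have hrem := G.instant_removesNode hT (hverts (none, none))
  -- The root has degree at most 1, so its removal is an edge step as well as a node step.
  refine ⟨Or.inl (Or.inr ⟨_, ?_, hrem⟩), Or.inl ⟨_, hrem⟩, ?_, ?_⟩
  · unfold FinGraph.degree at hdeg ⊢
    rw [G.instant_flatten_edges hT]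
    exact hdeg.trans (by rw [hroot])
  · rw [hdist T hT, hroot, Finset.sum_congr rfl fun h _ => hnext h, hsum]
    congr 1
    omega
  -- A path on l + 1 hubs has a matching and a cover of size ⌊(l + 1)/2⌋: the edges joining the hubs
  -- 2i and 2i + 1, and the odd hubs.
  · have hl2 : (if Even l then l + 1 else l + 2 : ℕ) = 2 * ((l + 1) / 2) + 1 := by
      split_ifs with h
      · obtain ⟨m, rfl⟩ := h
        omega
      · obtain ⟨m, rfl⟩ := Nat.not_even_iff_odd.mp h
        omega
    rw [hl2]
    let hub : ℕ → Fin (l + 1) := fun i => Fin.ofNat (l + 1) i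
    have hub_val : ∀ i, i ≤ l → (hub i : ℕ) = i := fun i hi => Nat.mod_eq_of_lt (by omega)
    let pr : ℕ → NetVert (Fin (l + 1)) D × NetVert (Fin (l + 1)) D := fun i =>
      ((some (hub (2 * i)), none), (some (hub (2 * i + 1)), none))
    have hpr : ∀ i ∈ Finset.range ((l + 1) / 2), pr i ∈ symmDiff
        (netPairs (Hub := Fin (l + 1)) (fun h => h)
          (fun h => Finset.univ.filter fun h' => (h' : ℕ) = h + 1) D 0 Even)
        (netPairs (Hub := Fin (l + 1)) (fun h => h)
          (fun h => Finset.univ.filter fun h' => (h' : ℕ) = h + 1) D 0 Odd) := by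
      intro i hi
      have hi' := Finset.mem_range.mp hi
      refine IsNetwork.mem_symmDiff.mpr (Or.inr (Or.inr ⟨_, _, ?_, rfl⟩))
      rw [Finset.mem_filter, hub_val _ (by omega), hub_val _ (by omega)]
      exact ⟨Finset.mem_univ _, rfl⟩
    have hendpoint : ∀ i ∈ Finset.range ((l + 1) / 2), ∀ x, φ x ∈ pairEdge φ (pr i) →
        ∃ j : Fin (l + 1), x = (some j, none) ∧ (j : ℕ) / 2 = i := by
      intro i hi x hx
      have hi' := Finset.mem_range.mp hi
      rcases (mem_pairEdge hφ).mp hx with h | h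
      · exact ⟨_, h.symm, by rw [hub_val _ (by omega)]; omega⟩
      · exact ⟨_, h.symm, by rw [hub_val _ (by omega)]; omega⟩
    have huniq : ∀ i ∈ Finset.range ((l + 1) / 2), ∀ j ∈ Finset.range ((l + 1) / 2), ∀ v,
        v ∈ pairEdge φ (pr i) → v ∈ pairEdge φ (pr j) → i = j := by
      intro i hi j hj v hv hv'
      obtain ⟨x, rfl, -⟩ := exists_of_mem_pairEdge hv
      obtain ⟨a, ha, ha'⟩ := hendpoint i hi x hv
      obtain ⟨b, hb, hb'⟩ := hendpoint j hj x hv'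
      rw [ha] at hb
      simp only [Prod.mk.injEq, Option.some.injEq, and_true] at hb
      rw [← ha', ← hb', hb]
    refine G.nodeDist_removeNode_eq hT (hverts _) hA hB
      (X := (Finset.range ((l + 1) / 2)).image fun i => φ (some (hub (2 * i + 1)), none))
      (M := (Finset.range ((l + 1) / 2)).image fun i => pairEdge φ (pr i)) ?_ ?_ ?_ ?_ ?_
    · rw [hsymm]
      intro e he hne
      obtain ⟨q, hq, rfl⟩ := Finset.mem_image.mp he
      rcases IsNetwork.mem_symmDiff.mp hq with ⟨i, hi, rfl⟩ | ⟨a, -, rfl⟩ | ⟨a, b, hb, rfl⟩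
      · omega
      · exact absurd ((mem_pairEdge hφ).mpr (Or.inl rfl)) hne
      · have hb' := (Finset.mem_filter.mp hb).2
        have hbl := b.isLt
        -- The odd one among a and a + 1 is 2⌊a/2⌋ + 1.
        refine ⟨φ (some (hub (2 * ((a : ℕ) / 2) + 1)), none), Finset.mem_image.mpr
          ⟨(a : ℕ) / 2, Finset.mem_range.mpr (by omega), rfl⟩, (mem_pairEdge hφ).mpr ?_⟩
        have hv : ∀ c : Fin (l + 1), (c : ℕ) = 2 * ((a : ℕ) / 2) + 1 →
            c = hub (2 * ((a : ℕ) / 2) + 1) := fun c hc =>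
          Fin.ext (by rw [hub_val _ (by omega)]; exact hc)
        rcases Nat.even_or_odd (a : ℕ) with ⟨m, hm⟩ | ⟨m, hm⟩
        · right
          rw [← hv b (by omega)]
        · left
          rw [← hv a (by omega)]
    · exact Finset.card_image_le.trans (by simp)
    · intro e he
      obtain ⟨i, hi, rfl⟩ := Finset.mem_image.mp he
      rw [hsymm, mem_pairEdge hφ]
      exact ⟨Finset.mem_image_of_mem _ (hpr i hi), by simp [pr]⟩
    · intro e he f hf v hv hv'
      obtain ⟨i, hi, rfl⟩ := Finset.mem_image.mp he
      obtain ⟨j, hj, rfl⟩ := Finset.mem_image.mp hf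
      rw [huniq i hi j hj v hv hv']
    · rw [Finset.card_image_of_injOn, Finset.card_range]
      intro i hi j hj hij
      refine huniq i hi j hj (φ (pr i).1) ((mem_pairEdge hφ).mpr (Or.inl rfl)) ?_
      have hij' : pairEdge φ (pr i) = pairEdge φ (pr j) := hij
      rw [← hij']
      exact (mem_pairEdge hφ).mpr (Or.inl rfl)

/-- The levels of the grid: `s ^ 2` hubs of level `0` and `m` layers of `s` hubs. -/
def gridLevel (s m : ℕ) : (Fin s × Fin s) ⊕ (Fin m × Fin s) → ℕ
  | .inl _ => 0
  | .inr x => x.1 + 1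

/-- Each hub of the first layer is joined to `s` hubs of level `0`, and consecutive layers are
completely joined. -/
def gridNext (s m : ℕ) (h : (Fin s × Fin s) ⊕ (Fin m × Fin s)) :
    Finset ((Fin s × Fin s) ⊕ (Fin m × Fin s)) :=
  match h with
  | .inl x => Finset.univ.filter fun h' => ∃ y, h' = .inr y ∧ (y.1 : ℕ) = 0 ∧ y.2 = x.1
  | .inr x => Finset.univ.filter fun h' => ∃ y, h' = .inr y ∧ (y.1 : ℕ) = x.1 + 1

theorem card_gridNext_inl {s m : ℕ} (hm : 1 ≤ m) (x : Fin s × Fin s) :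
    (gridNext s m (.inl x)).card = 1 := by
  rw [Finset.card_eq_one]
  refine ⟨.inr (⟨0, hm⟩, x.1), ?_⟩
  ext h'
  simp only [gridNext, Finset.mem_filter, Finset.mem_univ, true_and, Finset.mem_singleton]
  constructor
  · rintro ⟨⟨j, a⟩, rfl, h1, h2⟩
    rw [← h2]
    congr 2
    exact Fin.ext h1
  · rintro rfl
    exact ⟨_, rfl, rfl, rfl⟩

theorem card_gridNext_inr {s m : ℕ} (x : Fin m × Fin s) :
    (gridNext s m (.inr x)).card = if (x.1 : ℕ) + 1 < m then s else 0 := by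
  split_ifs with h
  · have : gridNext s m (.inr x) = Finset.univ.image
        fun a : Fin s => (.inr (⟨x.1 + 1, h⟩, a) : (Fin s × Fin s) ⊕ (Fin m × Fin s)) := by
      ext h'
      simp only [gridNext, Finset.mem_filter, Finset.mem_univ, true_and, Finset.mem_image]
      constructor
      · rintro ⟨⟨j, a⟩, rfl, h1⟩
        refine ⟨a, ?_⟩
        congr 2
        exact Fin.ext h1.symm
      · rintro ⟨a, rfl⟩
        exact ⟨_, rfl, rfl⟩
    rw [this, Finset.card_image_of_injective]
    · simp
    · intro a b hab
      simpa using hab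
  · rw [Finset.card_eq_zero]
    simp only [gridNext, Finset.filter_eq_empty_iff]
    rintro h' - ⟨⟨j, a⟩, -, h1⟩
    have := j.isLt
    simp only at h1
    omega

theorem gridIndeg_inr {s m : ℕ} (x : Fin m × Fin s) :
    netIndeg (gridLevel s m) (gridNext s m) (.inr x) = s := by
  obtain ⟨j, a⟩ := x
  have h0 : gridLevel s m (.inr (j, a)) ≠ 0 := by simp [gridLevel]
  simp only [netIndeg, if_neg h0]
  by_cases hj : (j : ℕ) = 0
  · have : (Finset.univ.filter fun h' => (.inr (j, a)) ∈ gridNext s m h') = Finset.univ.image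
        fun b : Fin s => (.inl (a, b) : (Fin s × Fin s) ⊕ (Fin m × Fin s)) := by
      ext h'
      simp only [Finset.mem_filter, Finset.mem_univ, true_and, Finset.mem_image]
      rcases h' with ⟨c, d⟩ | ⟨i, c⟩
      · simp [gridNext, hj]
      · simp [gridNext, hj]
    rw [this, Finset.card_image_of_injective]
    · simp
    · intro a b hab
      simpa using hab
  · have hlt := j.isLt
    have : (Finset.univ.filter fun h' => (.inr (j, a)) ∈ gridNext s m h') = Finset.univ.image
        fun b : Fin s => (.inr (⟨j - 1, by omega⟩, b) : (Fin s × Fin s) ⊕ (Fin m × Fin s)) := by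
      ext h'
      simp only [Finset.mem_filter, Finset.mem_univ, true_and, Finset.mem_image]
      rcases h' with ⟨c, d⟩ | ⟨i, c⟩
      · simp [gridNext, hj]
      · simp only [gridNext, Finset.mem_filter, Finset.mem_univ, true_and, Sum.inr.injEq,
          exists_eq_left', Prod.mk.injEq, Fin.ext_iff, exists_and_left]
        constructor
        · intro h
          exact ⟨by omega, c, rfl⟩
        · rintro ⟨h, -⟩
          omega
    rw [this, Finset.card_image_of_injective]
    · simp
    · intro a b hab
      simpa using hab

theorem card_gridLevel_zero (s m : ℕ) :
    (Finset.univ.filter (gridLevel s m · = 0)).card = s * s := by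
  have : Finset.univ.filter (gridLevel s m · = 0) = Finset.univ.image
      (Sum.inl : Fin s × Fin s → (Fin s × Fin s) ⊕ (Fin m × Fin s)) := by
    ext h
    simp only [Finset.mem_filter, Finset.mem_univ, true_and, Finset.mem_image]
    rcases h with h | h <;> simp [gridLevel]
  rw [this, Finset.card_image_of_injective _ Sum.inl_injective]
  simp

/-- A layer hub has `s` edges from below and at most `s` upward; a hub of level 0 has one of each.
The D - s² leaves bring the degree of the root to exactly `D`, so that the root contributes `D`
differing edges. -/
theorem isNetwork_grid {s m D : ℕ} (hs : 1 ≤ s) (hm : 1 ≤ m) (hD : s * s ≤ D) :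
    IsNetwork (gridLevel s m) (gridNext s m) D (D - s * s) := by
  have hsD : s ≤ D := (Nat.le_mul_self s).trans hD
  refine ⟨hs.trans hsD, ?_, ?_, ?_, ?_⟩
  · rintro (x | x) h' hh
    · obtain ⟨-, y, rfl, hy, -⟩ := Finset.mem_filter.mp hh
      simp [gridLevel, hy]
    · obtain ⟨-, y, rfl, hy⟩ := Finset.mem_filter.mp hh
      simp [gridLevel, hy]
  · rintro (x | x)
    · simp only [netIndeg, gridLevel, if_true]
      exact hs.trans hsD
    · rw [gridIndeg_inr]
      exact hsD
  · rintro (x | x)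
    · rw [card_gridNext_inl hm]
      simp [netIndeg, gridLevel]
    · rw [card_gridNext_inr, gridIndeg_inr]
      split_ifs <;> omega
  · rw [card_gridLevel_zero]
    omega

theorem sum_card_gridNext {s m : ℕ} (hm : 1 ≤ m) :
    ∑ h, (gridNext s m h).card = m * (s * s) := by
  rw [Fintype.sum_sum_type]
  simp only [card_gridNext_inl hm, card_gridNext_inr]
  rw [Fintype.sum_prod_type (f := fun x : Fin m × Fin s => if (x.1 : ℕ) + 1 < m then s else 0)]
  have h1 : ∑ j : Fin m, (if (j : ℕ) + 1 < m then s else 0) = (m - 1) * s := by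
    rw [← Finset.sum_filter, Finset.sum_const, smul_eq_mul]
    congr 1
    have : (Finset.univ.filter fun j : Fin m => (j : ℕ) + 1 < m) =
        Finset.univ.filter fun j : Fin m => (j : ℕ) < m - 1 := by
      ext j
      simp only [Finset.mem_filter, Finset.mem_univ, true_and]
      omega
    rw [this, card_filter_lt_fin (Nat.sub_le _ _)]
  rw [Finset.sum_comm (s := (Finset.univ : Finset (Fin m))), Finset.sum_congr rfl fun _ _ => h1]
  simp only [Finset.sum_const, Finset.card_univ, Fintype.card_prod, Fintype.card_fin, smul_eq_mul,
    mul_one]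
  obtain ⟨n, rfl⟩ := Nat.exists_eq_add_of_le hm
  rw [Nat.add_sub_cancel_left]
  ring

theorem card_gridNext_nonempty_le (s m : ℕ) :
    (Finset.univ.filter fun h => (gridNext s m h).Nonempty).card ≤ s * s + (m - 1) * s := by
  refine (Finset.card_le_card (t := (Finset.univ.image Sum.inl) ∪
    ((Finset.univ.filter fun j : Fin m => (j : ℕ) < m - 1) ×ˢ Finset.univ).image Sum.inr)
    fun h hh => ?_).trans ((Finset.card_union_le _ _).trans
      ((add_le_add Finset.card_image_le Finset.card_image_le).trans ?_))
  · rw [Finset.mem_union]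
    rcases h with x | x
    · exact Or.inl (Finset.mem_image_of_mem _ (Finset.mem_univ _))
    · refine Or.inr (Finset.mem_image_of_mem _ ?_)
      have := Finset.card_pos.mpr (Finset.mem_filter.mp hh).2
      rw [card_gridNext_inr] at this
      simp only [Finset.mem_product, Finset.mem_filter, Finset.mem_univ, true_and, and_true]
      split_ifs at this with h
      · omega
      · omega
  · rw [Finset.card_product, card_filter_lt_fin (Nat.sub_le _ _)]
    simp

/-- With k = min {D, l}, `s` is about √k / 2. Thus s² ≤ k/4 leaves at least three quarters of `l`
for layers of `s` hubs, which gives m s ≥ 3l/4, while 4s ≥ √k. The threshold 16 makes s ≥ 2. -/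
theorem exists_grid_parameters {D l : ℕ} (hD : 16 ≤ D) (hl : 16 ≤ l) :
    ∃ s m : ℕ, 1 ≤ s ∧ 1 ≤ m ∧ s * s ≤ D ∧ s * s + (m - 1) * s ≤ l ∧
      (1 / 8 : ℝ) * l * √(min (D : ℝ) l) ≤ (m * (s * s) : ℕ) := by
  set k := min D l with hk
  have hk16 : 16 ≤ k := le_min hD hl
  set u := Nat.sqrt k with hu
  have hu1 : u * u ≤ k := Nat.sqrt_le k
  have hu2 : k < (u + 1) * (u + 1) := Nat.lt_succ_sqrt k
  have hu4 : 4 ≤ u := Nat.le_sqrt.mpr (by omega)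
  set s := u / 2 with hs
  have hs2 : u ≤ 2 * s + 1 := by omega
  have hs1 : 2 ≤ s := by omega
  have hss : 4 * (s * s) ≤ k := by
    have : 2 * s ≤ u := by omega
    nlinarith
  have hkD : k ≤ D := min_le_left _ _
  have hkl : k ≤ l := min_le_right _ _
  have hdiv := Nat.div_add_mod (l - s * s) s
  have hmod := Nat.mod_lt (l - s * s) (show s > 0 by omega)
  set n := (l - s * s) / s with hn
  have hms : n * s ≤ l - s * s := by rw [mul_comm]; omega
  have hml : 3 * l ≤ 4 * ((n + 1) * s) := by
    have : l - s * s < (n + 1) * s := by rw [add_mul, mul_comm n]; omega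
    omega
  refine ⟨s, n + 1, by omega, Nat.le_add_left 1 n, by omega, by rw [Nat.add_sub_cancel]; omega, ?_⟩
  have hsqrt : √(min (D : ℝ) l) ≤ u + 1 := by
    rw [← Nat.cast_min]
    refine Real.sqrt_le_iff.mpr ⟨by positivity, ?_⟩
    have : (k : ℝ) ≤ ((u + 1) * (u + 1) : ℕ) := by exact_mod_cast hu2.le
    push_cast at this
    rw [sq]
    exact this
  have hus : (u : ℝ) + 1 ≤ 4 * s := by
    have : u + 1 ≤ 4 * s := by omega
    exact_mod_cast this
  have hml' : (3 : ℝ) * l ≤ 4 * ((n + 1) * s) := by exact_mod_cast hml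
  have hl0 : (0 : ℝ) ≤ l := by positivity
  have hs0 : (0 : ℝ) ≤ s := by positivity
  calc (1 / 8 : ℝ) * l * √(min (D : ℝ) l) ≤ (1 / 8 : ℝ) * l * (4 * s) := by
        gcongr
        exact hsqrt.trans hus
    _ ≤ (n + 1) * s * s := by nlinarith
    _ = (((n + 1) * (s * s) : ℕ) : ℝ) := by push_cast; ring

theorem exists_nodeNeighbor_dll {D l : ℕ} (hD : 16 ≤ D) (hl : 16 ≤ l) :
    ∃ G G' : FinGraph V, G.IsBounded D l ∧ G'.IsBounded D l ∧
      ∃ n : ℕ, (D : ℝ) + (1 / 8 : ℝ) * l * √(min (D : ℝ) l) ≤ n ∧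
      ∀ T : ℕ, 1 ≤ T → (G.instant T).NodeNeighbor (G'.instant T) ∧
        ((G.instant T).dll (lexEdgeOrder V) D).edgeDist
          ((G'.instant T).dll (lexEdgeOrder V) D) = n := by
  obtain ⟨s, m, hs, hm, hsD, hsl, hreal⟩ := exists_grid_parameters hD hl
  have hs0 : 0 < s := hs
  obtain ⟨G, φ, -, hverts, hbdd, -, -, -, -, -, hdist⟩ :=
    (isNetwork_grid hs hm hsD).exists_graph (V := V) ⟨.inl (⟨0, hs0⟩, ⟨0, hs0⟩), rfl⟩
      ((card_gridNext_nonempty_le s m).trans hsl)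
  refine ⟨G, G.removeNode (φ (none, none)), hbdd, hbdd.removeNode _, D + m * (s * s), ?_,
    fun T hT => ⟨Or.inl ⟨_, G.instant_removesNode hT (hverts _)⟩, ?_⟩⟩
  · push_cast at hreal ⊢
    linarith
  · rw [hdist T hT, card_gridLevel_zero, sum_card_gridNext hm, Nat.sub_add_cancel hsD]

end ProjectedTightness

/-! ### Assembly of the bounds and the examples -/

theorem mainTheorem1 :
    -- Upper bounds: any node identifiers, any fixed order of the edges.
    (∀ (V : Type*) [DecidableEq V] (ord : LinearOrder (Sym2 V)) (D l T : ℕ), 1 ≤ D →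
      -- Both projections output a `D`-bounded stream.
      (∀ (S : GraphStream V T) (t : ℕ) (ht : t ≤ T),
        ((S.bbds ord D).upTo t ht).flatten.MaxDegreeLE D ∧
        ((S.dll ord D).upTo t ht).flatten.MaxDegreeLE D) ∧
      -- Edge-to-edge stability.
      (∀ S S' : GraphStream V T, S.EdgeNeighbor S' → ∀ (t : ℕ) (ht : t ≤ T),
        ((S.bbds ord D).upTo t ht).edgeDist ((S'.bbds ord D).upTo t ht) ≤ 3 ∧
        (S.BoundedThrough D l t ht → S'.BoundedThrough D l t ht →
          ((S.dll ord D).upTo t ht).edgeDist ((S'.dll ord D).upTo t ht) ≤ (2 * l + 1 : ℕ))) ∧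
      -- Node-to-edge and node-to-node stability.
      (∀ S S' : GraphStream V T, S.NodeNeighbor S' → ∀ (t : ℕ) (ht : t ≤ T),
        S.BoundedThrough D l t ht → S'.BoundedThrough D l t ht →
          ((S.bbds ord D).upTo t ht).edgeDist ((S'.bbds ord D).upTo t ht) ≤ (D + l : ℕ) ∧
          (∃ n : ℕ, ((S.dll ord D).upTo t ht).edgeDist ((S'.dll ord D).upTo t ht) = n ∧
            (n : ℝ) ≤ (D : ℝ) + 2 * (l : ℝ) * √(min (D : ℝ) (l : ℝ))) ∧
          ((S.bbds ord D).upTo t ht).nodeDist ((S'.bbds ord D).upTo t ht) ≤ (2 * l + 1 : ℕ) ∧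
          ((S.dll ord D).upTo t ht).nodeDist ((S'.dll ord D).upTo t ht) ≤ (2 * l + 1 : ℕ))) ∧
    -- Tightness: any infinite linearly ordered set of identifiers, lexicographic edge order.
    (∀ (V : Type*) [LinearOrder V] [Infinite V] (D l T : ℕ), 1 ≤ D → 1 ≤ T →
      -- Edge-to-edge, original criterion.
      (∃ S S' : GraphStream V T, S.EdgeNeighbor S' ∧ ∀ (t : ℕ) (ht : t ≤ T), 1 ≤ t →
        ((S.bbds (lexEdgeOrder V) D).upTo t ht).edgeDist
          ((S'.bbds (lexEdgeOrder V) D).upTo t ht) = 3) ∧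
      -- Edge-to-edge, projected criterion.
      (∃ S S' : GraphStream V T, S.EdgeNeighbor S' ∧
        S.flatten.IsBounded D l ∧ S'.flatten.IsBounded D l ∧
        ∀ (t : ℕ) (ht : t ≤ T), 1 ≤ t →
          ((S.dll (lexEdgeOrder V) D).upTo t ht).edgeDist
            ((S'.dll (lexEdgeOrder V) D).upTo t ht) = (l + 1 : ℕ)) ∧
      -- Node-to-edge, original criterion; `l - 1` is truncated, so it means `max (l - 1) 0`.
      (∃ S S' : GraphStream V T, S.NodeNeighbor S' ∧
        S.flatten.IsBounded D l ∧ S'.flatten.IsBounded D l ∧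
        ∀ (t : ℕ) (ht : t ≤ T), 1 ≤ t →
          ((S.bbds (lexEdgeOrder V) D).upTo t ht).edgeDist
            ((S'.bbds (lexEdgeOrder V) D).upTo t ht) = (D + (l - 1) : ℕ)) ∧
      -- Node-to-node, original criterion; `l - 1` is truncated, so it means `max (l - 1) 0`.
      (∃ S S' : GraphStream V T, S.NodeNeighbor S' ∧
        S.flatten.IsBounded D l ∧ S'.flatten.IsBounded D l ∧
        ∀ (t : ℕ) (ht : t ≤ T), 1 ≤ t →
          ((S.bbds (lexEdgeOrder V) D).upTo t ht).nodeDist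
            ((S'.bbds (lexEdgeOrder V) D).upTo t ht) = (2 * (l - 1) + 1 : ℕ)) ∧
      -- Node-to-node, projected criterion: `l + 1` for even `l`, and `l + 2` for odd `l`.
      (∃ S S' : GraphStream V T, S.NodeNeighbor S' ∧
        S.flatten.IsBounded D l ∧ S'.flatten.IsBounded D l ∧
        ∀ (t : ℕ) (ht : t ≤ T), 1 ≤ t →
          ((S.dll (lexEdgeOrder V) D).upTo t ht).nodeDist
            ((S'.dll (lexEdgeOrder V) D).upTo t ht) = (if Even l then l + 1 else l + 2 : ℕ))) ∧
    -- Node-to-edge tightness, projected criterion: absolute constants `c` and `N`.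
    (∃ c : ℝ, 0 < c ∧ ∃ N : ℕ, ∀ (V : Type*) [LinearOrder V] [Infinite V] (D l T : ℕ),
      N ≤ D → N ≤ l → 1 ≤ T →
      ∃ S S' : GraphStream V T, S.NodeNeighbor S' ∧
        S.flatten.IsBounded D l ∧ S'.flatten.IsBounded D l ∧
        ∀ (t : ℕ) (ht : t ≤ T), 1 ≤ t →
          ∃ n : ℕ, ((S.dll (lexEdgeOrder V) D).upTo t ht).edgeDist
              ((S'.dll (lexEdgeOrder V) D).upTo t ht) = n ∧
            (D : ℝ) + c * (l : ℝ) * √(min (D : ℝ) (l : ℝ)) ≤ (n : ℝ)) := by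
  -- The constants are those of `exists_grid_parameters`.
  refine ⟨?_, ?_, 1 / 8, by norm_num, 16, ?_⟩
  · intro V _ ord D l T hD
    refine ⟨fun S t ht => ?_, fun S S' h t ht => GraphStream.proj_stability_of_edgeNeighbor h t ht,
      fun S S' h t ht hS hS' => GraphStream.proj_stability_of_nodeNeighbor h t ht hD hS hS'⟩
    rw [GraphStream.proj_upTo, GraphStream.proj_upTo]
    exact ⟨GraphStream.proj_maxDegreeLE _ _ _ _, GraphStream.proj_maxDegreeLE _ _ _ _⟩
  · intro V _ _ D l T hD hT
    obtain ⟨G₁, G₁', h₁⟩ := exists_edgeNeighbor_bbds (V := V) D hD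
    obtain ⟨G₂, G₂', b₂, b₂', h₂⟩ := exists_neighbor_dll (V := V) D l hD
    obtain ⟨G₃, G₃', b₃, b₃', h₃⟩ := exists_nodeNeighbor_bbds (V := V) D l hD
    rw [← FinGraph.instant_isBounded_iff _ hT] at b₂ b₂' b₃ b₃'
    simp only [GraphStream.proj_upTo]
    -- For t ≥ 1 the prefix of length t of an instant stream is by definition the instant stream of
    -- length t, so the examples are used with length t.
    exact ⟨⟨_, _, (h₁ T hT).1, fun t _ h1 => (h₁ t h1).2⟩,
      ⟨_, _, (h₂ T hT).1, b₂, b₂', fun t _ h1 => (h₂ t h1).2.2.1⟩,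
      ⟨_, _, (h₃ T hT).1, b₃, b₃', fun t _ h1 => (h₃ t h1).2.1⟩,
      ⟨_, _, (h₃ T hT).1, b₃, b₃', fun t _ h1 => (h₃ t h1).2.2⟩,
      ⟨_, _, (h₂ T hT).2.1, b₂, b₂', fun t _ h1 => (h₂ t h1).2.2.2⟩⟩
  · intro V _ _ D l T hD hl hT
    obtain ⟨G, G', b, b', n, hn, h⟩ := exists_nodeNeighbor_dll (V := V) hD hl
    rw [← FinGraph.instant_isBounded_iff _ hT] at b b'
    simp only [GraphStream.proj_upTo]
    exact ⟨_, _, (h T hT).1, b, b', fun t _ h1 => ⟨n, (h t h1).2, hn⟩⟩
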